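/- Let $n\ge 3$, $\mathbb R^n_+=\{x=(\tilde x,x_n): \tilde x\in\mathbb R^{n-1},\ x_n>0\}$, and let $K<0$, $H>0$ be constants such that $$\mathfrak D_n:=\sqrt{n(n-1)}\,\frac{H}{\sqrt{|K|}}>1.$$ Put $\alpha_n=(4n(n-1))^{\frac{n-2}{4}}$ and $$U(x)=\frac{\alpha_n}{|K|^{\frac{n-2}{4}}}\,\frac{1}{\left(|\tilde x|^2+(x_n+\mathfrak D_n)^2-1\right)^{\frac{n-2}{2}}}.$$ Let $v\in H^1(\mathbb R^n_+)$ be a (real-valued, weak) solution of the linearized problem $$\begin{cases}-\frac{4(n-1)}{n-2}\Delta v+\frac{n+2}{n-2}|K|\,U^{\frac{4}{n-2}}v=0 & \text{in }\mathbb R^n_+,\\[1mm] \frac{2}{n-2}\frac{\partial v}{\partial\nu}-\frac{n}{n-2}H\,U^{\frac{2}{n-2}}v=0 & \text{on }\partial\mathbb R^n_+,\end{cases}$$ where $\nu=-\mathfrak e_n$ is the exterior unit normal; that is, for every $\varphi\in C_c^\infty(\mathbb R^n)$, $$\tfrac{4(n-1)}{n-2}\int_{\mathbb R^n_+}\nabla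 v\cdot\nabla\varphi\,dx+\tfrac{n+2}{n-2}|K|\int_{\mathbb R^n_+}U^{\frac4{n-2}}v\varphi\,dx=\tfrac{4(n-1)}{n-2}\cdot\tfrac n2 H\int_{\partial\mathbb R^n_+}U^{\frac2{n-2}}v\varphi\,d\tilde x ,$$ with $v$ on $\partial\mathbb R^n_+$ understood as its trace. Then $v$ is (almost everywhere) a linear combination, with real coefficients, of the $n$ functions $$\mathfrak z_i(x):=\frac{\partial U}{\partial x_i}(x)=\frac{\alpha_n}{|K|^{\frac{n-2}{4}}}\,\frac{(2-n)\,x_i}{\left(|\tilde x|^2+(x_n+\mathfrak D_n)^2-1\right)^{\frac n2}},\qquad i=1,\dots,n-1,$$ and $$\mathfrak z_n(x):=\frac{2-n}{2}U(x)-\nabla U(x)\cdot(x+\mathfrak D_n\mathfrak e_n)+\mathfrak D_n\frac{\partial U}{\partial x_n}(x)=\frac{\alpha_n}{|K|^{\frac{n-2}{4}}}\,\frac{n-2}{2}\,\frac{|x|^2+1-\mathfrak D_n^2}{\left(|\tilde x|^2+(x_n+\mathfrak D_n)^2-1\right)^{\frac n2}},$$ where both explicit formulas hold on $\{x_n\ge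 0\}$. -/

import Mathlib

open MeasureTheory Filter Topology
open scoped ContDiff ENNReal

/-! The ambient space is `ℝⁿ` with `n = m + 1`, modelled as `EuclideanSpace ℝ (Fin (m + 1))`; a point
is `x = (x̃, x_n)` with `x̃ = (x_1, …, x_{n-1})` given by the coordinates `Fin.castSucc i`, `i : Fin m`,
and `x_n` the coordinate `Fin.last m`. -/

namespace HalfSpaceBubble

noncomputable section

/-- Euclidean space `ℝⁿ`, `n = m + 1`. -/
abbrev Space (m : ℕ) : Type := EuclideanSpace ℝ (Fin (m + 1))

/-- The boundary hyperplane `∂ℝⁿ₊ ≅ ℝⁿ⁻¹`. -/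
abbrev Bdry (m : ℕ) : Type := EuclideanSpace ℝ (Fin m)

/-- The dimension `n = m + 1`, as a real number. -/
abbrev dim (m : ℕ) : ℝ := (m : ℝ) + 1

/-- The open half-space `ℝⁿ₊ = {x : x_n > 0}`. -/
def halfSpace (m : ℕ) : Set (Space m) := {x | 0 < x (Fin.last m)}

/-- The inclusion `x̃ ↦ (x̃, 0)` of the boundary into `ℝⁿ`. -/
def bdryPt {m : ℕ} (y : Bdry m) : Space m :=
  WithLp.toLp 2 (Fin.snoc (α := fun _ => ℝ) (fun i => y i) 0)

/-- The coordinate vector `𝔢_i`. -/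
def coordVec {m : ℕ} (i : Fin (m + 1)) : Space m := EuclideanSpace.single i (1 : ℝ)

/-- Lebesgue measure on the half-space. -/
def halfVol (m : ℕ) : Measure (Space m) := volume.restrict (halfSpace m)

/-- Test functions of class `C_c^∞(ℝⁿ)` (they need not vanish on `∂ℝⁿ₊`). -/
def IsTest {m : ℕ} (φ : Space m → ℝ) : Prop := ContDiff ℝ ∞ φ ∧ HasCompactSupport φ

/-- `G` is the distributional gradient of `v` on the open half-space. -/
def IsWeakGradient {m : ℕ} (v : Space m → ℝ) (G : Space m → Space m) : Prop :=
  ∀ φ : Space m → ℝ, IsTest φ → tsupport φ ⊆ halfSpace m → ∀ i : Fin (m + 1),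
    ∫ x, v x * fderiv ℝ φ x (coordVec i) ∂(halfVol m) = -∫ x, G x i * φ x ∂(halfVol m)

/-- `v ∈ H¹(ℝⁿ₊)` with weak gradient `G`. -/
def IsH1With {m : ℕ} (v : Space m → ℝ) (G : Space m → Space m) : Prop :=
  MemLp v 2 (halfVol m) ∧ MemLp G 2 (halfVol m) ∧ IsWeakGradient v G

/-- The Sobolev space `H¹(ℝⁿ₊)`. -/
def MemH1 {m : ℕ} (v : Space m → ℝ) : Prop := ∃ G : Space m → Space m, IsH1With v G

/-- `τ ∈ L²(∂ℝⁿ₊)` is the trace of the `H¹` function `v` (with weak gradient `G`): the value at `v` of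
the continuous extension to `H¹(ℝⁿ₊)` of the restriction map `φ ↦ φ|_{∂ℝⁿ₊}`, `φ ∈ C_c^∞(ℝⁿ)`. -/
def IsTrace {m : ℕ} (v : Space m → ℝ) (G : Space m → Space m) (τ : Bdry m → ℝ) : Prop :=
  MemLp τ 2 volume ∧ ∃ φ : ℕ → Space m → ℝ, (∀ k, IsTest (φ k)) ∧
    Tendsto (fun k => eLpNorm (fun x => φ k x - v x) 2 (halfVol m)) atTop (𝓝 0) ∧
    Tendsto (fun k => eLpNorm (fun x => gradient (φ k) x - G x) 2 (halfVol m)) atTop (𝓝 0) ∧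
    Tendsto (fun k => eLpNorm (fun y => φ k (bdryPt y) - τ y) 2 volume) atTop (𝓝 0)

/-- `𝔇_n = √(n(n-1)) H / √|K|`. -/
def scalingD (m : ℕ) (K H : ℝ) : ℝ := √(dim m * (dim m - 1)) * H / √|K|

/-- `|x̃|² + (x_n + 𝔇_n)² - 1`. -/
def rho {m : ℕ} (K H : ℝ) (x : Space m) : ℝ :=
  (∑ i : Fin m, x (Fin.castSucc i) ^ 2) + (x (Fin.last m) + scalingD m K H) ^ 2 - 1

/-- `α_n / |K|^((n-2)/4)` with `α_n = (4n(n-1))^((n-2)/4)`. -/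
def bubbleConst (m : ℕ) (K : ℝ) : ℝ :=
  (4 * dim m * (dim m - 1)) ^ ((dim m - 2) / 4) / |K| ^ ((dim m - 2) / 4)

/-- The bubble `U`. -/
def bubble {m : ℕ} (K H : ℝ) (x : Space m) : ℝ :=
  bubbleConst m K * (1 / rho K H x ^ ((dim m - 2) / 2))

/-- `𝔷_i = ∂U/∂x_i` for `i = 1, …, n-1`. -/
def zTan {m : ℕ} (K H : ℝ) (i : Fin m) (x : Space m) : ℝ :=
  fderiv ℝ (bubble K H) x (coordVec (Fin.castSucc i))

/-- `𝔷_n = (2-n)/2 U - ∇U · (x + 𝔇_n 𝔢_n) + 𝔇_n ∂U/∂x_n`. -/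
def zDil {m : ℕ} (K H : ℝ) (x : Space m) : ℝ :=
  (2 - dim m) / 2 * bubble K H x
    - inner ℝ (gradient (bubble K H) x) (x + scalingD m K H • coordVec (Fin.last m))
    + scalingD m K H * fderiv ℝ (bubble K H) x (coordVec (Fin.last m))

/-- `v ∈ H¹(ℝⁿ₊)` is a weak solution of the linearized problem
`-c_n Δv + (n+2)/(n-2) |K| U^(4/(n-2)) v = 0` in `ℝⁿ₊`, `c_n = 4(n-1)/(n-2)`,
`2/(n-2) ∂v/∂ν - n/(n-2) H U^(2/(n-2)) v = 0` on `∂ℝⁿ₊`, `ν = -𝔢_n`: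
the equation is multiplied by `φ` and integrated by parts, and
`∂v/∂ν = (n/2) H U^(2/(n-2)) v` is inserted in the boundary term `c_n ∫ (∂v/∂ν) φ`. -/
def IsWeakSolution {m : ℕ} (K H : ℝ) (v : Space m → ℝ) : Prop :=
  ∃ (G : Space m → Space m) (τ : Bdry m → ℝ), IsH1With v G ∧ IsTrace v G τ ∧
    ∀ φ : Space m → ℝ, IsTest φ →
      4 * (dim m - 1) / (dim m - 2) * ∫ x, inner ℝ (G x) (gradient φ x) ∂(halfVol m)
        + (dim m + 2) / (dim m - 2) * |K| *
            ∫ x, bubble K H x ^ (4 / (dim m - 2)) * v x * φ x ∂(halfVol m)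
      = 4 * (dim m - 1) / (dim m - 2) *
          (dim m / 2 * H *
            ∫ y : Bdry m, bubble K H (bdryPt y) ^ (2 / (dim m - 2)) * τ y * φ (bdryPt y))

end

end HalfSpaceBubble

/-!
Put `D = 𝔇_n`, `z = x + D 𝔢_n` and `q = |z|² - 1` (`quad`). The bubble is a constant times
`q^{-(n-2)/2}`, and after division by a constant the linearized problem reads `-Δv + n(n+2) q⁻² v =
0` in the half-space, `∂v/∂ν = n D q⁻¹ v` on its boundary. The metric `4 q⁻² |dz|²` on `|z| > 1` is
hyperbolic, and the half-space is a geodesic ball in it. Conformal covariance yields explicit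
solutions: `q^{-(n-2)/2} f(t)` (`profile`), where `t` is a linear form on Minkowski space restricted
to the hyperboloid (`ratio`), solves the interior equation as soon as `f` satisfies an ordinary
differential equation (`divergence_profileGrad`, `IsAdmissible`). Green's formula then turns the
weak formulation, tested with such a profile, into an integral over the boundary
(`linearizedForm_profile`). Two families of profiles are used, in coordinates in which the boundary
is the unit sphere (`spherePt`) and the ball is centred:

* `f(t) = t` with vectors `(0, b)`: these satisfy the boundary condition as well, their restrictions
  to the boundary sphere are the linear functions, and they span the same space as `𝔷_1, …, 𝔷_n`
  (`exists_profile_id_eq_sum`);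
* `f(t) = t⁻ⁿ` with light-like vectors `(1, b)`, `|b| = 1`: the horospherical waves.

Given a weak solution, subtract from it a profile of the first family so that its weighted trace `g`
becomes orthogonal to the linear functions on the sphere. Testing with all horospherical waves says
that `w(ξ) = ∫ ((n+1) s⁻ⁿ - n (1-|ξ|²) s⁻ⁿ⁻¹) g`, `s = 1 - ⟨ξ, θ⟩`, vanishes on the sphere `|ξ| =
1/D` (`kleinPotential`, `boundaryDefect_horospherical`). Now `w` satisfies an elliptic equation with
zeroth order coefficient `-n(n-1) < 0` in the unit ball (`kleinPotential_equation`), so that `w = 0`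
for `|ξ| ≤ 1/D` by the maximum principle. This is an ordinary differential equation along rays for
`V(ξ) = ∫ s⁻ⁿ g`; as `g` has no first moments, `V` vanishes
(`ridgeTransform_eq_zero_of_kleinPotential`). Differentiating along rays, `∫ s⁻ᵖ g = 0` for all `p ≥
n`, hence `∫ h(⟨ξ, θ⟩) g = 0` for continuous `h`; in particular the Fourier transform of `g`
vanishes and `g = 0` (`ae_eq_zero_of_kleinPotential_eq_zero`). A solution without trace vanishes
because its energy does (`IsLinearizedSolution.ae_eq_zero`).

The limits are taken in weighted `L²` norms (`IsWeightedLimit`), as `𝔷_n ∉ L²` for `n ≤ 4`.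
-/

/-! ### Integral transforms of a density on the unit sphere -/

namespace HalfSpaceBubble

section RidgeTransform

set_option linter.unusedSectionVars false

variable {Y : Type*} [MeasurableSpace Y] {μ : Measure Y}
  {E : Type*} [NormedAddCommGroup E] [InnerProductSpace ℝ E] [MeasurableSpace E] [BorelSpace E]
  [SecondCountableTopology E] {θ : Y → E} {g : Y → ℝ}

/-- The transform `ξ ↦ ∫ (1 - ⟨ξ, θ(y)⟩)⁻ᵖ g(y) dμ(y)`, considered on the open unit ball for a map
`θ` into the unit sphere. -/
noncomputable def ridgeTransform (μ : Measure Y) (θ : Y → E) (p : ℕ) (g : Y → ℝ) (ξ : E) : ℝ :=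
  ∫ y, (1 - inner ℝ ξ (θ y))⁻¹ ^ p * g y ∂μ

lemma one_sub_le_one_sub_inner (hθ : ∀ y, ‖θ y‖ = 1) {ξ : E} {r : ℝ} (hξ : ‖ξ‖ ≤ r) (y : Y) :
    1 - r ≤ 1 - inner ℝ ξ (θ y) := by
  have := real_inner_le_norm ξ (θ y)
  rw [hθ, mul_one] at this
  linarith

lemma abs_inv_pow_le (hθ : ∀ y, ‖θ y‖ = 1) {ξ : E} {r : ℝ} (hr : r < 1) (hξ : ‖ξ‖ ≤ r) (p : ℕ)
    (y : Y) : |(1 - inner ℝ ξ (θ y))⁻¹ ^ p| ≤ (1 - r)⁻¹ ^ p := by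
  have h := one_sub_le_one_sub_inner hθ hξ y
  have h0 : 0 < 1 - r := by linarith
  rw [abs_of_nonneg (by have := h0.trans_le h; positivity)]
  have := h0.trans_le h
  gcongr

lemma aestronglyMeasurable_kernel (hθm : Measurable θ) (hg : AEStronglyMeasurable g μ) (p : ℕ)
    (ξ : E) : AEStronglyMeasurable (fun y => (1 - inner ℝ ξ (θ y))⁻¹ ^ p * g y) μ := by
  have : Measurable (fun y => (1 - inner ℝ ξ (θ y))⁻¹ ^ p) := by fun_prop
  exact this.aestronglyMeasurable.mul hg

lemma integrable_kernel (hθm : Measurable θ) (hθ : ∀ y, ‖θ y‖ = 1) (hg : Integrable g μ) (p : ℕ)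
    {ξ : E} (hξ : ‖ξ‖ < 1) : Integrable (fun y => (1 - inner ℝ ξ (θ y))⁻¹ ^ p * g y) μ := by
  refine (hg.norm.const_mul ((1 - ‖ξ‖)⁻¹ ^ p)).mono'
    (aestronglyMeasurable_kernel hθm hg.1 p ξ) (ae_of_all _ fun y => ?_)
  rw [norm_mul]
  exact mul_le_mul_of_nonneg_right (abs_inv_pow_le hθ hξ le_rfl p y) (norm_nonneg _)

lemma integrable_inner_mul (hθm : Measurable θ) (hθ : ∀ y, ‖θ y‖ = 1) (hg : Integrable g μ)
    (e : E) : Integrable (fun y => inner ℝ e (θ y) * g y) μ := by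
  refine (hg.norm.const_mul ‖e‖).mono'
    ((by fun_prop : Measurable fun y => inner ℝ e (θ y)).aestronglyMeasurable.mul hg.1)
    (ae_of_all _ fun y => ?_)
  rw [norm_mul]
  refine mul_le_mul_of_nonneg_right ?_ (norm_nonneg _)
  simpa [hθ] using norm_inner_le_norm (𝕜 := ℝ) e (θ y)

lemma continuousOn_ridgeTransform (hθm : Measurable θ) (hθ : ∀ y, ‖θ y‖ = 1)
    (hg : Integrable g μ) (p : ℕ) {r : ℝ} (hr : r < 1) :
    ContinuousOn (ridgeTransform μ θ p g) (Metric.closedBall 0 r) := by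
  refine continuousOn_of_dominated (bound := fun y => (1 - r)⁻¹ ^ p * ‖g y‖)
    (fun ξ _ => aestronglyMeasurable_kernel hθm hg.1 p ξ) (fun ξ hξ => ae_of_all _ fun y => ?_)
    (hg.norm.const_mul _) (ae_of_all _ fun y => ?_)
  · rw [norm_mul]
    exact mul_le_mul_of_nonneg_right (abs_inv_pow_le hθ hr (by simpa using hξ) p y)
      (norm_nonneg _)
  · refine ContinuousOn.mul (ContinuousOn.pow (ContinuousOn.inv₀ (by fun_prop) ?_) _)
      continuousOn_const
    intro ξ hξ
    have := one_sub_le_one_sub_inner hθ (by simpa using hξ : ‖ξ‖ ≤ r) y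
    linarith

lemma hasDerivAt_ridgeTransform (hθm : Measurable θ) (hθ : ∀ y, ‖θ y‖ = 1)
    (hg : Integrable g μ) (p : ℕ) (ξ e : E) {h : ℝ} (hξ : ‖ξ + h • e‖ < 1) :
    HasDerivAt (fun t : ℝ => ridgeTransform μ θ p g (ξ + t • e))
      (p * ridgeTransform μ θ (p + 1) (fun y => inner ℝ e (θ y) * g y) (ξ + h • e)) h := by
  set r : ℝ := (1 + ‖ξ + h • e‖) / 2
  have hr : r < 1 := by simp only [r]; linarith
  have hr' : ‖ξ + h • e‖ < r := by simp only [r]; linarith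
  have hs : {t : ℝ | ‖ξ + t • e‖ < r} ∈ 𝓝 h :=
    (isOpen_lt (by fun_prop) (by fun_prop)).mem_nhds hr'
  have hge := integrable_inner_mul hθm hθ hg e
  have key := hasDerivAt_integral_of_dominated_loc_of_deriv_le (μ := μ) hs
    (F := fun t y => (1 - inner ℝ (ξ + t • e) (θ y))⁻¹ ^ p * g y)
    (F' := fun t y => p * ((1 - inner ℝ (ξ + t • e) (θ y))⁻¹ ^ (p + 1) *
      (inner ℝ e (θ y) * g y)))
    (bound := fun y => p * ((1 - r)⁻¹ ^ (p + 1) * ‖inner ℝ e (θ y) * g y‖))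
    (Eventually.of_forall fun t => aestronglyMeasurable_kernel hθm hg.1 p _)
    (integrable_kernel hθm hθ hg p hξ)
    ((aestronglyMeasurable_kernel hθm hge.1 (p + 1) _).const_mul _)
    (ae_of_all _ fun y t ht => ?_) ((hge.norm.const_mul _).const_mul _)
    (ae_of_all _ fun y t ht => ?_)
  · have := key.2
    rw [integral_const_mul] at this
    exact this
  · rw [norm_mul, norm_mul ((1 - inner ℝ (ξ + t • e) (θ y))⁻¹ ^ (p + 1))]
    simp only [Real.norm_natCast]
    refine mul_le_mul_of_nonneg_left (mul_le_mul_of_nonneg_right ?_ (norm_nonneg _))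
      (Nat.cast_nonneg _)
    exact abs_inv_pow_le hθ hr (le_of_lt ht) (p + 1) y
  · have h1 := one_sub_le_one_sub_inner hθ (le_of_lt ht : ‖ξ + t • e‖ ≤ r) y
    have h2 : 1 - inner ℝ (ξ + t • e) (θ y) ≠ 0 := by linarith
    have h3 : HasDerivAt (fun t : ℝ => 1 - inner ℝ (ξ + t • e) (θ y)) (-inner ℝ e (θ y)) t := by
      have : (fun t : ℝ => 1 - inner ℝ (ξ + t • e) (θ y)) =
          fun t : ℝ => 1 - (inner ℝ ξ (θ y) + t * inner ℝ e (θ y)) := by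
        ext t; rw [inner_add_left, real_inner_smul_left]
      rw [this]
      simpa using (((hasDerivAt_id t).mul_const (inner ℝ e (θ y))).const_add
        (inner ℝ ξ (θ y))).const_sub 1
    convert! ((h3.inv h2).pow p).mul_const (g y) using 1
    rcases p with _ | p
    · simp
    · simp only [Nat.add_sub_cancel, Pi.inv_apply]
      generalize 1 - inner ℝ (ξ + t • e) (θ y) = a at h2 ⊢
      rw [pow_succ a⁻¹ (p + 1), pow_succ a⁻¹ p, div_eq_mul_inv, ← inv_pow a 2]
      push_cast
      ring

lemma ridgeTransform_inner_mul (hθm : Measurable θ) (hθ : ∀ y, ‖θ y‖ = 1)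
    (hg : Integrable g μ) (p : ℕ) {ξ : E} (hξ : ‖ξ‖ < 1) :
    ridgeTransform μ θ (p + 1) (fun y => inner ℝ ξ (θ y) * g y) ξ =
      ridgeTransform μ θ (p + 1) g ξ - ridgeTransform μ θ p g ξ := by
  unfold ridgeTransform
  rw [← integral_sub (integrable_kernel hθm hθ hg _ hξ) (integrable_kernel hθm hθ hg _ hξ)]
  refine integral_congr_ae (ae_of_all _ fun y => ?_)
  have h1 := one_sub_le_one_sub_inner hθ (le_refl ‖ξ‖) y
  have h2 : 1 - inner ℝ ξ (θ y) ≠ 0 := by linarith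
  obtain ⟨a, ha⟩ : ∃ a, a = 1 - inner ℝ ξ (θ y) := ⟨_, rfl⟩
  beta_reduce
  rw [show inner ℝ ξ (θ y) = 1 - a by rw [ha]; ring, sub_sub_cancel]
  rw [← ha] at h2
  rw [pow_succ]
  field_simp

lemma ridgeTransform_const_mul (p : ℕ) (ξ : E) (a : ℝ) (f : Y → ℝ) :
    ridgeTransform μ θ p (fun y => a * f y) ξ = a * ridgeTransform μ θ p f ξ := by
  unfold ridgeTransform
  rw [← integral_const_mul]
  exact integral_congr_ae (ae_of_all _ fun y => by ring)

lemma ridgeTransform_sum (hθm : Measurable θ) (hθ : ∀ y, ‖θ y‖ = 1) {ι : Type*} (s : Finset ι)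
    {f : ι → Y → ℝ} (hf : ∀ i ∈ s, Integrable (f i) μ) (p : ℕ) {ξ : E} (hξ : ‖ξ‖ < 1) :
    ∑ i ∈ s, ridgeTransform μ θ p (f i) ξ = ridgeTransform μ θ p (fun y => ∑ i ∈ s, f i y) ξ := by
  unfold ridgeTransform
  rw [← integral_finsetSum _ fun i hi => integrable_kernel hθm hθ (hf i hi) p hξ]
  simp_rw [Finset.mul_sum]

end RidgeTransform

lemma deriv_deriv_nonpos_of_isLocalMax {φ : ℝ → ℝ} {x : ℝ} (h : IsLocalMax φ x)
    (hc : ContinuousAt φ x) : deriv (deriv φ) x ≤ 0 := by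
  by_contra! hpos
  have hmin := isLocalMin_of_deriv_deriv_pos hpos h.deriv_eq_zero hc
  have hconst : φ =ᶠ[𝓝 x] fun _ => φ x := by
    filter_upwards [h, hmin] with y h1 h2 using le_antisymm h1 h2
  have := hconst.deriv.deriv_eq
  simp at this
  rw [this] at hpos
  exact lt_irrefl _ hpos

end HalfSpaceBubble

/-! ### An elliptic equation in the Klein model and its maximum principle -/

namespace HalfSpaceBubble

section MaximumPrinciple

set_option linter.unusedSectionVars false

variable {Y : Type*} [MeasurableSpace Y] {μ : Measure Y}
  {E : Type*} [NormedAddCommGroup E] [InnerProductSpace ℝ E] [MeasurableSpace E] [BorelSpace E]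
  [FiniteDimensional ℝ E] {θ : Y → E} {g : Y → ℝ}

/-- The function `ξ ↦ ∫ ((N+1) s⁻ᴺ - N (1 - |ξ|²) s⁻⁽ᴺ⁺¹⁾) g` with `s = 1 - ⟨ξ, θ⟩`. For `N = dim E`
it solves, in the Beltrami-Klein model of hyperbolic space, an elliptic equation whose zeroth order
coefficient has the good sign. -/
noncomputable def kleinPotential (μ : Measure Y) (θ : Y → E) (N : ℕ) (g : Y → ℝ) (ξ : E) : ℝ :=
  (N + 1) * ridgeTransform μ θ N g ξ - N * (1 - ‖ξ‖ ^ 2) * ridgeTransform μ θ (N + 1) g ξ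

lemma hasDerivAt_one_sub_norm_sq (ξ e : E) (h : ℝ) :
    HasDerivAt (fun t : ℝ => 1 - ‖ξ + t • e‖ ^ 2) (-2 * inner ℝ (ξ + h • e) e) h := by
  have h1 : HasDerivAt (fun t : ℝ => ξ + t • e) e h := by
    simpa using ((hasDerivAt_id h).smul_const e).const_add ξ
  convert! h1.norm_sq.const_sub 1 using 1
  ring

lemma hasDerivAt_inner_line (ξ e : E) (h : ℝ) :
    HasDerivAt (fun t : ℝ => inner ℝ (ξ + t • e) e) (‖e‖ ^ 2) h := by
  have h1 : HasDerivAt (fun t : ℝ => ξ + t • e) e h := by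
    simpa using ((hasDerivAt_id h).smul_const e).const_add ξ
  convert! h1.inner ℝ (hasDerivAt_const h e) using 1
  simp

lemma hasDerivAt_kleinPotential (hθm : Measurable θ) (hθ : ∀ y, ‖θ y‖ = 1)
    (hg : Integrable g μ) (N : ℕ) (ξ e : E) {h : ℝ} (hξ : ‖ξ + h • e‖ < 1) :
    HasDerivAt (fun t : ℝ => kleinPotential μ θ N g (ξ + t • e))
      ((N + 1) * (N * ridgeTransform μ θ (N + 1) (fun y => inner ℝ e (θ y) * g y) (ξ + h • e))
        - (N * (-2 * inner ℝ (ξ + h • e) e) * ridgeTransform μ θ (N + 1) g (ξ + h • e)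
          + N * (1 - ‖ξ + h • e‖ ^ 2) * ((N + 1) *
            ridgeTransform μ θ (N + 2) (fun y => inner ℝ e (θ y) * g y) (ξ + h • e)))) h := by
  have h1 := hasDerivAt_ridgeTransform hθm hθ hg N ξ e hξ
  have h2 := hasDerivAt_ridgeTransform hθm hθ hg (N + 1) ξ e hξ
  have h3 := (hasDerivAt_one_sub_norm_sq ξ e h).const_mul (N : ℝ)
  convert! (h1.const_mul ((N : ℝ) + 1)).sub (h3.mul h2) using 1
  push_cast
  ring

lemma deriv_deriv_kleinPotential (hθm : Measurable θ) (hθ : ∀ y, ‖θ y‖ = 1)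
    (hg : Integrable g μ) (N : ℕ) (ξ e : E) (hξ : ‖ξ‖ < 1) :
    deriv (deriv fun t : ℝ => kleinPotential μ θ N g (ξ + t • e)) 0 =
      (N + 1) * N * (N + 1) * ridgeTransform μ θ (N + 2)
          (fun y => inner ℝ e (θ y) * (inner ℝ e (θ y) * g y)) ξ
        - N * ((1 - ‖ξ‖ ^ 2) * (N + 1) * (N + 2) * ridgeTransform μ θ (N + 3)
              (fun y => inner ℝ e (θ y) * (inner ℝ e (θ y) * g y)) ξ
            - 4 * inner ℝ ξ e * (N + 1) *
              ridgeTransform μ θ (N + 2) (fun y => inner ℝ e (θ y) * g y) ξ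
            - 2 * ‖e‖ ^ 2 * ridgeTransform μ θ (N + 1) g ξ) := by
  have hnhds : ∀ᶠ t : ℝ in 𝓝 0, ‖ξ + t • e‖ < 1 :=
    (isOpen_lt (by fun_prop) (by fun_prop)).mem_nhds (by simpa using hξ)
  have hge := integrable_inner_mul hθm hθ hg e
  have hd := hnhds.mono fun t ht => (hasDerivAt_kleinPotential hθm hθ hg N ξ e ht).deriv
  rw [EventuallyEq.deriv_eq hd]
  have h0 : ‖ξ + (0 : ℝ) • e‖ < 1 := by simpa using hξ
  have h1 := hasDerivAt_ridgeTransform hθm hθ hge (N + 1) ξ e h0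
  have h2 := hasDerivAt_ridgeTransform hθm hθ hg (N + 1) ξ e h0
  have h3 := (hasDerivAt_one_sub_norm_sq ξ e 0).const_mul (N : ℝ)
  have h4 := hasDerivAt_ridgeTransform hθm hθ hge (N + 2) ξ e h0
  have h5 := ((hasDerivAt_inner_line ξ e 0).const_mul (-2)).const_mul (N : ℝ)
  have key := ((h1.const_mul (N : ℝ)).const_mul ((N : ℝ) + 1)).sub
    ((h5.mul h2).add (h3.mul (h4.const_mul ((N : ℝ) + 1))))
  have := key.deriv
  simp only [zero_smul, add_zero] at this
  refine Eq.trans ?_ (this.trans ?_)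
  · rfl
  · push_cast
    ring_nf

/-- The symmetric square root of `I - ξ ξᵀ`. -/
noncomputable def kleinFrame (ξ v : E) : E :=
  v - ((1 + √(1 - ‖ξ‖ ^ 2))⁻¹ * inner ℝ ξ v) • ξ

lemma inner_kleinFrame_left (ξ u v : E) :
    inner ℝ (kleinFrame ξ u) v = inner ℝ u (kleinFrame ξ v) := by
  simp only [kleinFrame, inner_sub_left, inner_sub_right, real_inner_smul_left,
    real_inner_smul_right]
  rw [real_inner_comm ξ u]
  ring

lemma inner_kleinFrame_kleinFrame {ξ : E} (hξ : ‖ξ‖ < 1) (u v : E) :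
    inner ℝ (kleinFrame ξ u) (kleinFrame ξ v) = inner ℝ u v - inner ℝ ξ u * inner ℝ ξ v := by
  have h0 : (0 : ℝ) ≤ 1 - ‖ξ‖ ^ 2 := by nlinarith [norm_nonneg ξ]
  have hs := Real.sq_sqrt h0
  have hs0 := Real.sqrt_nonneg (1 - ‖ξ‖ ^ 2)
  simp only [kleinFrame, inner_sub_left, inner_sub_right, real_inner_smul_left,
    real_inner_smul_right, real_inner_self_eq_norm_sq]
  rw [real_inner_comm ξ u]
  set q := √(1 - ‖ξ‖ ^ 2)
  have hq : 1 + q ≠ 0 := by positivity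
  have : ‖ξ‖ ^ 2 = 1 - q ^ 2 := by linarith
  rw [this]
  field_simp
  ring

section Sums

variable {ι : Type*} [Fintype ι] (b : OrthonormalBasis ι ℝ E)

lemma sum_inner_kleinFrame_mul {ξ : E} (hξ : ‖ξ‖ < 1) (u v : E) :
    ∑ i, inner ℝ (kleinFrame ξ (b i)) u * inner ℝ (kleinFrame ξ (b i)) v =
      inner ℝ u v - inner ℝ ξ u * inner ℝ ξ v := by
  rw [← inner_kleinFrame_kleinFrame hξ, ← b.sum_inner_mul_inner]
  refine Finset.sum_congr rfl fun i _ => ?_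
  rw [inner_kleinFrame_left, inner_kleinFrame_left, real_inner_comm]

lemma sum_norm_sq_kleinFrame {ξ : E} (hξ : ‖ξ‖ < 1) :
    ∑ i, ‖kleinFrame ξ (b i)‖ ^ 2 = Fintype.card ι - ‖ξ‖ ^ 2 := by
  simp_rw [← real_inner_self_eq_norm_sq (kleinFrame ξ _), inner_kleinFrame_kleinFrame hξ]
  rw [Finset.sum_sub_distrib, ← real_inner_self_eq_norm_sq ξ, ← b.sum_inner_mul_inner ξ ξ]
  congr 1
  · simp
  · exact Finset.sum_congr rfl fun i _ => by rw [real_inner_comm ξ (b i)]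

/-- The elliptic equation for `kleinPotential`: with `w` the potential,
`∑ (δᵢⱼ - ξᵢ ξⱼ) ∂ᵢⱼ w - 2 N ξ · ∇w - N (N - 1) w = 0`. -/
lemma kleinPotential_equation (hθm : Measurable θ) (hθ : ∀ y, ‖θ y‖ = 1)
    (hg : Integrable g μ) {ξ : E} (hξ : ‖ξ‖ < 1) :
    ∑ i, deriv (deriv fun t : ℝ =>
        kleinPotential μ θ (Fintype.card ι) g (ξ + t • kleinFrame ξ (b i))) 0
      - 2 * Fintype.card ι *
          deriv (fun t : ℝ => kleinPotential μ θ (Fintype.card ι) g (ξ + t • ξ)) 0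
      - Fintype.card ι * (Fintype.card ι - 1) * kleinPotential μ θ (Fintype.card ι) g ξ = 0 := by
  set N := Fintype.card ι with hN
  have hgi := fun e => integrable_inner_mul hθm hθ hg e
  have hgii := fun e => integrable_inner_mul hθm hθ (hgi e) e
  -- since `|θ| = 1`, `∑ ⟨fᵢ, θ⟩² = 1 - ⟨ξ, θ⟩² = 2 s - s²` for the frame `fᵢ`
  have hquad : ∀ p, ∑ i, ridgeTransform μ θ (p + 2) (fun y => inner ℝ (kleinFrame ξ (b i)) (θ y) *
      (inner ℝ (kleinFrame ξ (b i)) (θ y) * g y)) ξ =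
      2 * ridgeTransform μ θ (p + 1) g ξ - ridgeTransform μ θ p g ξ := by
    intro p
    rw [ridgeTransform_sum hθm hθ _ (fun i _ => hgii _) _ hξ]
    have e1 : (fun y => ∑ i, inner ℝ (kleinFrame ξ (b i)) (θ y) *
        (inner ℝ (kleinFrame ξ (b i)) (θ y) * g y)) =
        fun y => g y - inner ℝ ξ (θ y) * (inner ℝ ξ (θ y) * g y) := by
      ext y
      have := sum_inner_kleinFrame_mul b hξ (θ y) (θ y)
      simp_rw [← mul_assoc]
      rw [← Finset.sum_mul, this, real_inner_self_eq_norm_sq, hθ]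
      ring
    have e2 : ridgeTransform μ θ (p + 2)
        (fun y => g y - inner ℝ ξ (θ y) * (inner ℝ ξ (θ y) * g y)) ξ =
        ridgeTransform μ θ (p + 2) g ξ - ridgeTransform μ θ (p + 2)
          (fun y => inner ℝ ξ (θ y) * (inner ℝ ξ (θ y) * g y)) ξ := by
      unfold ridgeTransform
      rw [← integral_sub (integrable_kernel hθm hθ hg _ hξ)
        (integrable_kernel hθm hθ (hgii ξ) _ hξ)]
      exact integral_congr_ae (ae_of_all _ fun y => by ring)
    rw [e1, e2, ridgeTransform_inner_mul hθm hθ (hgi ξ) _ hξ,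
      ridgeTransform_inner_mul hθm hθ hg _ hξ, ridgeTransform_inner_mul hθm hθ hg _ hξ]
    ring
  have hlin : ∑ i, inner ℝ ξ (kleinFrame ξ (b i)) * ridgeTransform μ θ (N + 2)
      (fun y => inner ℝ (kleinFrame ξ (b i)) (θ y) * g y) ξ =
      (1 - ‖ξ‖ ^ 2) * (ridgeTransform μ θ (N + 2) g ξ - ridgeTransform μ θ (N + 1) g ξ) := by
    simp_rw [← ridgeTransform_const_mul]
    rw [ridgeTransform_sum hθm hθ _ (fun i _ => (hgi _).const_mul _) _ hξ,
      ← ridgeTransform_inner_mul hθm hθ hg _ hξ, ← ridgeTransform_const_mul]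
    congr 1
    ext y
    have := sum_inner_kleinFrame_mul b hξ ξ (θ y)
    simp_rw [← mul_assoc, ← Finset.sum_mul, real_inner_comm (kleinFrame ξ (b _)) ξ]
    rw [this, real_inner_self_eq_norm_sq]
    ring
  have hsq := sum_norm_sq_kleinFrame b hξ
  have hd := (hasDerivAt_kleinPotential hθm hθ hg N ξ ξ (h := 0) (by simpa using hξ)).deriv
  simp only [zero_smul, add_zero, real_inner_self_eq_norm_sq] at hd
  rw [hd, ridgeTransform_inner_mul hθm hθ hg _ hξ, ridgeTransform_inner_mul hθm hθ hg _ hξ]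
  simp_rw [deriv_deriv_kleinPotential hθm hθ hg N ξ _ hξ]
  have hsum : ∀ (c1 c2 c3 c4 : ℝ) (x1 x2 x3 x4 : ι → ℝ),
      ∑ i, (c1 * x1 i - N * (c2 * x2 i - 4 * x3 i * c3 * x4 i - 2 * ‖kleinFrame ξ (b i)‖ ^ 2 * c4))
      = c1 * ∑ i, x1 i - N * (c2 * ∑ i, x2 i - 4 * c3 * ∑ i, x3 i * x4 i
        - 2 * (N - ‖ξ‖ ^ 2) * c4) := by
    intro c1 c2 c3 c4 x1 x2 x3 x4
    rw [← hsq]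
    simp only [Finset.mul_sum, Finset.sum_mul, ← Finset.sum_sub_distrib]
    exact Finset.sum_congr rfl fun i _ => by ring
  rw [hsum, hquad N, hquad (N + 1), hlin, kleinPotential]
  ring

end Sums

/-- By the maximum principle, `kleinPotential` cannot be positive inside a sphere on which it
vanishes: at a positive interior maximum the second order terms of its equation are nonpositive, the
first order term vanishes and the zeroth order term is negative. -/
lemma kleinPotential_nonpos {ι : Type*} [Fintype ι] (b : OrthonormalBasis ι ℝ E)
    (hι : 2 ≤ Fintype.card ι) (hθm : Measurable θ)
    (hθ : ∀ y, ‖θ y‖ = 1) (hg : Integrable g μ) {r : ℝ} (hr0 : 0 < r) (hr : r < 1)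
    (hb : ∀ ξ : E, ‖ξ‖ = r → kleinPotential μ θ (Fintype.card ι) g ξ = 0) {ξ : E}
    (hξ : ‖ξ‖ ≤ r) : kleinPotential μ θ (Fintype.card ι) g ξ ≤ 0 := by
  set w := kleinPotential μ θ (Fintype.card ι) g with hw
  have hcont : ContinuousOn w (Metric.closedBall 0 r) := by
    have h1 := continuousOn_ridgeTransform hθm hθ hg (Fintype.card ι) hr
    have h2 := continuousOn_ridgeTransform hθm hθ hg (Fintype.card ι + 1) hr
    exact (continuousOn_const.mul h1).sub ((Continuous.continuousOn (by fun_prop)).mul h2)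
  obtain ⟨η, hη, hmax⟩ := (isCompact_closedBall (0 : E) r).exists_isMaxOn
    ⟨0, by simpa using hr0.le⟩ hcont
  have hle : w ξ ≤ w η := hmax (by simpa using hξ)
  refine hle.trans ?_
  by_contra! hpos
  have hηr : ‖η‖ < r := by
    refine lt_of_le_of_ne (by simpa using hη) fun h => ?_
    rw [hb η h] at hpos
    exact lt_irrefl _ hpos
  have hη1 : ‖η‖ < 1 := hηr.trans hr
  have hloc : ∀ e : E, IsLocalMax (fun t : ℝ => w (η + t • e)) 0 := by
    intro e
    have : ∀ᶠ t : ℝ in 𝓝 0, ‖η + t • e‖ < r :=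
      (isOpen_lt (by fun_prop) (by fun_prop)).mem_nhds (by simpa using hηr)
    filter_upwards [this] with t ht
    simpa using hmax (by simpa using ht.le)
  have hca : ∀ e : E, ContinuousAt (fun t : ℝ => w (η + t • e)) 0 := fun e =>
    (hasDerivAt_kleinPotential hθm hθ hg _ η e (h := 0) (by simpa using hη1)).continuousAt
  have heq := kleinPotential_equation b hθm hθ hg hη1
  rw [← hw, (hloc η).deriv_eq_zero] at heq
  have hs : ∑ i, deriv (deriv fun t : ℝ => w (η + t • kleinFrame η (b i))) 0 ≤ 0 :=
    Finset.sum_nonpos fun i _ => deriv_deriv_nonpos_of_isLocalMax (hloc _) (hca _)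
  have hN : (2 : ℝ) ≤ Fintype.card ι := by exact_mod_cast hι
  have : 0 < (Fintype.card ι : ℝ) * (Fintype.card ι - 1) * w η := by
    have : (0 : ℝ) < (Fintype.card ι : ℝ) - 1 := by linarith
    positivity
  linarith

lemma kleinPotential_eq_zero {ι : Type*} [Fintype ι] (b : OrthonormalBasis ι ℝ E)
    (hι : 2 ≤ Fintype.card ι) (hθm : Measurable θ)
    (hθ : ∀ y, ‖θ y‖ = 1) (hg : Integrable g μ) {r : ℝ} (hr0 : 0 < r) (hr : r < 1)
    (hb : ∀ ξ : E, ‖ξ‖ = r → kleinPotential μ θ (Fintype.card ι) g ξ = 0) {ξ : E}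
    (hξ : ‖ξ‖ ≤ r) : kleinPotential μ θ (Fintype.card ι) g ξ = 0 := by
  have hneg : ∀ ζ : E, kleinPotential μ θ (Fintype.card ι) (fun y => -g y) ζ =
      -kleinPotential μ θ (Fintype.card ι) g ζ := by
    intro ζ
    have := fun p => ridgeTransform_const_mul (μ := μ) (θ := θ) p ζ (-1) g
    simp only [neg_mul, one_mul] at this
    simp only [kleinPotential, this]
    ring
  refine le_antisymm (kleinPotential_nonpos b hι hθm hθ hg hr0 hr hb hξ) ?_
  have := kleinPotential_nonpos b hι hθm hθ hg.neg hr0 hr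
    (fun ζ hζ => (hneg ζ).trans (by rw [hb ζ hζ, neg_zero])) hξ
  have h2 := hneg ξ
  change kleinPotential μ θ (Fintype.card ι) (fun y => -g y) ξ ≤ 0 at this
  linarith

end MaximumPrinciple

end HalfSpaceBubble

/-! ### Injectivity for densities with vanishing first moments -/

namespace HalfSpaceBubble

section Uniqueness

set_option linter.unusedSectionVars false

variable {Y : Type*} [MeasurableSpace Y] {μ : Measure Y}
  {E : Type*} [NormedAddCommGroup E] [InnerProductSpace ℝ E] [MeasurableSpace E] [BorelSpace E]
  [FiniteDimensional ℝ E] {θ : Y → E} {g : Y → ℝ}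

lemma norm_smul_lt_one {b : E} (hb : ‖b‖ = 1) {t : ℝ} (ht0 : 0 ≤ t) (ht : t < 1) :
    ‖t • b‖ < 1 := by
  rw [norm_smul, hb, mul_one, Real.norm_eq_abs, abs_of_nonneg ht0]
  exact ht

/-- Along a ray from the origin, `r V' = p (V_{p+1} - V_p)`. -/
lemma hasDerivAt_ridgeTransform_ray (hθm : Measurable θ) (hθ : ∀ y, ‖θ y‖ = 1)
    (hg : Integrable g μ) (p : ℕ) {b : E} (hb : ‖b‖ = 1) {t : ℝ} (ht0 : 0 < t) (ht : t < 1) :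
    HasDerivAt (fun r : ℝ => ridgeTransform μ θ p g (r • b))
      (p * (ridgeTransform μ θ (p + 1) g (t • b) - ridgeTransform μ θ p g (t • b)) / t) t := by
  have hn := norm_smul_lt_one hb ht0.le ht
  have h := hasDerivAt_ridgeTransform hθm hθ hg p 0 b (h := t) (by simpa using hn)
  simp only [zero_add] at h
  convert! h using 1
  rw [← ridgeTransform_inner_mul hθm hθ hg p hn]
  have : (fun y => inner ℝ (t • b) (θ y) * g y) = fun y => t * (inner ℝ b (θ y) * g y) := by
    ext y; rw [real_inner_smul_left]; ring
  rw [this, ridgeTransform_const_mul]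
  field_simp

/-- The vanishing of `kleinPotential` is a first order differential equation for `V` along rays,
whose solutions are the multiples of `r (1 - r²)^{-(N+1)/2}`. The multiple is zero when the first
moments of `g` vanish. -/
lemma ridgeTransform_eq_zero_of_kleinPotential (hθm : Measurable θ) (hθ : ∀ y, ‖θ y‖ = 1)
    (hg : Integrable g μ) {N : ℕ} {r : ℝ} (hr : r < 1)
    (hw : ∀ ξ : E, ‖ξ‖ ≤ r → kleinPotential μ θ N g ξ = 0)
    {b : E} (hb : ‖b‖ = 1) (hmom : ∫ y, inner ℝ b (θ y) * g y ∂μ = 0) {t : ℝ} (ht0 : 0 < t)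
    (ht : t < r) : ridgeTransform μ θ N g (t • b) = 0 := by
  have hr0 : 0 < r := ht0.trans ht
  set V : ℝ → ℝ := fun s => ridgeTransform μ θ N g (s • b) with hV
  -- the square of the ratio of `V` and the explicit solution is constant
  set R : ℝ → ℝ := fun s => V s ^ 2 * (1 - s ^ 2) ^ (N + 1) / s ^ 2 with hR
  have hwray : ∀ s, 0 ≤ s → s ≤ r → (N + 1) * V s -
      N * (1 - s ^ 2) * ridgeTransform μ θ (N + 1) g (s • b) = 0 := by
    intro s hs0 hs
    have hn : ‖s • b‖ = s := by rw [norm_smul, hb, mul_one, Real.norm_eq_abs, abs_of_nonneg hs0]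
    have := hw (s • b) (by rw [hn]; exact hs)
    rwa [kleinPotential, hn] at this
  have hRd : ∀ s ∈ Set.Ioo 0 r, HasDerivAt R 0 s := by
    intro s hs
    have hs1 : s < 1 := hs.2.trans hr
    have h1 := hasDerivAt_ridgeTransform_ray hθm hθ hg N hb hs.1 hs1
    have h2 : HasDerivAt (fun s : ℝ => 1 - s ^ 2) (-(2 * s)) s := by
      simpa using (hasDerivAt_pow 2 s).const_sub 1
    have h3 : HasDerivAt (fun s : ℝ => s ^ 2) (2 * s) s := by simpa using hasDerivAt_pow 2 s
    have hs0 : s ≠ 0 := hs.1.ne'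
    have h4 := ((h1.pow 2).mul (h2.pow (N + 1))).div h3 (pow_ne_zero 2 hs0)
    convert! h4 using 1
    have hrel := hwray s hs.1.le hs.2.le
    have hq : 1 - s ^ 2 ≠ 0 := by nlinarith [hs.1]
    simp only [hV] at hrel
    simp only [Pi.pow_apply, Pi.mul_apply, Nat.add_sub_cancel]
    set v := ridgeTransform μ θ N g (s • b)
    set v1 := ridgeTransform μ θ (N + 1) g (s • b)
    set P := (1 - s ^ 2) ^ N with hP
    rw [pow_succ (1 - s ^ 2) N, ← hP]
    symm
    rw [div_eq_zero_iff]
    left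
    push_cast
    field_simp
    linear_combination (-(2 : ℝ) * P * s * v) * hrel
  have hRconst : ∀ s ∈ Set.Ioo 0 r, R s = R t := fun s hs =>
    isOpen_Ioo.is_const_of_deriv_eq_zero isPreconnected_Ioo
      (fun s hs => (hRd s hs).differentiableAt.differentiableWithinAt)
      (fun s hs => (hRd s hs).deriv) hs ⟨ht0, ht⟩
  -- `V` vanishes to second order at the origin
  have hV0 : V 0 = 0 := by
    have := hwray 0 le_rfl hr0.le
    simp only [hV, zero_smul, ridgeTransform, inner_zero_left, sub_zero, inv_one, one_pow,
      one_mul, ne_eq, OfNat.ofNat_ne_zero, not_false_eq_true, zero_pow, mul_one] at this ⊢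
    linarith
  have hVd : HasDerivAt V 0 0 := by
    have := hasDerivAt_ridgeTransform hθm hθ hg N 0 b (h := 0) (by simp)
    simp only [zero_add] at this
    convert! this using 1
    simp [ridgeTransform, hmom]
  have hlim : Tendsto R (𝓝[>] 0) (𝓝 0) := by
    have h1 := hVd.tendsto_slope_zero_right
    simp only [zero_add, hV0, sub_zero, smul_eq_mul] at h1
    have h2 : Tendsto (fun s : ℝ => (1 - s ^ 2) ^ (N + 1)) (𝓝[>] 0) (𝓝 1) := by
      have : Continuous fun s : ℝ => (1 - s ^ 2) ^ (N + 1) := by fun_prop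
      simpa using (this.tendsto 0).mono_left nhdsWithin_le_nhds
    have h3 := (h1.pow 2).mul h2
    simp only [ne_eq, OfNat.ofNat_ne_zero, not_false_eq_true, zero_pow, mul_one] at h3
    refine h3.congr fun s => ?_
    simp only [hR]
    rw [mul_pow, inv_pow]
    ring
  have hRt : R t = 0 := by
    refine tendsto_nhds_unique (Tendsto.congr' ?_ hlim) tendsto_const_nhds |>.symm
    filter_upwards [Ioo_mem_nhdsGT hr0] with s hs using hRconst s hs
  simp only [hR] at hRt
  have ht1 : 0 < 1 - t ^ 2 := by nlinarith
  have : V t ^ 2 = 0 := by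
    have := (div_eq_zero_iff.mp hRt).resolve_right (by positivity)
    exact (mul_eq_zero.mp this).resolve_right (by positivity)
  exact pow_eq_zero_iff two_ne_zero |>.mp this

/-- If `V_p` vanishes along a ray then so does `V_{p+1}`, since the derivative of `V_p` along the
ray is a combination of the two. -/
lemma ridgeTransform_add_eq_zero (hθm : Measurable θ) (hθ : ∀ y, ‖θ y‖ = 1)
    (hg : Integrable g μ) {N : ℕ} (hN : N ≠ 0) {r : ℝ} (hr : r < 1) {b : E} (hb : ‖b‖ = 1)
    (h0 : ∀ t ∈ Set.Ioo 0 r, ridgeTransform μ θ N g (t • b) = 0) (j : ℕ) :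
    ∀ t ∈ Set.Ioo 0 r, ridgeTransform μ θ (N + j) g (t • b) = 0 := by
  induction j with
  | zero => simpa using h0
  | succ j ih =>
    intro t ht
    have h1 := hasDerivAt_ridgeTransform_ray hθm hθ hg (N + j) hb ht.1 (ht.2.trans hr)
    have h2 : (fun s : ℝ => ridgeTransform μ θ (N + j) g (s • b)) =ᶠ[𝓝 t] fun _ => 0 := by
      filter_upwards [isOpen_Ioo.mem_nhds ht] with s hs using ih s hs
    have h3 := h1.deriv
    rw [h2.deriv_eq, deriv_const, ih t ht, sub_zero] at h3
    have h4 : (((N + j : ℕ) : ℝ)) ≠ 0 := by exact_mod_cast (by omega : N + j ≠ 0)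
    have := (div_eq_zero_iff.mp h3.symm).resolve_right ht.1.ne'
    exact (mul_eq_zero.mp this).resolve_left h4

/-- If all the transforms with exponent at least `N` vanish at a point, then, by the Weierstrass
approximation theorem, `(1 - ⟨ξ, θ⟩)⁻ᴺ g` is orthogonal to every continuous function of
`(1 - ⟨ξ, θ⟩)⁻¹`. -/
lemma integral_continuous_mul_eq_zero (hθm : Measurable θ) (hθ : ∀ y, ‖θ y‖ = 1)
    (hg : Integrable g μ) {N : ℕ} {ξ : E} (hξ : ‖ξ‖ < 1)
    (h0 : ∀ j : ℕ, ridgeTransform μ θ (N + j) g ξ = 0) {f : ℝ → ℝ}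
    (hf : ContinuousOn f (Set.Ioi 0)) (hfm : Measurable f) :
    ∫ y, f (1 - inner ℝ ξ (θ y))⁻¹ * ((1 - inner ℝ ξ (θ y))⁻¹ ^ N * g y) ∂μ = 0 := by
  set X : Y → ℝ := fun y => (1 - inner ℝ ξ (θ y))⁻¹ with hX
  set G : Y → ℝ := fun y => X y ^ N * g y with hG
  have hXm : Measurable X := by fun_prop
  have hGi : Integrable G μ := integrable_kernel hθm hθ hg N hξ
  have hXmem : ∀ y, X y ∈ Set.Icc (2 : ℝ)⁻¹ (1 - ‖ξ‖)⁻¹ := by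
    intro y
    have h1 := one_sub_le_one_sub_inner hθ (le_refl ‖ξ‖) y
    have h2 : 1 - inner ℝ ξ (θ y) ≤ 2 := by
      have := abs_le.mp (abs_real_inner_le_norm ξ (θ y))
      rw [hθ] at this
      linarith [this.1]
    have h3 : 0 < 1 - ‖ξ‖ := by linarith
    exact ⟨inv_anti₀ (h3.trans_le h1) h2, inv_anti₀ h3 h1⟩
  have hpow : ∀ j : ℕ, Integrable (fun y => X y ^ j * G y) μ := fun j => by
    refine (integrable_kernel hθm hθ hg (j + N) hξ).congr (ae_of_all _ fun y => ?_)
    simp only [hG, hX, pow_add]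
    ring
  have hmono : ∀ j : ℕ, ∫ y, X y ^ j * G y ∂μ = 0 := fun j => by
    rw [← h0 j]
    refine integral_congr_ae (ae_of_all _ fun y => ?_)
    simp only [hG, hX, pow_add]
    ring
  have hpoly : ∀ P : Polynomial ℝ, Integrable (fun y => P.eval (X y) * G y) μ ∧
      ∫ y, P.eval (X y) * G y ∂μ = 0 := by
    intro P
    have e : (fun y => P.eval (X y) * G y) = fun y => ∑ i ∈ Finset.range (P.natDegree + 1),
        P.coeff i * (X y ^ i * G y) := by
      ext y
      rw [Polynomial.eval_eq_sum_range, Finset.sum_mul]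
      exact Finset.sum_congr rfl fun i _ => by ring
    rw [e]
    refine ⟨integrable_finsetSum _ fun i _ => (hpow i).const_mul _, ?_⟩
    rw [integral_finsetSum _ fun i _ => (hpow i).const_mul _]
    refine Finset.sum_eq_zero fun i _ => ?_
    rw [integral_const_mul, hmono, mul_zero]
  have hsub : Set.Icc (2 : ℝ)⁻¹ (1 - ‖ξ‖)⁻¹ ⊆ Set.Ioi 0 := fun x hx =>
    lt_of_lt_of_le (by norm_num) hx.1
  have hfi : Integrable (fun y => f (X y) * G y) μ := by
    obtain ⟨M, hM⟩ := isCompact_Icc.exists_bound_of_continuousOn (hf.mono hsub)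
    refine (hGi.norm.const_mul M).mono' ((hfm.comp hXm).aestronglyMeasurable.mul hGi.1)
      (ae_of_all _ fun y => ?_)
    rw [norm_mul]
    exact mul_le_mul_of_nonneg_right (hM _ (hXmem y)) (norm_nonneg _)
  have hGn : 0 ≤ ∫ y, ‖G y‖ ∂μ := integral_nonneg fun _ => norm_nonneg _
  have hbound : ∀ ε : ℝ, 0 < ε → |∫ y, f (X y) * G y ∂μ| ≤ ε * ∫ y, ‖G y‖ ∂μ := by
    intro ε hε
    obtain ⟨P, hP⟩ := exists_polynomial_near_of_continuousOn _ _ f (hf.mono hsub) ε hε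
    obtain ⟨hPi, hP0⟩ := hpoly P
    rw [← sub_zero (∫ y, f (X y) * G y ∂μ), ← hP0, ← integral_sub hfi hPi,
      ← integral_const_mul, ← Real.norm_eq_abs]
    refine norm_integral_le_of_norm_le (hGi.norm.const_mul ε) (ae_of_all _ fun y => ?_)
    rw [← sub_mul, norm_mul, Real.norm_eq_abs, abs_sub_comm]
    exact mul_le_mul_of_nonneg_right (hP _ (hXmem y)).le (norm_nonneg _)
  rw [← abs_nonpos_iff]
  refine le_of_forall_pos_le_add fun δ hδ => ?_
  have h1 : 0 < 1 + ∫ y, ‖G y‖ ∂μ := by linarith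
  refine (hbound (δ / (1 + ∫ y, ‖G y‖ ∂μ)) (by positivity)).trans ?_
  rw [zero_add, div_mul_eq_mul_div, div_le_iff₀ h1]
  nlinarith

lemma integral_cos_sin_mul_eq_zero (hθm : Measurable θ) (hθ : ∀ y, ‖θ y‖ = 1)
    (hg : Integrable g μ) {N : ℕ} {ξ : E} (hξ : ‖ξ‖ < 1)
    (h0 : ∀ j : ℕ, ridgeTransform μ θ (N + j) g ξ = 0) (a : ℝ) :
    ∫ y, Real.cos (a * inner ℝ ξ (θ y)) * g y ∂μ = 0 ∧
      ∫ y, Real.sin (a * inner ℝ ξ (θ y)) * g y ∂μ = 0 := by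
  have key : ∀ F : ℝ → ℝ, Continuous F → ∫ y, F (a * inner ℝ ξ (θ y)) * g y ∂μ = 0 := by
    intro F hF
    have hcont : ContinuousOn (fun x : ℝ => F (a * (1 - x⁻¹)) * x⁻¹ ^ N) (Set.Ioi 0) := by
      have hinv : ContinuousOn (fun x : ℝ => x⁻¹) (Set.Ioi 0) :=
        continuousOn_id.inv₀ fun x hx => (ne_of_gt hx : (x : ℝ) ≠ 0)
      exact (hF.comp_continuousOn (continuousOn_const.mul (continuousOn_const.sub hinv))).mul
        (hinv.pow N)
    have hm : Measurable (fun x : ℝ => F (a * (1 - x⁻¹)) * x⁻¹ ^ N) :=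
      (hF.measurable.comp (by fun_prop)).mul (by fun_prop)
    rw [← integral_continuous_mul_eq_zero hθm hθ hg hξ h0 hcont hm]
    refine integral_congr_ae (ae_of_all _ fun y => ?_)
    have h1 := one_sub_le_one_sub_inner hθ (le_refl ‖ξ‖) y
    have h2 : 1 - inner ℝ ξ (θ y) ≠ 0 := by linarith
    simp only [inv_inv, sub_sub_cancel]
    rw [mul_assoc, ← mul_assoc (_ ^ N), ← mul_pow, mul_inv_cancel₀ h2, one_pow, one_mul]
  exact ⟨key _ Real.continuous_cos, key _ Real.continuous_sin⟩

/-- A function whose image measure under an injective map has vanishing Fourier transform is zero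
almost everywhere. -/
lemma ae_eq_zero_of_forall_integral_cos_sin (hemb : MeasurableEmbedding θ) (hg : Integrable g μ)
    (h : ∀ ξ : E, ∫ y, Real.cos (inner ℝ ξ (θ y)) * g y ∂μ = 0 ∧
      ∫ y, Real.sin (inner ℝ ξ (θ y)) * g y ∂μ = 0) : g =ᵐ[μ] 0 := by
  have hfin : ∀ f : Y → ℝ, Integrable f μ →
      ∫⁻ y, ENNReal.ofReal (f y) ∂μ ≠ ⊤ := fun f hf => hf.lintegral_lt_top.ne
  have hae : ∀ f : Y → ℝ, Integrable f μ → AEMeasurable (fun y => ENNReal.ofReal (f y)) μ :=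
    fun f hf => hf.1.aemeasurable.ennreal_ofReal
  set ν₁ := μ.withDensity fun y => ENNReal.ofReal (g y) with hν₁
  set ν₂ := μ.withDensity fun y => ENNReal.ofReal (-g y) with hν₂
  have : IsFiniteMeasure ν₁ := isFiniteMeasure_withDensity_ofReal hg.2
  have : IsFiniteMeasure ν₂ := isFiniteMeasure_withDensity_ofReal hg.neg.2
  have hchar : ∀ (f : Y → ℝ), Integrable f μ → ∀ ξ : E,
      charFun ((μ.withDensity fun y => ENNReal.ofReal (f y)).map θ) ξ =
      ∫ y, (max (f y) 0 : ℝ) • Complex.exp (inner ℝ (θ y) ξ * Complex.I) ∂μ := by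
    intro f hf ξ
    rw [charFun_apply, hemb.integral_map, integral_withDensity_eq_integral_toReal_smul₀ (hae f hf)
      (ae_of_all _ fun _ => ENNReal.ofReal_lt_top)]
    simp_rw [ENNReal.toReal_ofReal']
  have hint : ∀ (f : Y → ℝ), Integrable f μ → ∀ ξ : E,
      Integrable (fun y => f y • Complex.exp (inner ℝ (θ y) ξ * Complex.I)) μ := by
    intro f hf ξ
    have hθm := hemb.measurable
    have hm : Measurable fun y => Complex.exp ((inner ℝ (θ y) ξ : ℝ) * Complex.I) := by fun_prop
    refine hf.norm.mono' (hf.1.smul hm.aestronglyMeasurable) (ae_of_all _ fun y => ?_)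
    rw [norm_smul, Complex.norm_exp_ofReal_mul_I, mul_one]
  -- the positive and the negative part of `g` have image measures with the same Fourier transform
  have heq : ν₁.map θ = ν₂.map θ := by
    refine Measure.ext_of_charFun (funext fun ξ => ?_)
    rw [hν₁, hν₂, hchar g hg, hchar (fun y => -g y) hg.neg, ← sub_eq_zero,
      ← integral_sub (hint _ hg.pos_part ξ) (hint _ hg.neg_part ξ)]
    have e : ∀ y, (max (g y) 0 : ℝ) • Complex.exp ((inner ℝ (θ y) ξ : ℝ) * Complex.I) -
        (max (-g y) 0 : ℝ) • Complex.exp ((inner ℝ (θ y) ξ : ℝ) * Complex.I) =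
        ((Real.cos (inner ℝ ξ (θ y)) * g y : ℝ) : ℂ) +
          ((Real.sin (inner ℝ ξ (θ y)) * g y : ℝ) : ℂ) * Complex.I := by
      intro y
      rw [← sub_smul, real_inner_comm, Complex.exp_mul_I,
        show max (g y) 0 - max (-g y) 0 = g y by
          rcases le_total 0 (g y) with h | h
          · rw [max_eq_left h, max_eq_right (by linarith), sub_zero]
          · rw [max_eq_right h, max_eq_left (by linarith)]; ring, Complex.real_smul]
      push_cast
      ring
    simp_rw [e]
    have hθm := hemb.measurable
    have hc : Integrable (fun y => Real.cos (inner ℝ ξ (θ y)) * g y) μ :=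
      hg.norm.mono' ((by fun_prop : Measurable fun y =>
        Real.cos (inner ℝ ξ (θ y))).aestronglyMeasurable.mul hg.1) (ae_of_all _ fun y => by
          rw [norm_mul]
          exact mul_le_of_le_one_left (norm_nonneg _) (Real.abs_cos_le_one _))
    have hs : Integrable (fun y => Real.sin (inner ℝ ξ (θ y)) * g y) μ :=
      hg.norm.mono' ((by fun_prop : Measurable fun y =>
        Real.sin (inner ℝ ξ (θ y))).aestronglyMeasurable.mul hg.1) (ae_of_all _ fun y => by
          rw [norm_mul]
          exact mul_le_of_le_one_left (norm_nonneg _) (Real.abs_sin_le_one _))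
    rw [integral_add hc.ofReal (hs.ofReal.mul_const _), integral_mul_const]
    have h1 := integral_ofReal (𝕜 := ℂ) (μ := μ) (f := fun y => Real.cos (inner ℝ ξ (θ y)) * g y)
    have h2 := integral_ofReal (𝕜 := ℂ) (μ := μ) (f := fun y => Real.sin (inner ℝ ξ (θ y)) * g y)
    simp only [Complex.coe_algebraMap] at h1 h2
    rw [h1, h2, (h ξ).1, (h ξ).2]
    simp
  have heq' : ν₁ = ν₂ := by
    rw [← hemb.comap_map ν₁, heq, hemb.comap_map]
  rw [hν₁, hν₂, withDensity_eq_iff (hae g hg) (hae (fun y => -g y) hg.neg) (hfin g hg)] at heq'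
  filter_upwards [heq'] with y hy
  rcases le_total 0 (g y) with h0 | h0
  · rw [ENNReal.ofReal_of_nonpos (by linarith : -g y ≤ 0), ENNReal.ofReal_eq_zero] at hy
    exact le_antisymm hy h0
  · rw [ENNReal.ofReal_of_nonpos h0, eq_comm, ENNReal.ofReal_eq_zero] at hy
    exact le_antisymm h0 (by simpa using hy)

/-- An integrable density on the unit sphere with vanishing first moments is zero as soon as its
`kleinPotential` vanishes on one sphere of radius `r < 1`: the maximum principle and the equation
along rays kill all the transforms on a small sphere, and these determine the Fourier transform of
the density. -/
theorem ae_eq_zero_of_kleinPotential_eq_zero {ι : Type*} [Fintype ι] (b : OrthonormalBasis ι ℝ E)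
    (hι : 2 ≤ Fintype.card ι) (hemb : MeasurableEmbedding θ)
    (hθ : ∀ y, ‖θ y‖ = 1) (hg : Integrable g μ) {r : ℝ} (hr0 : 0 < r) (hr : r < 1)
    (hb : ∀ ξ : E, ‖ξ‖ = r → kleinPotential μ θ (Fintype.card ι) g ξ = 0)
    (hmom : ∀ ξ : E, ∫ y, inner ℝ ξ (θ y) * g y ∂μ = 0) : g =ᵐ[μ] 0 := by
  have hθm := hemb.measurable
  have hray : ∀ v : E, ‖v‖ = 1 → ∀ j : ℕ,
      ridgeTransform μ θ (Fintype.card ι + j) g ((r / 2) • v) = 0 := fun v hv j =>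
    ridgeTransform_add_eq_zero hθm hθ hg (by omega) hr hv
      (fun t ht => ridgeTransform_eq_zero_of_kleinPotential hθm hθ hg hr
        (fun ξ hξ => kleinPotential_eq_zero b hι hθm hθ hg hr0 hr hb hξ) hv (hmom v) ht.1 ht.2)
      j (r / 2) ⟨by positivity, by linarith⟩
  have hmain : ∀ v : E, ‖v‖ = 1 → ∀ a : ℝ, ∫ y, Real.cos (a * inner ℝ v (θ y)) * g y ∂μ = 0 ∧
      ∫ y, Real.sin (a * inner ℝ v (θ y)) * g y ∂μ = 0 := by
    intro v hv a
    have := integral_cos_sin_mul_eq_zero hθm hθ hg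
      (norm_smul_lt_one hv (by positivity) (by linarith)) (hray v hv) (a / (r / 2))
    simp_rw [real_inner_smul_left, ← mul_assoc] at this
    rwa [div_mul_cancel₀ _ (by positivity)] at this
  have : Nonempty ι := Fintype.card_pos_iff.mp (by omega)
  refine ae_eq_zero_of_forall_integral_cos_sin hemb hg fun ξ => ?_
  rcases eq_or_ne ξ 0 with rfl | hξ
  · obtain ⟨i⟩ := this
    simpa using hmain (b i) (by simp) 0
  · have h1 : ‖ξ‖ ≠ 0 := by simpa using hξ
    have := hmain (‖ξ‖⁻¹ • ξ) (by rw [norm_smul, norm_inv, norm_norm, inv_mul_cancel₀ h1]) ‖ξ‖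
    simp_rw [real_inner_smul_left, ← mul_assoc] at this
    simpa [mul_inv_cancel₀ h1] using this

end Uniqueness

end HalfSpaceBubble

/-! ### Green's formula on the half-space -/

namespace HalfSpaceBubble

section Divergence

variable {m : ℕ}

lemma measurableSet_halfSpace : MeasurableSet (halfSpace m) :=
  (isOpen_lt continuous_const (by fun_prop)).measurableSet

lemma norm_coordVec (i : Fin (m + 1)) : ‖(coordVec i : Space m)‖ = 1 := by simp [coordVec]

@[simp] lemma bdryPt_castSucc (y : Bdry m) (i : Fin m) : bdryPt y (Fin.castSucc i) = y i := by
  simp [bdryPt]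

@[simp] lemma bdryPt_last (y : Bdry m) : bdryPt y (Fin.last m) = 0 := by
  simp [bdryPt]

lemma norm_bdryPt (y : Bdry m) : ‖bdryPt y‖ = ‖y‖ := by
  rw [EuclideanSpace.norm_eq, EuclideanSpace.norm_eq, Fin.sum_univ_castSucc]
  simp

lemma continuous_bdryPt : Continuous (bdryPt : Bdry m → Space m) := by
  refine (PiLp.continuous_toLp 2 _).comp (continuous_pi fun i => ?_)
  refine Fin.lastCases ?_ (fun j => ?_) i
  · simpa using continuous_const
  · simp only [Fin.snoc_castSucc]
    fun_prop

/-- The decomposition of a point of `ℝⁿ` into its last coordinate and its boundary component. -/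
noncomputable def sliceEquiv (m : ℕ) : (ℝ × Bdry m) ≃ᵐ Space m :=
  ((MeasurableEquiv.prodCongr (MeasurableEquiv.refl ℝ)
    (MeasurableEquiv.toLp 2 (Fin m → ℝ)).symm).trans
    (MeasurableEquiv.piFinSuccAbove (fun _ => ℝ) (Fin.last m)).symm).trans
    (MeasurableEquiv.toLp 2 (Fin (m + 1) → ℝ))

lemma sliceEquiv_apply (p : ℝ × Bdry m) :
    sliceEquiv m p = bdryPt p.2 + p.1 • coordVec (Fin.last m) := by
  ext i
  refine Fin.lastCases ?_ (fun j => ?_) i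
  · simp [sliceEquiv, MeasurableEquiv.piFinSuccAbove, coordVec]
    rfl
  · simp [sliceEquiv, MeasurableEquiv.piFinSuccAbove, coordVec]
    rfl

lemma measurePreserving_sliceEquiv : MeasurePreserving (sliceEquiv m) := by
  have h1 : MeasurePreserving (MeasurableEquiv.prodCongr (MeasurableEquiv.refl ℝ)
      (MeasurableEquiv.toLp 2 (Fin m → ℝ)).symm) (volume : Measure (ℝ × Bdry m)) volume :=
    (MeasurePreserving.id volume).prod
      (EuclideanSpace.volume_preserving_symm_measurableEquiv_toLp (Fin m))
  have h2 := (volume_preserving_piFinSuccAbove (fun _ : Fin (m + 1) => ℝ) (Fin.last m)).symm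
  have h3 := (EuclideanSpace.volume_preserving_symm_measurableEquiv_toLp (Fin (m + 1))).symm
  exact h3.comp (h2.comp h1)

lemma integral_halfVol_eq {f : Space m → ℝ} (hf : Integrable f (halfVol m)) :
    ∫ x, f x ∂(halfVol m) =
      ∫ y : Bdry m, ∫ s in Set.Ioi (0 : ℝ), f (bdryPt y + s • coordVec (Fin.last m)) := by
  have hpre : sliceEquiv m ⁻¹' halfSpace m = Set.Ioi (0 : ℝ) ×ˢ Set.univ := by
    ext p
    simp [halfSpace, sliceEquiv_apply, coordVec]
  have hmp : MeasurePreserving (sliceEquiv m)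
      ((volume.restrict (Set.Ioi (0 : ℝ))).prod (volume : Measure (Bdry m))) (halfVol m) := by
    have := (measurePreserving_sliceEquiv (m := m)).restrict_preimage
      (measurableSet_halfSpace (m := m))
    rw [hpre] at this
    rwa [show (volume.restrict (Set.Ioi (0 : ℝ))).prod (volume : Measure (Bdry m)) =
      volume.restrict (Set.Ioi (0 : ℝ) ×ˢ Set.univ) by
        rw [Measure.volume_eq_prod, ← Measure.prod_restrict, Measure.restrict_univ]]
  rw [← hmp.integral_comp (sliceEquiv m).measurableEmbedding, integral_prod_symm]
  · simp_rw [sliceEquiv_apply]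
  · exact (hmp.integrable_comp_emb (sliceEquiv m).measurableEmbedding).mpr hf

lemma integrable_halfVol_of_continuous {f : Space m → ℝ} (hf : Continuous f)
    (hc : HasCompactSupport f) : Integrable f (halfVol m) :=
  (hf.integrable_of_hasCompactSupport hc).mono_measure Measure.restrict_le_self

lemma integral_halfVol_fderiv_last {h : Space m → ℝ} (hh : ContDiff ℝ 1 h)
    (hc : HasCompactSupport h) :
    ∫ x, fderiv ℝ h x (coordVec (Fin.last m)) ∂(halfVol m) = -∫ y : Bdry m, h (bdryPt y) := by
  rw [integral_halfVol_eq (integrable_halfVol_of_continuous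
    ((hh.continuous_fderiv one_ne_zero).clm_apply continuous_const) (hc.fderiv_apply ℝ _)),
    ← integral_neg]
  refine integral_congr_ae (ae_of_all _ fun y => ?_)
  set e : Space m := coordVec (Fin.last m)
  have hl : ContDiff ℝ 1 (fun s : ℝ => bdryPt y + s • e) := by fun_prop
  have hiso : Isometry (fun s : ℝ => bdryPt y + s • e) := by
    refine Isometry.of_dist_eq fun s t => ?_
    rw [dist_add_left, dist_eq_norm, ← sub_smul, norm_smul, norm_coordVec, mul_one]
    rfl
  have hcs : HasCompactSupport (fun s : ℝ => h (bdryPt y + s • e)) :=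
    hc.comp_isClosedEmbedding hiso.isClosedEmbedding
  have := HasCompactSupport.integral_Ioi_deriv_eq (hh.comp hl) hcs 0
  simp only [Function.comp_apply, zero_smul, add_zero] at this
  beta_reduce
  rw [← this]
  refine setIntegral_congr_fun measurableSet_Ioi fun s _ => ?_
  have h1 : HasDerivAt (fun s : ℝ => bdryPt y + s • e) e s := by
    simpa using ((hasDerivAt_id s).smul_const e).const_add (bdryPt y)
  exact (((hh.differentiable one_ne_zero) _).hasFDerivAt.comp_hasDerivAt s h1).deriv.symm

lemma integral_halfVol_fderiv_castSucc {h : Space m → ℝ} (hh : ContDiff ℝ 1 h)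
    (hc : HasCompactSupport h) (i : Fin m) :
    ∫ x, fderiv ℝ h x (coordVec (Fin.castSucc i)) ∂(halfVol m) = 0 := by
  set e : Space m := coordVec (Fin.castSucc i)
  have hcd : Continuous fun x => fderiv ℝ h x e :=
    (hh.continuous_fderiv one_ne_zero).clm_apply continuous_const
  have hi1 := (hh.continuous.integrable_of_hasCompactSupport (μ := volume) hc).indicator
    (measurableSet_halfSpace (m := m))
  have hi2 := (hcd.integrable_of_hasCompactSupport (μ := volume)
    (hc.fderiv_apply ℝ e)).indicator (measurableSet_halfSpace (m := m))
  -- translations along the boundary preserve the half-space, so that the indicator is harmless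
  have hline : ∀ x, HasLineDerivAt ℝ ((halfSpace m).indicator h)
      ((halfSpace m).indicator (fun x => fderiv ℝ h x e) x) x e := by
    intro x
    have hmem : ∀ t : ℝ, x + t • e ∈ halfSpace m ↔ x ∈ halfSpace m := by
      intro t
      simp [halfSpace, e, coordVec]
    by_cases hx : x ∈ halfSpace m
    · have := (((hh.differentiable one_ne_zero) x).hasFDerivAt.hasLineDerivAt e)
      rw [Set.indicator_of_mem hx]
      refine HasDerivAt.congr_of_eventuallyEq this (Eventually.of_forall fun t => ?_)
      simp only
      rw [Set.indicator_of_mem ((hmem t).mpr hx)]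
    · rw [Set.indicator_of_notMem hx]
      refine HasDerivAt.congr_of_eventuallyEq (hasDerivAt_const (0 : ℝ) (0 : ℝ))
        (Eventually.of_forall fun t => ?_)
      simp only
      rw [Set.indicator_of_notMem (fun h' => hx ((hmem t).mp h'))]
  have := integral_bilinear_hasLineDerivAt_right_eq_neg_left_of_integrable (μ := volume)
    (f := fun _ : Space m => (1 : ℝ)) (f' := fun _ => 0) (g := (halfSpace m).indicator h)
    (g' := (halfSpace m).indicator (fun x => fderiv ℝ h x e)) (v := e)
    (B := ContinuousLinearMap.mul ℝ ℝ) (by simp) (by simpa using hi2) (by simpa using hi1)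
    (fun _ _ => hasDerivAt_const (0 : ℝ) (1 : ℝ)) (fun x _ => hline x)
  simp only [ContinuousLinearMap.mul_apply', one_mul, zero_mul, integral_zero, neg_zero] at this
  rwa [integral_indicator measurableSet_halfSpace] at this

/-- The open half-space `{x : x_n > -δ}`, a neighbourhood of the closure of `halfSpace m`. -/
def enlargedHalfSpace (m : ℕ) (δ : ℝ) : Set (Space m) := {x | -δ < x (Fin.last m)}

lemma isOpen_enlargedHalfSpace (δ : ℝ) : IsOpen (enlargedHalfSpace m δ) :=
  isOpen_lt continuous_const (by fun_prop)

lemma halfSpace_subset_enlarged {δ : ℝ} (hδ : 0 < δ) : halfSpace m ⊆ enlargedHalfSpace m δ :=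
  fun _ hx => (neg_lt_zero.mpr hδ).trans hx

lemma bdryPt_mem_enlarged {δ : ℝ} (hδ : 0 < δ) (y : Bdry m) :
    bdryPt y ∈ enlargedHalfSpace m δ := by
  simpa [enlargedHalfSpace] using hδ

/-- A cutoff in the variable `x_n` that allows to extend functions from a neighbourhood of the
closed half-space to the whole space. -/
lemma exists_vertical_cutoff {δ : ℝ} (hδ : 0 < δ) : ∃ κ : Space m → ℝ, ContDiff ℝ ∞ κ ∧
    (∀ x : Space m, -(δ / 3) < x (Fin.last m) → κ x = 1) ∧
    tsupport κ ⊆ enlargedHalfSpace m δ := by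
  refine ⟨fun x => Real.smoothTransition ((x (Fin.last m) + 2 * δ / 3) / (δ / 3)), ?_, ?_, ?_⟩
  · refine Real.smoothTransition.contDiff.comp ?_
    fun_prop
  · intro x hx
    refine Real.smoothTransition.one_of_one_le ?_
    rw [one_le_div (by positivity)]
    linarith
  · have hcl : IsClosed {x : Space m | -(2 * δ / 3) ≤ x (Fin.last m)} :=
      isClosed_le continuous_const (by fun_prop)
    refine (closure_minimal (fun _ hx => ?_) hcl).trans fun x hx => ?_
    · by_contra hlt
      simp only [Set.mem_ofPred_eq, not_le] at hlt
      refine hx (Real.smoothTransition.zero_of_nonpos ?_)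
      exact div_nonpos_of_nonpos_of_nonneg (by linarith) (by positivity)
    · simp only [Set.mem_ofPred_eq] at hx
      simp only [enlargedHalfSpace, Set.mem_ofPred_eq]
      linarith

lemma contDiff_mul_of_tsupport {E : Type*} [NormedAddCommGroup E] [NormedSpace ℝ E]
    {n : WithTop ℕ∞} {κ f : E → ℝ} {Ω : Set E} (hΩ : IsOpen Ω) (hκ : ContDiff ℝ n κ)
    (hs : tsupport κ ⊆ Ω) (hf : ContDiffOn ℝ n f Ω) : ContDiff ℝ n fun x => κ x * f x := by
  rw [contDiff_iff_contDiffAt]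
  intro x
  by_cases hx : x ∈ tsupport κ
  · exact hκ.contDiffAt.mul (hf.contDiffAt (hΩ.mem_nhds (hs hx)))
  · refine (contDiffAt_const (c := (0 : ℝ))).congr_of_eventuallyEq ?_
    filter_upwards [notMem_tsupport_iff_eventuallyEq.mp hx] with y hy
    rw [hy]
    simp

lemma integrable_mul_of_continuousOn {δ : ℝ} (hδ : 0 < δ) {φ f : Space m → ℝ}
    (hφ : Continuous φ) (hc : HasCompactSupport φ)
    (hf : ContinuousOn f (enlargedHalfSpace m δ)) :
    Integrable (fun x => φ x * f x) (halfVol m) := by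
  obtain ⟨κ, hκ, hκ1, hκs⟩ := exists_vertical_cutoff (m := m) hδ
  have h0 : Continuous fun x => κ x * f x :=
    contDiff_zero.mp (contDiff_mul_of_tsupport (isOpen_enlargedHalfSpace δ)
      (hκ.of_le (by simp)) hκs (contDiffOn_zero.mpr hf))
  have h1 := integrable_halfVol_of_continuous (hφ.mul h0) hc.mul_right
  refine h1.congr ?_
  filter_upwards [ae_restrict_mem measurableSet_halfSpace] with x hx
  have : 0 < x (Fin.last m) := hx
  simp [hκ1 x (by linarith)]

/-- The divergence of a vector field. -/
noncomputable def divergence (F : Space m → Space m) (x : Space m) : ℝ :=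
  ∑ i, fderiv ℝ F x (coordVec i) i

/-- Green's formula on the half-space, for a test function and a vector field of class `C¹` near the
closed half-space. -/
theorem integral_inner_gradient_eq {δ : ℝ} (hδ : 0 < δ) {φ : Space m → ℝ} (hφ : IsTest φ)
    {F : Space m → Space m} (hF : ContDiffOn ℝ 1 F (enlargedHalfSpace m δ)) :
    ∫ x, inner ℝ (gradient φ x) (F x) ∂(halfVol m) =
      -(∫ x, φ x * divergence F x ∂(halfVol m)) -
        ∫ y : Bdry m, φ (bdryPt y) * F (bdryPt y) (Fin.last m) := by
  set Ω := enlargedHalfSpace m δ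
  have hΩ : IsOpen Ω := isOpen_enlargedHalfSpace δ
  obtain ⟨κ, hκ, hκ1, hκs⟩ := exists_vertical_cutoff (m := m) hδ
  have hFi : ∀ i, ContDiffOn ℝ 1 (fun x => F x i) Ω := fun i => by fun_prop
  have hφ1 : ContDiff ℝ 1 φ := hφ.1.of_le (by simp)
  set h : Fin (m + 1) → Space m → ℝ := fun i x => φ x * (κ x * F x i) with hh
  have hhc : ∀ i, ContDiff ℝ 1 (h i) := fun i =>
    hφ1.mul (contDiff_mul_of_tsupport hΩ (hκ.of_le (by simp)) hκs (hFi i))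
  have hhs : ∀ i, HasCompactSupport (h i) := fun i => hφ.2.mul_right
  have hnear : ∀ x ∈ halfSpace m, ∀ᶠ y in 𝓝 x, κ y = 1 := by
    intro x hx
    have : {y : Space m | -(δ / 3) < y (Fin.last m)} ∈ 𝓝 x :=
      (isOpen_lt continuous_const (by fun_prop)).mem_nhds (by
        have : 0 < x (Fin.last m) := hx
        simp only [Set.mem_ofPred_eq]
        linarith)
    exact mem_of_superset this hκ1
  have hder : ∀ i, ∀ x ∈ halfSpace m, fderiv ℝ (h i) x (coordVec i) =
      fderiv ℝ φ x (coordVec i) * F x i + φ x * fderiv ℝ F x (coordVec i) i := by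
    intro i x hx
    have e1 : h i =ᶠ[𝓝 x] fun y => φ y * F y i := by
      filter_upwards [hnear x hx] with y hy
      simp [hh, hy]
    have hFd : DifferentiableAt ℝ F x :=
      (hF.contDiffAt (hΩ.mem_nhds (halfSpace_subset_enlarged hδ hx))).differentiableAt one_ne_zero
    have h2 : HasFDerivAt (fun y => F y i)
        ((EuclideanSpace.proj i : Space m →L[ℝ] ℝ).comp (fderiv ℝ F x)) x :=
      (EuclideanSpace.proj i : Space m →L[ℝ] ℝ).hasFDerivAt.comp x hFd.hasFDerivAt
    have h3 := ((hφ1.differentiable one_ne_zero) x).hasFDerivAt.mul h2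
    have h4 : fderiv ℝ (fun y => φ y * F y i) x = _ := h3.fderiv
    rw [e1.fderiv_eq, h4]
    simp
    ring
  have hFc : ∀ i, ContinuousOn (fun x => F x i) Ω := fun i => (hFi i).continuousOn
  have hFd : ∀ i, ContinuousOn (fun x => fderiv ℝ F x (coordVec i) i) Ω := by
    intro i
    have h1 := hF.continuousOn_fderiv_of_isOpen hΩ le_rfl
    exact (EuclideanSpace.proj i : Space m →L[ℝ] ℝ).continuous.comp_continuousOn
      (h1.clm_apply continuousOn_const)
  have hint1 : ∀ i, Integrable (fun x => fderiv ℝ φ x (coordVec i) * F x i) (halfVol m) :=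
    fun i => integrable_mul_of_continuousOn hδ
      ((hφ1.continuous_fderiv one_ne_zero).clm_apply continuous_const)
      (hφ.2.fderiv_apply ℝ _) (hFc i)
  have hint2 : ∀ i, Integrable (fun x => φ x * fderiv ℝ F x (coordVec i) i) (halfVol m) :=
    fun i => integrable_mul_of_continuousOn hδ hφ.1.continuous hφ.2 (hFd i)
  have hsplit : ∀ i, ∫ x, fderiv ℝ φ x (coordVec i) * F x i ∂(halfVol m) +
      ∫ x, φ x * fderiv ℝ F x (coordVec i) i ∂(halfVol m) =
      ∫ x, fderiv ℝ (h i) x (coordVec i) ∂(halfVol m) := by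
    intro i
    rw [← integral_add (hint1 i) (hint2 i)]
    refine integral_congr_ae ?_
    filter_upwards [ae_restrict_mem measurableSet_halfSpace] with x hx using (hder i x hx).symm
  have e1 : ∀ x, inner ℝ (gradient φ x) (F x) = ∑ i, fderiv ℝ φ x (coordVec i) * F x i := by
    intro x
    rw [inner_gradient_left]
    conv_lhs => rw [← (EuclideanSpace.basisFun (Fin (m + 1)) ℝ).sum_repr (F x)]
    simp [map_sum, coordVec, mul_comm]
  simp_rw [e1, divergence, Finset.mul_sum]
  rw [integral_finsetSum _ fun i _ => hint1 i, integral_finsetSum _ fun i _ => hint2 i]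
  have e2 : ∑ i, ∫ x, fderiv ℝ (h i) x (coordVec i) ∂(halfVol m) =
      -∫ y : Bdry m, φ (bdryPt y) * F (bdryPt y) (Fin.last m) := by
    rw [Fin.sum_univ_castSucc, Finset.sum_eq_zero fun i _ =>
      integral_halfVol_fderiv_castSucc (hhc _) (hhs _) i, zero_add,
      integral_halfVol_fderiv_last (hhc _) (hhs _)]
    congr 1
    refine integral_congr_ae (ae_of_all _ fun y => ?_)
    simp only [hh]
    rw [hκ1 _ (by simpa using hδ), one_mul]
  simp_rw [← hsplit, Finset.sum_add_distrib] at e2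
  linarith

end Divergence

end HalfSpaceBubble

/-! ### Profiles: conformal factor times a function of a Minkowski linear form -/

namespace HalfSpaceBubble

section Profiles

variable {m : ℕ}

/-- The point `z = x + D 𝔢_n`. -/
noncomputable def shift (D : ℝ) (x : Space m) : Space m := x + D • coordVec (Fin.last m)

/-- `|x + D 𝔢_n|² - 1`. -/
noncomputable def quad (D : ℝ) (x : Space m) : ℝ := ‖shift D x‖ ^ 2 - 1

/-- The quotient `(A (|z|² + 1) + 2 ⟨B, z⟩) / (|z|² - 1)`, `z = x + D 𝔢_n`. Up to a constant it is
the restriction of a linear form on Minkowski space to the hyperboloid, in the coordinates of the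
exterior of the unit ball. -/
noncomputable def ratio (D A : ℝ) (B : Space m) (x : Space m) : ℝ :=
  (A * (quad D x + 2) + 2 * inner ℝ B (shift D x)) / quad D x

/-- The conformal weight `-(n-2)/2`. -/
noncomputable def weight (m : ℕ) : ℝ := -(dim m - 2) / 2

/-- The function `(|z|² - 1)^{-(n-2)/2} f(t)`, where `t` is the `ratio`. -/
noncomputable def profile (D A : ℝ) (B : Space m) (f : ℝ → ℝ) (x : Space m) : ℝ :=
  quad D x ^ weight m * f (ratio D A B x)

/-- The gradient of `profile D A B f`, where `f₁` stands for the derivative of `f`. -/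
noncomputable def profileGrad (D A : ℝ) (B : Space m) (f f₁ : ℝ → ℝ) (x : Space m) : Space m :=
  (2 * quad D x ^ (weight m - 1) * (weight m * f (ratio D A B x) +
      (A - ratio D A B x) * f₁ (ratio D A B x))) • shift D x +
    (2 * quad D x ^ (weight m - 1) * f₁ (ratio D A B x)) • B

/-- `f` is smooth on the set `I`, with first and second derivatives `f₁` and `f₂`. -/
structure IsProfile (I : Set ℝ) (f f₁ f₂ : ℝ → ℝ) : Prop where
  contDiffOn : ContDiffOn ℝ ∞ f I
  contDiffOn_deriv : ContDiffOn ℝ ∞ f₁ I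
  hasDerivAt : ∀ s ∈ I, HasDerivAt f (f₁ s) s
  hasDerivAt_deriv : ∀ s ∈ I, HasDerivAt f₁ (f₂ s) s

lemma hasFDerivAt_shift (D : ℝ) (x : Space m) :
    HasFDerivAt (shift D) (ContinuousLinearMap.id ℝ (Space m)) x :=
  (hasFDerivAt_id x).add_const _

lemma hasFDerivAt_quad (D : ℝ) (x : Space m) :
    HasFDerivAt (quad D) ((2 : ℝ) • innerSL ℝ (shift D x)) x := by
  have := ((hasFDerivAt_shift D x).norm_sq).sub_const 1
  convert! this using 1
  ext v
  simp [two_smul]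

lemma norm_shift_sq (D : ℝ) (x : Space m) : ‖shift D x‖ ^ 2 = quad D x + 1 := by
  simp [quad]

lemma ratio_mul_quad {D : ℝ} (A : ℝ) (B : Space m) {x : Space m} (hq : 0 < quad D x) :
    ratio D A B x * quad D x = A * (quad D x + 2) + 2 * inner ℝ B (shift D x) := by
  rw [ratio, div_mul_cancel₀ _ hq.ne']

lemma hasFDerivAt_ratio {D : ℝ} (A : ℝ) (B : Space m) {x : Space m} (hq : 0 < quad D x) :
    HasFDerivAt (ratio D A B)
      ((2 * (quad D x)⁻¹) • ((A - ratio D A B x) • innerSL ℝ (shift D x) + innerSL ℝ B)) x := by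
  have h1 := hasFDerivAt_quad D x
  have h2 : HasFDerivAt (fun x => inner ℝ B (shift D x)) (innerSL ℝ B) x :=
    (innerSL ℝ B).hasFDerivAt.comp x (hasFDerivAt_shift D x)
  have h3 := (((h1.add_const 2).const_mul A).add (h2.const_mul 2)).mul
    ((hasDerivAt_inv hq.ne').comp_hasFDerivAt x h1)
  have : ratio D A B = (fun x => (A * (quad D x + 2) + 2 * inner ℝ B (shift D x)) *
      (quad D x)⁻¹) := by
    ext y; rw [ratio, div_eq_mul_inv]
  rw [this]
  convert! h3 using 1
  ext v
  simp
  field_simp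
  ring

lemma hasFDerivAt_quad_rpow {D : ℝ} (a : ℝ) {x : Space m} (hq : 0 < quad D x) :
    HasFDerivAt (fun x => quad D x ^ a)
      ((2 * a * quad D x ^ (a - 1)) • innerSL ℝ (shift D x)) x := by
  convert! (hasFDerivAt_quad D x).rpow_const (p := a) (Or.inl hq.ne') using 1
  rw [smul_smul]
  ring_nf

variable {D A : ℝ} {B : Space m} {I : Set ℝ} {f f₁ f₂ : ℝ → ℝ}

lemma hasFDerivAt_comp_ratio {g g' : ℝ → ℝ} {x : Space m} (hq : 0 < quad D x)
    (hg : HasDerivAt g (g' (ratio D A B x)) (ratio D A B x)) :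
    HasFDerivAt (fun x => g (ratio D A B x)) (g' (ratio D A B x) • ((2 * (quad D x)⁻¹) •
      ((A - ratio D A B x) • innerSL ℝ (shift D x) + innerSL ℝ B))) x :=
  hg.comp_hasFDerivAt x (hasFDerivAt_ratio A B hq)

lemma hasGradientAt_profile (hf : IsProfile I f f₁ f₂) {x : Space m} (hq : 0 < quad D x)
    (ht : ratio D A B x ∈ I) :
    HasGradientAt (profile D A B f) (profileGrad D A B f f₁ x) x := by
  rw [hasGradientAt_iff_hasFDerivAt]
  have h := (hasFDerivAt_quad_rpow (weight m) hq).mul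
    (hasFDerivAt_comp_ratio hq (hf.hasDerivAt _ ht))
  convert! h using 1
  ext v
  have hpow : quad D x ^ weight m = quad D x ^ (weight m - 1) * quad D x := by
    rw [← Real.rpow_add_one hq.ne', sub_add_cancel]
  simp only [profileGrad, InnerProductSpace.toDual_apply_apply, inner_add_left,
    real_inner_smul_left, add_apply, smul_apply,
    innerSL_apply_apply, smul_eq_mul, hpow]
  field_simp
  ring

lemma contDiffOn_quad_rpow {n : WithTop ℕ∞} (a : ℝ) {Ω : Set (Space m)}
    (hΩ : ∀ x ∈ Ω, 0 < quad D x) : ContDiffOn ℝ n (fun x => quad D x ^ a) Ω := by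
  have h : ContDiff ℝ n (quad D : Space m → ℝ) := by
    unfold quad shift
    exact ((contDiff_id.add contDiff_const).norm_sq ℝ).sub contDiff_const
  exact h.contDiffOn.rpow_const_of_ne fun x hx => (hΩ x hx).ne'

lemma contDiffOn_ratio {n : WithTop ℕ∞} {Ω : Set (Space m)} (hΩ : ∀ x ∈ Ω, 0 < quad D x) :
    ContDiffOn ℝ n (ratio D A B) Ω := by
  have h0 : ContDiff ℝ n (shift D : Space m → Space m) := contDiff_id.add contDiff_const
  have h : ContDiff ℝ n (quad D : Space m → ℝ) := (h0.norm_sq ℝ).sub contDiff_const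
  unfold ratio
  exact ((contDiff_const.mul (h.add contDiff_const)).add
    (contDiff_const.mul (contDiff_const.inner ℝ h0))).contDiffOn.div h.contDiffOn
    fun x hx => (hΩ x hx).ne'

lemma contDiffOn_profile (hf : IsProfile I f f₁ f₂) {Ω : Set (Space m)}
    (hΩ : ∀ x ∈ Ω, 0 < quad D x) (hI : Set.MapsTo (ratio D A B) Ω I) :
    ContDiffOn ℝ ∞ (profile D A B f) Ω :=
  (contDiffOn_quad_rpow _ hΩ).mul (hf.contDiffOn.comp (contDiffOn_ratio hΩ) hI)

lemma contDiffOn_profileGrad (hf : IsProfile I f f₁ f₂) {Ω : Set (Space m)}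
    (hΩ : ∀ x ∈ Ω, 0 < quad D x) (hI : Set.MapsTo (ratio D A B) Ω I) :
    ContDiffOn ℝ ∞ (profileGrad D A B f f₁) Ω := by
  have h0 : ContDiff ℝ ∞ (shift D : Space m → Space m) := contDiff_id.add contDiff_const
  have h1 := hf.contDiffOn.comp (contDiffOn_ratio hΩ) hI
  have h2 := hf.contDiffOn_deriv.comp (contDiffOn_ratio hΩ) hI
  have h3 := contDiffOn_quad_rpow (m := m) (n := ∞) (weight m - 1) hΩ
  have h4 : ContDiffOn ℝ ∞ (ratio D A B) Ω := contDiffOn_ratio hΩ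
  exact (((contDiffOn_const.mul h3).mul ((contDiffOn_const.mul h1).add
    ((contDiffOn_const.sub h4).mul h2))).smul h0.contDiffOn).add
    (((contDiffOn_const.mul h3).mul h2).smul contDiffOn_const)

lemma divergence_smul_add_smul {P Q : Space m → ℝ} {P' Q' : Space m →L[ℝ] ℝ} {x : Space m}
    (hP : HasFDerivAt P P' x) (hQ : HasFDerivAt Q Q' x) :
    divergence (fun x => P x • shift D x + Q x • B) x =
      P' (shift D x) + dim m * P x + Q' B := by
  have h := (hP.smul (hasFDerivAt_shift D x)).add (hQ.smul (hasFDerivAt_const B x))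
  have hsum : ∀ (T : Space m →L[ℝ] ℝ) (v : Space m), ∑ i, T (coordVec i) * v i = T v := by
    intro T v
    conv_rhs => rw [← (EuclideanSpace.basisFun (Fin (m + 1)) ℝ).sum_repr v]
    simp [map_sum, coordVec, mul_comm]
  rw [divergence]
  have h' : fderiv ℝ (fun x => P x • shift D x + Q x • B) x = _ := h.fderiv
  rw [h', ← hsum P' (shift D x), ← hsum Q' B]
  simp [coordVec, Finset.sum_add_distrib]
  ring

/-- The Laplacian of a profile: by conformal covariance it only involves the value of the ratio `t`
and the Minkowski norm `|B|² - A²`. -/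
lemma divergence_profileGrad (hf : IsProfile I f f₁ f₂) {x : Space m} (hq : 0 < quad D x)
    (ht : ratio D A B x ∈ I) :
    divergence (profileGrad D A B f f₁) x = quad D x ^ (weight m - 2) *
      (dim m * (dim m - 2) * f (ratio D A B x) + 4 * dim m * ratio D A B x * f₁ (ratio D A B x) +
        4 * (‖B‖ ^ 2 - A ^ 2 + ratio D A B x ^ 2) * f₂ (ratio D A B x)) := by
  have hw := (hasFDerivAt_quad_rpow (D := D) (weight m - 1) hq).const_mul 2
  have hF := hasFDerivAt_comp_ratio hq (hf.hasDerivAt _ ht)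
  have hF1 := hasFDerivAt_comp_ratio hq (hf.hasDerivAt_deriv _ ht)
  have hP := hw.mul ((hF.const_mul (weight m)).add
    (((hasFDerivAt_ratio A B hq).const_sub A).mul hF1))
  have hQ := hw.mul hF1
  have := divergence_smul_add_smul (D := D) (B := B) hP hQ
  refine (show divergence (profileGrad D A B f f₁) x = _ from this).trans ?_
  have hz := norm_shift_sq D x
  have hl := ratio_mul_quad A B hq
  have e1 : quad D x ^ (weight m - 1) = quad D x ^ (weight m - 2) * quad D x := by
    rw [← Real.rpow_add_one hq.ne']; ring_nf
  have e2 : quad D x ^ (weight m - 1 - 1) = quad D x ^ (weight m - 2) := by ring_nf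
  simp only [add_apply, smul_apply,
    innerSL_apply_apply, smul_eq_mul, e1, e2, neg_apply,
    real_inner_self_eq_norm_sq, hz, Pi.mul_apply, Pi.add_apply]
  rw [real_inner_comm B (shift D x)]
  generalize ratio D A B x = t at *
  generalize quad D x ^ (weight m - 2) = w at *
  have hb : inner ℝ B (shift D x) = (t * quad D x - A * (quad D x + 2)) / 2 := by linarith
  rw [hb]
  generalize quad D x = q at *
  have hwt : dim m = 2 - 2 * weight m := by rw [weight]; ring
  rw [hwt]
  field_simp
  ring

end Profiles

end HalfSpaceBubble

/-! ### Decay estimates and cutoffs -/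

namespace HalfSpaceBubble

section Decay

variable {m : ℕ} {D : ℝ}

lemma shift_last (D : ℝ) (x : Space m) : shift D x (Fin.last m) = x (Fin.last m) + D := by
  simp [shift, coordVec]

lemma quad_eq (D : ℝ) (x : Space m) :
    quad D x = ‖x‖ ^ 2 + 2 * D * x (Fin.last m) + (D ^ 2 - 1) := by
  rw [quad, shift, norm_add_sq_real, norm_smul, norm_coordVec, real_inner_smul_right]
  simp [coordVec, EuclideanSpace.inner_single_right]
  ring

lemma quad_pos (hD : 1 < D) {x : Space m} (hx : x ∈ enlargedHalfSpace m ((D - 1) / 2)) :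
    0 < quad D x := by
  have h1 : -((D - 1) / 2) < x (Fin.last m) := hx
  have h2 : |shift D x (Fin.last m)| ≤ ‖shift D x‖ := by
    simpa using PiLp.norm_apply_le (shift D x) (Fin.last m)
  rw [shift_last] at h2
  have h3 := (le_abs_self _).trans h2
  rw [quad]
  nlinarith

lemma quad_ge (hD : 1 < D) {x : Space m} (hx : 0 ≤ x (Fin.last m)) :
    ‖x‖ ^ 2 + (D ^ 2 - 1) ≤ quad D x := by
  rw [quad_eq]
  have : 0 ≤ 2 * D * x (Fin.last m) := by positivity
  linarith

lemma quad_ge_const (hD : 1 < D) {x : Space m} (hx : 0 ≤ x (Fin.last m)) :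
    D ^ 2 - 1 ≤ quad D x :=
  (le_add_of_nonneg_left (sq_nonneg _)).trans (quad_ge hD hx)

lemma sq_sub_one_pos (hD : 1 < D) : 0 < D ^ 2 - 1 := by nlinarith

lemma quad_pos' (hD : 1 < D) {x : Space m} (hx : 0 ≤ x (Fin.last m)) : 0 < quad D x :=
  (sq_sub_one_pos hD).trans_le (quad_ge_const hD hx)

/-- `|z|² - 1` is comparable from below to `(1 + |x|)²` on the closed half-space. -/
lemma exists_mul_one_add_norm_sq_le_quad (hD : 1 < D) : ∃ c : ℝ, 0 < c ∧
    ∀ x : Space m, 0 ≤ x (Fin.last m) → c * (1 + ‖x‖) ^ 2 ≤ quad D x := by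
  have h0 := sq_sub_one_pos hD
  refine ⟨min 1 (D ^ 2 - 1) / 2, by positivity, fun x hx => ?_⟩
  have h1 := quad_ge hD hx
  have h2 := min_le_left 1 (D ^ 2 - 1)
  have h3 := min_le_right 1 (D ^ 2 - 1)
  have h4 : 0 < min 1 (D ^ 2 - 1) := by positivity
  have h5 : (1 + ‖x‖) ^ 2 ≤ 2 * (1 + ‖x‖ ^ 2) := by nlinarith [sq_nonneg (1 - ‖x‖)]
  nlinarith [sq_nonneg ‖x‖, mul_le_mul_of_nonneg_left h5 h4.le,
    mul_le_mul_of_nonneg_right h2 (sq_nonneg ‖x‖)]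

lemma quad_le (hD : 1 < D) (x : Space m) : quad D x ≤ D ^ 2 * (1 + ‖x‖) ^ 2 := by
  have h1 : ‖shift D x‖ ≤ D * (1 + ‖x‖) := by
    refine (norm_add_le _ _).trans ?_
    rw [norm_smul, norm_coordVec, mul_one, Real.norm_eq_abs, abs_of_pos (by linarith)]
    nlinarith [norm_nonneg x]
  rw [quad, ← mul_pow]
  have := pow_le_pow_left₀ (norm_nonneg _) h1 2
  linarith

/-- `(|z|² - 1)^{-(n-1)/2}`, which dominates all the functions that have to be square
integrable. -/
noncomputable def decay (D : ℝ) (x : Space m) : ℝ := quad D x ^ (weight m - 1 / 2)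

lemma decay_nonneg (hD : 1 < D) {x : Space m} (hx : 0 ≤ x (Fin.last m)) : 0 ≤ decay D x :=
  Real.rpow_nonneg (quad_pos' hD hx).le _

lemma exists_decay_le (hD : 1 < D) (hm : 2 ≤ m) : ∃ C : ℝ, ∀ x : Space m, 0 ≤ x (Fin.last m) →
    ‖decay D x‖ ≤ ‖C * (1 + ‖x‖) ^ (-(m : ℝ))‖ := by
  obtain ⟨c, hc, h⟩ := exists_mul_one_add_norm_sq_le_quad (m := m) hD
  have hm' : (2 : ℝ) ≤ m := by exact_mod_cast hm
  have hw : weight m - 1 / 2 = -(m : ℝ) / 2 := by simp only [weight, dim]; ring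
  refine ⟨c ^ (-(m : ℝ) / 2), fun x hx => ?_⟩
  have h1 : (0 : ℝ) < 1 + ‖x‖ := by positivity
  rw [Real.norm_of_nonneg (decay_nonneg hD hx), Real.norm_of_nonneg (by positivity), decay, hw]
  refine (Real.rpow_le_rpow_of_nonpos (by positivity) (h x hx) (by linarith)).trans_eq ?_
  rw [Real.mul_rpow hc.le (by positivity), ← Real.rpow_natCast_mul h1.le]
  congr 2
  push_cast
  ring

lemma memLp_one_add_norm_rpow {E : Type*} [NormedAddCommGroup E] [NormedSpace ℝ E]
    [FiniteDimensional ℝ E] [MeasurableSpace E] [BorelSpace E] (μ : Measure E)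
    [μ.IsAddHaarMeasure] {a : ℝ} (ha : (Module.finrank ℝ E : ℝ) < 2 * a) (C : ℝ) :
    MemLp (fun x : E => C * (1 + ‖x‖) ^ (-a)) 2 μ := by
  have hcont : Continuous fun x : E => (1 + ‖x‖) ^ (-a) := by
    refine Continuous.rpow_const (by fun_prop) fun x => Or.inl ?_
    positivity
  refine MemLp.const_mul ?_ C
  rw [memLp_two_iff_integrable_sq hcont.aestronglyMeasurable]
  refine (integrable_one_add_norm (μ := μ) ha).congr (ae_of_all _ fun x => ?_)
  simp only
  rw [← Real.rpow_mul_natCast (by positivity)]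
  congr 1
  push_cast
  ring

lemma continuousOn_quad_rpow (hD : 1 < D) (a : ℝ) :
    ContinuousOn (fun x : Space m => quad D x ^ a) (enlargedHalfSpace m ((D - 1) / 2)) :=
  (contDiffOn_quad_rpow (n := 0) a fun _ hx => quad_pos hD hx).continuousOn

lemma aestronglyMeasurable_halfVol {F : Type*} [TopologicalSpace F]
    [TopologicalSpace.PseudoMetrizableSpace F] [SecondCountableTopologyEither (Space m) F]
    {f : Space m → F} {δ : ℝ} (hδ : 0 < δ) (hf : ContinuousOn f (enlargedHalfSpace m δ)) :
    AEStronglyMeasurable f (halfVol m) :=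
  (hf.mono (halfSpace_subset_enlarged hδ)).aestronglyMeasurable measurableSet_halfSpace

lemma continuous_comp_bdryPt {F : Type*} [TopologicalSpace F] {f : Space m → F} {δ : ℝ}
    (hδ : 0 < δ) (hf : ContinuousOn f (enlargedHalfSpace m δ)) :
    Continuous fun y : Bdry m => f (bdryPt y) :=
  hf.comp_continuous continuous_bdryPt fun y => bdryPt_mem_enlarged hδ y

lemma ae_halfVol_nonneg : ∀ᵐ x ∂(halfVol m), 0 ≤ x (Fin.last m) := by
  filter_upwards [ae_restrict_mem measurableSet_halfSpace] with x hx using le_of_lt hx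

lemma memLp_decay (hD : 1 < D) (hm : 2 ≤ m) : MemLp (decay D) 2 (halfVol m) := by
  have hδ : 0 < (D - 1) / 2 := by linarith
  obtain ⟨C, hC⟩ := exists_decay_le (m := m) hD hm
  have hm' : (2 : ℝ) ≤ m := by exact_mod_cast hm
  refine MemLp.mono ((memLp_one_add_norm_rpow volume (a := m) ?_ C).mono_measure
    Measure.restrict_le_self) (aestronglyMeasurable_halfVol hδ (continuousOn_quad_rpow hD _)) ?_
  · simp
    linarith
  · filter_upwards [ae_halfVol_nonneg] with x hx using hC x hx

lemma memLp_decay_bdryPt (hD : 1 < D) (hm : 2 ≤ m) :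
    MemLp (fun y : Bdry m => decay D (bdryPt y)) 2 := by
  have hδ : 0 < (D - 1) / 2 := by linarith
  obtain ⟨C, hC⟩ := exists_decay_le (m := m) hD hm
  have hm' : (2 : ℝ) ≤ m := by exact_mod_cast hm
  refine MemLp.mono (memLp_one_add_norm_rpow volume (a := m) ?_ C)
    (continuous_comp_bdryPt hδ (continuousOn_quad_rpow hD _)).aestronglyMeasurable ?_
  · simp
    linarith
  · refine ae_of_all _ fun y => ?_
    simpa only [norm_bdryPt] using hC (bdryPt y) (by simp)

end Decay

section Dominated

lemma tendsto_eLpNorm_two_of_dominated {α F : Type*} [MeasurableSpace α] {μ : Measure α}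
    [NormedAddCommGroup F] {f : ℕ → α → F} {f₀ : α → F} {g : α → ℝ} (hg : MemLp g 2 μ)
    (hf : ∀ k, AEStronglyMeasurable (f k) μ) (hf₀ : AEStronglyMeasurable f₀ μ)
    (hle : ∀ k, ∀ᵐ x ∂μ, ‖f k x - f₀ x‖ ≤ ‖g x‖)
    (hlim : ∀ᵐ x ∂μ, Tendsto (fun k => f k x) atTop (𝓝 (f₀ x))) :
    Tendsto (fun k => eLpNorm (fun x => f k x - f₀ x) 2 μ) atTop (𝓝 0) := by
  have h2 : (2 : ℝ≥0∞) ≠ 0 := by norm_num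
  have h2' : (2 : ℝ≥0∞) ≠ ⊤ := by norm_num
  simp_rw [eLpNorm_eq_lintegral_rpow_enorm_toReal h2 h2']
  have key : Tendsto (fun k => ∫⁻ x, ‖f k x - f₀ x‖ₑ ^ (2 : ℝ≥0∞).toReal ∂μ) atTop
      (𝓝 (∫⁻ _, 0 ∂μ)) := by
    refine tendsto_lintegral_of_dominated_convergence' (fun x => ‖g x‖ₑ ^ (2 : ℝ≥0∞).toReal)
      (fun k => ((hf k).sub hf₀).enorm.pow_const _) (fun k => ?_) ?_ ?_
    · filter_upwards [hle k] with x hx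
      exact ENNReal.rpow_le_rpow (enorm_le_iff_norm_le.mpr hx) (by simp)
    · exact (lintegral_rpow_enorm_lt_top_of_eLpNorm_lt_top h2 h2' hg.2).ne
    · filter_upwards [hlim] with x hx
      have h1 : Tendsto (fun k => f k x - f₀ x) atTop (𝓝 0) := by
        simpa using hx.sub_const (f₀ x)
      have h3 := (ENNReal.continuous_rpow_const (y := (2 : ℝ≥0∞).toReal)).tendsto _ |>.comp
        h1.enorm
      simpa [Function.comp_def] using h3
  rw [lintegral_zero] at key
  have h4 := (ENNReal.continuous_rpow_const (y := 1 / (2 : ℝ≥0∞).toReal)).tendsto 0 |>.comp key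
  simpa [Function.comp_def] using h4

lemma tendsto_integral_inner {α F : Type*} [MeasurableSpace α] {μ : Measure α}
    [NormedAddCommGroup F] [InnerProductSpace ℝ F] {f : ℕ → α → F} {f₀ g : α → F}
    (hf : ∀ k, MemLp (f k) 2 μ) (hf₀ : MemLp f₀ 2 μ) (hg : MemLp g 2 μ)
    (hlim : Tendsto (fun k => eLpNorm (fun x => f k x - f₀ x) 2 μ) atTop (𝓝 0)) :
    Tendsto (fun k => ∫ x, inner ℝ (f k x) (g x) ∂μ) atTop (𝓝 (∫ x, inner ℝ (f₀ x) (g x) ∂μ)) := by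
  have h1 : Tendsto (fun k => (hf k).toLp (f k)) atTop (𝓝 (hf₀.toLp f₀)) :=
    (Lp.tendsto_Lp_iff_tendsto_eLpNorm'' f hf f₀ hf₀).mpr hlim
  have h2 := h1.inner (𝕜 := ℝ) (tendsto_const_nhds (x := hg.toLp g))
  have e : ∀ (u : α → F) (hu : MemLp u 2 μ), inner ℝ (hu.toLp u) (hg.toLp g) =
      ∫ x, inner ℝ (u x) (g x) ∂μ := by
    intro u hu
    rw [L2.inner_def]
    refine integral_congr_ae ?_
    filter_upwards [hu.coeFn_toLp, hg.coeFn_toLp] with x h3 h4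
    rw [h3, h4]
  simpa only [e] using h2

lemma tendsto_integral_mul {α : Type*} [MeasurableSpace α] {μ : Measure α}
    {f : ℕ → α → ℝ} {f₀ g : α → ℝ}
    (hf : ∀ k, MemLp (f k) 2 μ) (hf₀ : MemLp f₀ 2 μ) (hg : MemLp g 2 μ)
    (hlim : Tendsto (fun k => eLpNorm (fun x => f k x - f₀ x) 2 μ) atTop (𝓝 0)) :
    Tendsto (fun k => ∫ x, f k x * g x ∂μ) atTop (𝓝 (∫ x, f₀ x * g x ∂μ)) := by
  simpa [mul_comm] using tendsto_integral_inner hf hf₀ hg hlim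

/-- Radial cutoffs at scale `k + 1`, whose gradients are bounded by `C / (1 + |x|)` uniformly in
`k`. -/
lemma exists_cutoff_seq (E : Type*) [NormedAddCommGroup E] [InnerProductSpace ℝ E]
    [FiniteDimensional ℝ E] : ∃ (χ : ℕ → E → ℝ) (C : ℝ), 0 ≤ C ∧
    (∀ k, ContDiff ℝ ∞ (χ k)) ∧ (∀ k, HasCompactSupport (χ k)) ∧
    (∀ k x, |χ k x - 1| ≤ 1) ∧ (∀ k x, ‖fderiv ℝ (χ k) x‖ ≤ C / (1 + ‖x‖)) ∧
    (∀ x, ∀ᶠ k in atTop, χ k =ᶠ[𝓝 x] fun _ => 1) := by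
  let b : ContDiffBump (0 : E) := ⟨1, 2, one_pos, one_lt_two⟩
  have hb : ContDiff ℝ ∞ (b : E → ℝ) := b.contDiff
  have hlin : ∀ k : ℕ, ContDiff ℝ ∞ (fun x : E => ((k : ℝ) + 1)⁻¹ • x) := fun k => by fun_prop
  obtain ⟨M, hM⟩ := (hb.continuous_fderiv (by simp)).bounded_above_of_compact_support
    (b.hasCompactSupport.fderiv ℝ)
  have hM0 : 0 ≤ M := (norm_nonneg _).trans (hM 0)
  refine ⟨fun k x => b (((k : ℝ) + 1)⁻¹ • x), 3 * M, by positivity,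
    fun k => hb.comp (hlin k), fun k => ?_, fun k x => ?_, fun k x => ?_, fun x => ?_⟩
  · exact b.hasCompactSupport.comp_smul (by positivity)
  · have h0 := b.nonneg (x := ((k : ℝ) + 1)⁻¹ • x)
    have h1 := b.le_one (x := ((k : ℝ) + 1)⁻¹ • x)
    rw [abs_le]
    constructor <;> linarith
  · have hk : (0 : ℝ) < (k : ℝ) + 1 := by positivity
    have hd : HasFDerivAt (fun x => b (((k : ℝ) + 1)⁻¹ • x))
        ((fderiv ℝ b (((k : ℝ) + 1)⁻¹ • x)).comp
          (((k : ℝ) + 1)⁻¹ • ContinuousLinearMap.id ℝ E)) x :=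
      ((hb.differentiable (by simp)) _).hasFDerivAt.comp x
        ((hasFDerivAt_id x).const_smul ((k : ℝ) + 1)⁻¹)
    rw [hd.fderiv, ContinuousLinearMap.comp_smul, ContinuousLinearMap.comp_id, norm_smul,
      Real.norm_of_nonneg (by positivity), le_div_iff₀ (by positivity)]
    by_cases hx : ‖x‖ ≤ 2 * ((k : ℝ) + 1)
    · have h1 : 1 + ‖x‖ ≤ 3 * ((k : ℝ) + 1) := by
        have : (0 : ℝ) ≤ k := by positivity
        linarith
      calc ((k : ℝ) + 1)⁻¹ * ‖fderiv ℝ b (((k : ℝ) + 1)⁻¹ • x)‖ * (1 + ‖x‖)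
          ≤ ((k : ℝ) + 1)⁻¹ * M * (3 * ((k : ℝ) + 1)) := by
            gcongr
            exact hM _
        _ = 3 * M := by field_simp
    · have : fderiv ℝ b (((k : ℝ) + 1)⁻¹ • x) = 0 := by
        refine image_eq_zero_of_notMem_tsupport fun hmem => hx ?_
        have h1 := tsupport_fderiv_subset ℝ hmem
        rw [b.tsupport_eq, Metric.mem_closedBall, dist_zero_right, norm_smul,
          Real.norm_of_nonneg (by positivity)] at h1
        change _ ≤ (2 : ℝ) at h1
        rwa [inv_mul_le_iff₀ hk, mul_comm] at h1
      rw [this]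
      simp
      positivity
  · obtain ⟨K, hK⟩ := exists_nat_gt ‖x‖
    filter_upwards [eventually_ge_atTop K] with k hk
    have hlt : ‖x‖ < (k : ℝ) + 1 := by
      have : (K : ℝ) ≤ k := by exact_mod_cast hk
      linarith
    have : {y : E | ‖y‖ < (k : ℝ) + 1} ∈ 𝓝 x :=
      (isOpen_lt (by fun_prop) (by fun_prop)).mem_nhds hlt
    filter_upwards [this] with y hy
    refine b.one_of_mem_closedBall ?_
    have h2 : ‖y‖ < (k : ℝ) + 1 := hy
    rw [Metric.mem_closedBall, dist_zero_right, norm_smul, Real.norm_of_nonneg (by positivity)]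
    change _ ≤ (1 : ℝ)
    rw [inv_mul_le_iff₀ (by positivity)]
    linarith

end Dominated

end HalfSpaceBubble

/-! ### The linearized problem in weighted spaces -/

namespace HalfSpaceBubble

section WeightedLimit

variable {m : ℕ} {D : ℝ}

/-- The triple `(v, G, τ)` of a function, its gradient and its trace is a limit of test functions in
the weighted norm `‖(|z|²-1)⁻¹ v‖ + ‖G‖ + ‖(|z|²-1)^{-1/2} τ‖` of `L²`. The weights are needed
because one of the functions in the kernel is not square integrable when `n ≤ 4`. -/
structure IsWeightedLimit (D : ℝ) (v : Space m → ℝ) (G : Space m → Space m) (τ : Bdry m → ℝ) :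
    Prop where
  memLp_val : MemLp (fun x => quad D x ^ (-1 : ℝ) * v x) 2 (halfVol m)
  memLp_grad : MemLp G 2 (halfVol m)
  memLp_trace : MemLp (fun y => quad D (bdryPt y) ^ (-1 / 2 : ℝ) * τ y) 2 volume
  exists_seq : ∃ φ : ℕ → Space m → ℝ, (∀ k, IsTest (φ k)) ∧
    Tendsto (fun k => eLpNorm (fun x => quad D x ^ (-1 : ℝ) * φ k x - quad D x ^ (-1 : ℝ) * v x) 2
      (halfVol m)) atTop (𝓝 0) ∧
    Tendsto (fun k => eLpNorm (fun x => gradient (φ k) x - G x) 2 (halfVol m)) atTop (𝓝 0) ∧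
    Tendsto (fun k => eLpNorm (fun y => quad D (bdryPt y) ^ (-1 / 2 : ℝ) * φ k (bdryPt y) -
      quad D (bdryPt y) ^ (-1 / 2 : ℝ) * τ y) 2 volume) atTop (𝓝 0)

lemma gradient_eq_toDual_symm (φ : Space m → ℝ) :
    gradient φ = fun x => (InnerProductSpace.toDual ℝ (Space m)).symm (fderiv ℝ φ x) := rfl

lemma IsTest.continuous_gradient {φ : Space m → ℝ} (hφ : IsTest φ) : Continuous (gradient φ) := by
  rw [gradient_eq_toDual_symm]
  exact (InnerProductSpace.toDual ℝ (Space m)).symm.continuous.comp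
    (hφ.1.continuous_fderiv (by simp))

lemma IsTest.hasCompactSupport_gradient {φ : Space m → ℝ} (hφ : IsTest φ) :
    HasCompactSupport (gradient φ) := by
  rw [gradient_eq_toDual_symm]
  exact (hφ.2.fderiv ℝ).comp_left (g := (InnerProductSpace.toDual ℝ (Space m)).symm) (by simp)

lemma norm_gradient (φ : Space m → ℝ) (x : Space m) : ‖gradient φ x‖ = ‖fderiv ℝ φ x‖ := by
  rw [gradient_eq_toDual_symm]
  simp

lemma IsTest.comp_bdryPt_hasCompactSupport {φ : Space m → ℝ} (hφ : IsTest φ) :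
    HasCompactSupport fun y : Bdry m => φ (bdryPt y) := by
  have hiso : Isometry (bdryPt : Bdry m → Space m) := by
    refine Isometry.of_dist_eq fun y z => ?_
    rw [EuclideanSpace.dist_eq, EuclideanSpace.dist_eq, Fin.sum_univ_castSucc]
    simp
  exact hφ.2.comp_isClosedEmbedding hiso.isClosedEmbedding

lemma quad_rpow_le_const (hD : 1 < D) {a : ℝ} (ha : a ≤ 0) {x : Space m}
    (hx : 0 ≤ x (Fin.last m)) : ‖quad D x ^ a‖ ≤ (D ^ 2 - 1) ^ a := by
  rw [Real.norm_of_nonneg (Real.rpow_nonneg (quad_pos' hD hx).le _)]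
  exact Real.rpow_le_rpow_of_nonpos (sq_sub_one_pos hD) (quad_ge_const hD hx) ha

lemma memLp_quad_rpow_mul (hD : 1 < D) {a : ℝ} (ha : a ≤ 0) {f : Space m → ℝ}
    (hf : MemLp f 2 (halfVol m)) : MemLp (fun x => quad D x ^ a * f x) 2 (halfVol m) := by
  refine MemLp.of_le_mul (c := (D ^ 2 - 1) ^ a) hf ((aestronglyMeasurable_halfVol
    (by linarith : 0 < (D - 1) / 2) (continuousOn_quad_rpow hD a)).mul hf.1) ?_
  filter_upwards [ae_halfVol_nonneg] with x hx
  rw [norm_mul]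
  exact mul_le_mul_of_nonneg_right (quad_rpow_le_const hD ha hx) (norm_nonneg _)

lemma memLp_quad_bdryPt_rpow_mul (hD : 1 < D) {a : ℝ} (ha : a ≤ 0) {f : Bdry m → ℝ}
    (hf : MemLp f 2 volume) : MemLp (fun y => quad D (bdryPt y) ^ a * f y) 2 volume := by
  refine MemLp.of_le_mul (c := (D ^ 2 - 1) ^ a) hf ((continuous_comp_bdryPt
    (by linarith : 0 < (D - 1) / 2) (continuousOn_quad_rpow hD a)).aestronglyMeasurable.mul hf.1)
    (ae_of_all _ fun y => ?_)
  rw [norm_mul]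
  exact mul_le_mul_of_nonneg_right (quad_rpow_le_const hD ha (by simp)) (norm_nonneg _)

lemma IsTest.memLp_val (hD : 1 < D) {φ : Space m → ℝ} (hφ : IsTest φ) :
    MemLp (fun x => quad D x ^ (-1 : ℝ) * φ x) 2 (halfVol m) :=
  memLp_quad_rpow_mul hD (by norm_num)
    ((hφ.1.continuous.memLp_of_hasCompactSupport hφ.2).mono_measure Measure.restrict_le_self)

lemma IsTest.memLp_grad {φ : Space m → ℝ} (hφ : IsTest φ) :
    MemLp (gradient φ) 2 (halfVol m) :=
  (hφ.continuous_gradient.memLp_of_hasCompactSupport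
    hφ.hasCompactSupport_gradient).mono_measure Measure.restrict_le_self

lemma IsTest.memLp_trace (hD : 1 < D) {φ : Space m → ℝ} (hφ : IsTest φ) :
    MemLp (fun y => quad D (bdryPt y) ^ (-1 / 2 : ℝ) * φ (bdryPt y)) 2 volume :=
  memLp_quad_bdryPt_rpow_mul hD (by norm_num)
    ((hφ.1.continuous.comp continuous_bdryPt).memLp_of_hasCompactSupport
      hφ.comp_bdryPt_hasCompactSupport)

lemma tendsto_eLpNorm_of_le_mul {α : Type*} [MeasurableSpace α] {μ : Measure α} {F G : Type*}
    [NormedAddCommGroup F] [NormedAddCommGroup G]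
    {f : ℕ → α → F} {g : ℕ → α → G} {c : ℝ} (h : ∀ k, ∀ᵐ x ∂μ, ‖f k x‖ ≤ c * ‖g k x‖)
    (hg : Tendsto (fun k => eLpNorm (g k) 2 μ) atTop (𝓝 0)) :
    Tendsto (fun k => eLpNorm (f k) 2 μ) atTop (𝓝 0) := by
  have h1 : Tendsto (fun k => ENNReal.ofReal c * eLpNorm (g k) 2 μ) atTop (𝓝 0) := by
    simpa using ENNReal.Tendsto.const_mul hg (Or.inr (ENNReal.ofReal_ne_top (r := c)))
  exact tendsto_of_tendsto_of_tendsto_of_le_of_le tendsto_const_nhds h1 (fun _ => zero_le)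
    fun k => eLpNorm_le_mul_eLpNorm_of_ae_le_mul (h k) 2

lemma IsTrace.isWeightedLimit (hD : 1 < D) {v : Space m → ℝ} {G : Space m → Space m}
    {τ : Bdry m → ℝ} (hv : IsH1With v G) (hτ : IsTrace v G τ) : IsWeightedLimit D v G τ := by
  obtain ⟨hτ2, φ, hφ, h1, h2, h3⟩ := hτ
  refine ⟨memLp_quad_rpow_mul hD (by norm_num) hv.1, hv.2.1,
    memLp_quad_bdryPt_rpow_mul hD (by norm_num) hτ2, φ, hφ,
    tendsto_eLpNorm_of_le_mul (c := (D ^ 2 - 1) ^ (-1 : ℝ)) (fun k => ?_) h1, h2,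
    tendsto_eLpNorm_of_le_mul (c := (D ^ 2 - 1) ^ (-1 / 2 : ℝ)) (fun k => ae_of_all _ fun y => ?_)
      h3⟩
  · filter_upwards [ae_halfVol_nonneg] with x hx
    rw [← mul_sub, norm_mul]
    exact mul_le_mul_of_nonneg_right (quad_rpow_le_const hD (by norm_num) hx) (norm_nonneg _)
  · rw [← mul_sub, norm_mul]
    exact mul_le_mul_of_nonneg_right (quad_rpow_le_const hD (by norm_num) (by simp))
      (norm_nonneg _)

lemma IsTest.sub {φ ψ : Space m → ℝ} (hφ : IsTest φ) (hψ : IsTest ψ) :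
    IsTest fun x => φ x - ψ x := ⟨hφ.1.sub hψ.1, hφ.2.sub hψ.2⟩

lemma IsTest.gradient_sub {φ ψ : Space m → ℝ} (hφ : IsTest φ) (hψ : IsTest ψ) (x : Space m) :
    gradient (fun x => φ x - ψ x) x = gradient φ x - gradient ψ x := by
  simp only [gradient_eq_toDual_symm]
  rw [fderiv_fun_sub (hφ.1.differentiable (by simp) x) (hψ.1.differentiable (by simp) x), map_sub]

lemma tendsto_eLpNorm_sub_sub {α F : Type*} [MeasurableSpace α] {μ : Measure α}
    [NormedAddCommGroup F] {f g : ℕ → α → F} (hf : ∀ k, AEStronglyMeasurable (f k) μ)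
    (hg : ∀ k, AEStronglyMeasurable (g k) μ)
    (h1 : Tendsto (fun k => eLpNorm (f k) 2 μ) atTop (𝓝 0))
    (h2 : Tendsto (fun k => eLpNorm (g k) 2 μ) atTop (𝓝 0)) :
    Tendsto (fun k => eLpNorm (fun x => f k x - g k x) 2 μ) atTop (𝓝 0) := by
  have := h1.add h2
  rw [add_zero] at this
  exact tendsto_of_tendsto_of_tendsto_of_le_of_le tendsto_const_nhds this (fun _ => zero_le)
    fun k => eLpNorm_sub_le (hf k) (hg k) (by norm_num)

lemma IsWeightedLimit.sub (hD : 1 < D) {v w : Space m → ℝ} {G F : Space m → Space m}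
    {τ σ : Bdry m → ℝ} (hv : IsWeightedLimit D v G τ) (hw : IsWeightedLimit D w F σ) :
    IsWeightedLimit D (fun x => v x - w x) (fun x => G x - F x) fun y => τ y - σ y := by
  obtain ⟨φ, hφ, h1, h2, h3⟩ := hv.exists_seq
  obtain ⟨ψ, hψ, g1, g2, g3⟩ := hw.exists_seq
  refine ⟨?_, hv.memLp_grad.sub hw.memLp_grad, ?_, fun k x => φ k x - ψ k x,
    fun k => (hφ k).sub (hψ k), ?_, ?_, ?_⟩
  · simp_rw [mul_sub]
    exact hv.memLp_val.sub hw.memLp_val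
  · simp_rw [mul_sub]
    exact hv.memLp_trace.sub hw.memLp_trace
  · refine (tendsto_eLpNorm_sub_sub (fun k => (((hφ k).memLp_val hD).sub hv.memLp_val).1)
      (fun k => (((hψ k).memLp_val hD).sub hw.memLp_val).1) h1 g1).congr fun k => ?_
    congr 1
    ext x
    simp only [Pi.sub_apply]
    ring
  · refine (tendsto_eLpNorm_sub_sub (fun k => ((hφ k).memLp_grad.sub hv.memLp_grad).1)
      (fun k => ((hψ k).memLp_grad.sub hw.memLp_grad).1) h2 g2).congr fun k => ?_
    congr 1
    ext1 x
    rw [(hφ k).gradient_sub (hψ k)]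
    simp only [Pi.sub_apply]
    abel
  · refine (tendsto_eLpNorm_sub_sub (fun k => (((hφ k).memLp_trace hD).sub hv.memLp_trace).1)
      (fun k => (((hψ k).memLp_trace hD).sub hw.memLp_trace).1) h3 g3).congr fun k => ?_
    congr 1
    ext y
    simp only [Pi.sub_apply]
    ring

/-- The bilinear form of the linearized problem after division by `4(n-1)/(n-2)`:
`∫ ∇v · ∇w + n(n+2) ∫ (|z|²-1)⁻² v w - n D ∫_∂ (|z|²-1)⁻¹ v w`. -/
noncomputable def linearizedForm (D : ℝ) (v : Space m → ℝ) (G : Space m → Space m) (τ : Bdry m → ℝ)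
    (w : Space m → ℝ) (F : Space m → Space m) (σ : Bdry m → ℝ) : ℝ :=
  ∫ x, inner ℝ (G x) (F x) ∂(halfVol m) +
    dim m * (dim m + 2) *
      ∫ x, (quad D x ^ (-1 : ℝ) * v x) * (quad D x ^ (-1 : ℝ) * w x) ∂(halfVol m) -
    dim m * D * ∫ y, (quad D (bdryPt y) ^ (-1 / 2 : ℝ) * τ y) *
      (quad D (bdryPt y) ^ (-1 / 2 : ℝ) * σ y)

lemma linearizedForm_comm (D : ℝ) (v : Space m → ℝ) (G : Space m → Space m) (τ : Bdry m → ℝ)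
    (w : Space m → ℝ) (F : Space m → Space m) (σ : Bdry m → ℝ) :
    linearizedForm D v G τ w F σ = linearizedForm D w F σ v G τ := by
  simp only [linearizedForm, real_inner_comm, mul_comm]

lemma tendsto_linearizedForm (hD : 1 < D) {v w : Space m → ℝ} {G F : Space m → Space m}
    {τ σ : Bdry m → ℝ} (hv : IsWeightedLimit D v G τ) {φ : ℕ → Space m → ℝ}
    (hφ : ∀ k, IsTest (φ k))
    (h1 : Tendsto (fun k => eLpNorm (fun x => quad D x ^ (-1 : ℝ) * φ k x -
      quad D x ^ (-1 : ℝ) * v x) 2 (halfVol m)) atTop (𝓝 0))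
    (h2 : Tendsto (fun k => eLpNorm (fun x => gradient (φ k) x - G x) 2 (halfVol m)) atTop (𝓝 0))
    (h3 : Tendsto (fun k => eLpNorm (fun y => quad D (bdryPt y) ^ (-1 / 2 : ℝ) * φ k (bdryPt y) -
      quad D (bdryPt y) ^ (-1 / 2 : ℝ) * τ y) 2 volume) atTop (𝓝 0))
    (hw : IsWeightedLimit D w F σ) :
    Tendsto (fun k => linearizedForm D (φ k) (gradient (φ k)) (fun y => φ k (bdryPt y)) w F σ) atTop
      (𝓝 (linearizedForm D v G τ w F σ)) := by
  have t1 := tendsto_integral_inner (fun k => (hφ k).memLp_grad) hv.memLp_grad hw.memLp_grad h2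
  have t2 := tendsto_integral_mul (fun k => (hφ k).memLp_val hD) hv.memLp_val hw.memLp_val h1
  have t3 := tendsto_integral_mul (fun k => (hφ k).memLp_trace hD) hv.memLp_trace hw.memLp_trace h3
  exact (t1.add (t2.const_mul _)).sub (t3.const_mul _)

/-- `(v, G, τ)` solves the linearized problem weakly, against all test functions. -/
def IsLinearizedSolution (D : ℝ) (v : Space m → ℝ) (G : Space m → Space m) (τ : Bdry m → ℝ) :
    Prop :=
  ∀ φ : Space m → ℝ, IsTest φ →
    linearizedForm D v G τ φ (gradient φ) (fun y => φ (bdryPt y)) = 0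

lemma IsLinearizedSolution.eq_zero (hD : 1 < D) {v w : Space m → ℝ} {G F : Space m → Space m}
    {τ σ : Bdry m → ℝ} (hv : IsLinearizedSolution D v G τ) (hvl : IsWeightedLimit D v G τ)
    (hw : IsWeightedLimit D w F σ) : linearizedForm D v G τ w F σ = 0 := by
  obtain ⟨φ, hφ, h1, h2, h3⟩ := hw.exists_seq
  have := tendsto_linearizedForm hD hw hφ h1 h2 h3 hvl
  rw [linearizedForm_comm]
  refine tendsto_nhds_unique this ?_
  simp_rw [linearizedForm_comm D (φ _), hv _ (hφ _)]
  exact tendsto_const_nhds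

lemma integrable_inner_of_memLp {α F : Type*} [MeasurableSpace α] {μ : Measure α}
    [NormedAddCommGroup F] [InnerProductSpace ℝ F] {f g : α → F} (hf : MemLp f 2 μ)
    (hg : MemLp g 2 μ) : Integrable (fun x => inner ℝ (f x) (g x)) μ := by
  refine (L2.integrable_inner (𝕜 := ℝ) (hf.toLp f) (hg.toLp g)).congr ?_
  filter_upwards [hf.coeFn_toLp, hg.coeFn_toLp] with x h1 h2
  rw [h1, h2]

lemma IsLinearizedSolution.sub (hD : 1 < D) {v w : Space m → ℝ} {G F : Space m → Space m}
    {τ σ : Bdry m → ℝ} (hv : IsLinearizedSolution D v G τ) (hvl : IsWeightedLimit D v G τ)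
    (hw : IsLinearizedSolution D w F σ) (hwl : IsWeightedLimit D w F σ) :
    IsLinearizedSolution D (fun x => v x - w x) (fun x => G x - F x) fun y => τ y - σ y := by
  intro φ hφ
  have e1 : ∫ x, inner ℝ (G x - F x) (gradient φ x) ∂(halfVol m) =
      ∫ x, inner ℝ (G x) (gradient φ x) ∂(halfVol m) -
        ∫ x, inner ℝ (F x) (gradient φ x) ∂(halfVol m) := by
    simp_rw [inner_sub_left]
    exact integral_sub (integrable_inner_of_memLp hvl.memLp_grad hφ.memLp_grad)
      (integrable_inner_of_memLp hwl.memLp_grad hφ.memLp_grad)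
  have e2 := integral_sub (hvl.memLp_val.integrable_mul (hφ.memLp_val hD))
    (hwl.memLp_val.integrable_mul (hφ.memLp_val hD))
  have e3 := integral_sub (hvl.memLp_trace.integrable_mul (hφ.memLp_trace hD))
    (hwl.memLp_trace.integrable_mul (hφ.memLp_trace hD))
  simp only [Pi.mul_apply, ← sub_mul, ← mul_sub] at e2 e3
  have h1 := hv φ hφ
  have h2 := hw φ hφ
  simp only [linearizedForm] at h1 h2 ⊢
  rw [e1, e2, e3]
  linarith

/-- A solution with vanishing trace vanishes: without the boundary term the form is positive
definite. -/
lemma IsLinearizedSolution.ae_eq_zero (hD : 1 < D) {v : Space m → ℝ}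
    {G : Space m → Space m} {τ : Bdry m → ℝ} (hv : IsLinearizedSolution D v G τ)
    (hvl : IsWeightedLimit D v G τ) (hτ : τ =ᵐ[volume] 0) : v =ᵐ[halfVol m] 0 := by
  have h := hv.eq_zero hD hvl hvl
  have h3 : ∫ y, (quad D (bdryPt y) ^ (-1 / 2 : ℝ) * τ y) *
      (quad D (bdryPt y) ^ (-1 / 2 : ℝ) * τ y) = 0 := by
    rw [integral_eq_zero_of_ae]
    filter_upwards [hτ] with y hy
    simp [hy]
  rw [linearizedForm, h3, mul_zero, sub_zero] at h
  have h1 : 0 ≤ ∫ x, inner ℝ (G x) (G x) ∂(halfVol m) :=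
    integral_nonneg fun x => real_inner_self_nonneg
  have h2 : 0 ≤ ∫ x, (quad D x ^ (-1 : ℝ) * v x) * (quad D x ^ (-1 : ℝ) * v x) ∂(halfVol m) :=
    integral_nonneg fun x => mul_self_nonneg _
  have hc : 0 < dim m * (dim m + 2) := by
    simp only [dim]
    positivity
  have h4 : ∫ x, (quad D x ^ (-1 : ℝ) * v x) * (quad D x ^ (-1 : ℝ) * v x) ∂(halfVol m) = 0 := by
    by_contra hne
    have : 0 < dim m * (dim m + 2) *
        ∫ x, (quad D x ^ (-1 : ℝ) * v x) * (quad D x ^ (-1 : ℝ) * v x) ∂(halfVol m) :=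
      mul_pos hc (lt_of_le_of_ne h2 (Ne.symm hne))
    linarith
  rw [integral_eq_zero_iff_of_nonneg (fun x => mul_self_nonneg _)
    (hvl.memLp_val.integrable_mul hvl.memLp_val)] at h4
  filter_upwards [h4, ae_halfVol_nonneg] with x hx hx0
  have := mul_self_eq_zero.mp hx
  exact (mul_eq_zero.mp this).resolve_left (Real.rpow_pos_of_pos (quad_pos' hD hx0) _).ne'

end WeightedLimit

end HalfSpaceBubble

/-! ### Profiles as test functions -/

namespace HalfSpaceBubble

section Admissible

variable {m : ℕ} {D A : ℝ} {B : Space m} {I : Set ℝ} {f f₁ f₂ : ℝ → ℝ}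

/-- The conditions on `f` under which `profile D A B f` is a classical solution of
`-Δv + n(n+2) (|z|²-1)⁻² v = 0` near the closed half-space, with the decay of a bubble. -/
structure IsAdmissible (D A : ℝ) (B : Space m) (I : Set ℝ) (f f₁ f₂ : ℝ → ℝ) : Prop
    extends IsProfile I f f₁ f₂ where
  mapsTo : Set.MapsTo (ratio D A B) (enlargedHalfSpace m ((D - 1) / 2)) I
  exists_bound : ∃ M : ℝ, ∀ x : Space m, 0 ≤ x (Fin.last m) →
    |f (ratio D A B x)| ≤ M ∧ |f₁ (ratio D A B x)| ≤ M
  equation : ∀ s ∈ I, dim m * s * f₁ s + (‖B‖ ^ 2 - A ^ 2 + s ^ 2) * f₂ s = dim m * f s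

lemma abs_ratio_le (hD : 1 < D) (A : ℝ) (B : Space m) {x : Space m} (hx : 0 ≤ x (Fin.last m)) :
    |ratio D A B x| ≤ (|A| + ‖B‖) * (1 + 2 * (D ^ 2 - 1)⁻¹) := by
  have hq := quad_pos' hD hx
  have h1 : |A * (quad D x + 2) + 2 * inner ℝ B (shift D x)| ≤
      (|A| + ‖B‖) * (quad D x + 2) := by
    refine (abs_add_le _ _).trans ?_
    rw [abs_mul, abs_mul, abs_two, abs_of_pos (by linarith : 0 < quad D x + 2)]
    have h2 := abs_real_inner_le_norm B (shift D x)
    have h3 : 2 * ‖shift D x‖ ≤ quad D x + 2 := by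
      have := norm_shift_sq D x
      nlinarith [sq_nonneg (‖shift D x‖ - 1)]
    nlinarith [mul_le_mul_of_nonneg_left h3 (norm_nonneg B)]
  rw [ratio, abs_div, abs_of_pos hq, div_le_iff₀ hq]
  refine h1.trans ?_
  rw [mul_assoc]
  refine mul_le_mul_of_nonneg_left ?_ (by positivity)
  have h4 : 1 ≤ (D ^ 2 - 1)⁻¹ * quad D x := by
    rw [← div_eq_inv_mul, one_le_div (sq_sub_one_pos hD)]
    exact quad_ge_const hD hx
  nlinarith

lemma quad_rpow_half_le (hD : 1 < D) {x : Space m} (hx : 0 ≤ x (Fin.last m)) :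
    (1 + ‖x‖)⁻¹ ≤ D * quad D x ^ (-1 / 2 : ℝ) := by
  have hq := quad_pos' hD hx
  have h1 : (0 : ℝ) < 1 + ‖x‖ := by positivity
  have h2 : √(quad D x) ≤ D * (1 + ‖x‖) := by
    rw [Real.sqrt_le_left (by positivity), mul_pow]
    exact quad_le hD x
  have h3 : quad D x ^ (-1 / 2 : ℝ) = (√(quad D x))⁻¹ := by
    rw [Real.sqrt_eq_rpow, ← Real.rpow_neg hq.le]
    norm_num
  have h4 : 0 < √(quad D x) := Real.sqrt_pos.mpr hq
  rw [h3, inv_le_iff_one_le_mul₀ h1]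
  field_simp
  linarith

lemma quad_rpow_half_mul_norm_le (hD : 1 < D) {x : Space m} (hx : 0 ≤ x (Fin.last m)) :
    quad D x ^ (-1 / 2 : ℝ) * ‖shift D x‖ ≤ 1 + (D ^ 2 - 1) ^ (-1 / 2 : ℝ) := by
  have hq := quad_pos' hD hx
  have h3 : quad D x ^ (-1 / 2 : ℝ) = (√(quad D x))⁻¹ := by
    rw [Real.sqrt_eq_rpow, ← Real.rpow_neg hq.le]
    norm_num
  have h4 : 0 < √(quad D x) := Real.sqrt_pos.mpr hq
  have h5 : ‖shift D x‖ ≤ √(quad D x) + 1 := by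
    refine abs_le_of_sq_le_sq' ?_ (by positivity) |>.2
    rw [norm_shift_sq]
    nlinarith [Real.sq_sqrt hq.le]
  have h6 := quad_rpow_le_const hD (by norm_num : (-1 / 2 : ℝ) ≤ 0) hx
  rw [Real.norm_of_nonneg (Real.rpow_nonneg hq.le _)] at h6
  calc quad D x ^ (-1 / 2 : ℝ) * ‖shift D x‖
      ≤ quad D x ^ (-1 / 2 : ℝ) * (√(quad D x) + 1) :=
        mul_le_mul_of_nonneg_left h5 (Real.rpow_nonneg hq.le _)
    _ = 1 + quad D x ^ (-1 / 2 : ℝ) := by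
        rw [h3]
        field_simp
    _ ≤ _ := by linarith

lemma abs_profile_le (hD : 1 < D) {M : ℝ} {x : Space m} (hx : 0 ≤ x (Fin.last m))
    (hM : |f (ratio D A B x)| ≤ M) : |profile D A B f x| ≤ M * quad D x ^ weight m := by
  have h := Real.rpow_nonneg (quad_pos' hD hx).le (weight m)
  rw [profile, abs_mul, abs_of_nonneg h, mul_comm]
  exact mul_le_mul_of_nonneg_right hM h

lemma exists_norm_profileGrad_le (hD : 1 < D) (hf : IsAdmissible D A B I f f₁ f₂) :
    ∃ C : ℝ, 0 ≤ C ∧ ∀ x : Space m, 0 ≤ x (Fin.last m) →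
      ‖profileGrad D A B f f₁ x‖ ≤ C * decay D x := by
  obtain ⟨M, hM⟩ := hf.exists_bound
  have hM0 : 0 ≤ M := (abs_nonneg _).trans (hM 0 (by simp)).1
  set T := (|A| + ‖B‖) * (1 + 2 * (D ^ 2 - 1)⁻¹)
  set κ := (D ^ 2 - 1) ^ (-1 / 2 : ℝ)
  have h0 := sq_sub_one_pos hD
  have hκ : 0 ≤ κ := Real.rpow_nonneg h0.le _
  refine ⟨2 * (|weight m| * M + (|A| + T) * M) * (1 + κ) + 2 * M * κ * ‖B‖, by positivity,
    fun x hx => ?_⟩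
  have hq := quad_pos' hD hx
  obtain ⟨hM1, hM2⟩ := hM x hx
  have e : quad D x ^ (weight m - 1) = decay D x * quad D x ^ (-1 / 2 : ℝ) := by
    rw [decay, ← Real.rpow_add hq]
    ring_nf
  have hr : 0 ≤ quad D x ^ (-1 / 2 : ℝ) := Real.rpow_nonneg hq.le _
  have hd := decay_nonneg hD hx
  have hz := quad_rpow_half_mul_norm_le hD hx
  have hk := quad_rpow_le_const hD (by norm_num : (-1 / 2 : ℝ) ≤ 0) hx
  rw [Real.norm_of_nonneg hr] at hk
  have ht : |A - ratio D A B x| ≤ |A| + T := by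
    refine (abs_sub _ _).trans ?_
    have := abs_ratio_le hD A B hx
    linarith
  have hP : |weight m * f (ratio D A B x) + (A - ratio D A B x) * f₁ (ratio D A B x)| ≤
      |weight m| * M + (|A| + T) * M := by
    refine (abs_add_le _ _).trans ?_
    rw [abs_mul, abs_mul]
    gcongr
  rw [profileGrad]
  refine (norm_add_le _ _).trans ?_
  simp only [norm_smul, norm_mul, e, Real.norm_eq_abs, abs_of_nonneg hd,
    abs_of_nonneg hr]
  calc _ = 2 * decay D x * |weight m * f (ratio D A B x) + (A - ratio D A B x) *
        f₁ (ratio D A B x)| * (quad D x ^ (-1 / 2 : ℝ) * ‖shift D x‖) +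
        2 * decay D x * |f₁ (ratio D A B x)| * quad D x ^ (-1 / 2 : ℝ) * ‖B‖ := by ring
    _ ≤ 2 * decay D x * (|weight m| * M + (|A| + T) * M) * (1 + κ) +
        2 * decay D x * M * κ * ‖B‖ := by gcongr
    _ = _ := by ring

/-- A solution of bubble type is a weighted limit of test functions. -/
lemma IsAdmissible.isWeightedLimit (hD : 1 < D) (hm : 2 ≤ m)
    (hf : IsAdmissible D A B I f f₁ f₂) :
    IsWeightedLimit D (profile D A B f) (profileGrad D A B f f₁)
      fun y => profile D A B f (bdryPt y) := by
  set Ω := enlargedHalfSpace m ((D - 1) / 2)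
  have hδ : 0 < (D - 1) / 2 := by linarith
  have hΩ : ∀ x ∈ Ω, 0 < quad D x := fun x hx => quad_pos hD hx
  have hΨ := contDiffOn_profile hf.toIsProfile hΩ hf.mapsTo
  have hG := contDiffOn_profileGrad hf.toIsProfile hΩ hf.mapsTo
  obtain ⟨M, hM⟩ := hf.exists_bound
  have hM0 : 0 ≤ M := (abs_nonneg _).trans (hM 0 (by simp)).1
  obtain ⟨C, hC0, hC⟩ := exists_norm_profileGrad_le hD hf
  obtain ⟨κ, hκ, hκ1, hκs⟩ := exists_vertical_cutoff (m := m) hδ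
  obtain ⟨χ, C', hC'0, hχ, hχc, hχ1, hχd, hχlim⟩ := exists_cutoff_seq (Space m)
  have hdec := memLp_decay (m := m) hD hm
  have hdecb := memLp_decay_bdryPt (m := m) hD hm
  set ν := (D ^ 2 - 1) ^ (-1 / 2 : ℝ)
  have hν : 0 ≤ ν := Real.rpow_nonneg (sq_sub_one_pos hD).le _
  -- bounds of the weighted function and trace
  have hval : ∀ x : Space m, 0 ≤ x (Fin.last m) →
      |quad D x ^ (-1 : ℝ) * profile D A B f x| ≤ M * ν * decay D x := by
    intro x hx
    have hq := quad_pos' hD hx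
    have h1 := abs_profile_le hD hx (hM x hx).1
    have h2 := quad_rpow_le_const hD (by norm_num : (-1 / 2 : ℝ) ≤ 0) hx
    rw [Real.norm_of_nonneg (Real.rpow_nonneg hq.le _)] at h2
    rw [abs_mul, abs_of_nonneg (Real.rpow_nonneg hq.le _)]
    calc quad D x ^ (-1 : ℝ) * |profile D A B f x|
        ≤ quad D x ^ (-1 : ℝ) * (M * quad D x ^ weight m) := by gcongr
      _ = M * (quad D x ^ (-1 / 2 : ℝ) * decay D x) := by
          rw [decay, mul_left_comm, ← Real.rpow_add hq, ← Real.rpow_add hq]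
          ring_nf
      _ ≤ M * (ν * decay D x) := by
          have := decay_nonneg hD hx
          gcongr
      _ = _ := by ring
  have htr : ∀ x : Space m, 0 ≤ x (Fin.last m) →
      |quad D x ^ (-1 / 2 : ℝ) * profile D A B f x| ≤ M * decay D x := by
    intro x hx
    have hq := quad_pos' hD hx
    have h1 := abs_profile_le hD hx (hM x hx).1
    rw [abs_mul, abs_of_nonneg (Real.rpow_nonneg hq.le _)]
    calc quad D x ^ (-1 / 2 : ℝ) * |profile D A B f x|
        ≤ quad D x ^ (-1 / 2 : ℝ) * (M * quad D x ^ weight m) := by gcongr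
      _ = M * decay D x := by
          rw [decay, mul_left_comm, ← Real.rpow_add hq]
          ring_nf
  have hvc : ContinuousOn (fun x => quad D x ^ (-1 : ℝ) * profile D A B f x) Ω :=
    (continuousOn_quad_rpow hD _).mul hΨ.continuousOn
  have htc : ContinuousOn (fun x => quad D x ^ (-1 / 2 : ℝ) * profile D A B f x) Ω :=
    (continuousOn_quad_rpow hD _).mul hΨ.continuousOn
  have hvm := aestronglyMeasurable_halfVol hδ hvc
  have htm := (continuous_comp_bdryPt hδ htc).aestronglyMeasurable (μ := volume)
  have hGm := aestronglyMeasurable_halfVol hδ hG.continuousOn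
  -- the truncated functions
  set φ : ℕ → Space m → ℝ := fun k x => κ x * χ k x * profile D A B f x with hφdef
  have hφ : ∀ k, IsTest (φ k) := by
    intro k
    refine ⟨contDiff_mul_of_tsupport (isOpen_enlargedHalfSpace _) (hκ.mul (hχ k))
      ((closure_mono (Function.support_mul_subset_left _ _)).trans hκs) hΨ, ?_⟩
    exact ((hχc k).mul_left).mul_right
  have hφeq : ∀ k, ∀ x : Space m, 0 ≤ x (Fin.last m) →
      φ k =ᶠ[𝓝 x] fun y => χ k y * profile D A B f y := by
    intro k x hx
    have : {y : Space m | -((D - 1) / 2 / 3) < y (Fin.last m)} ∈ 𝓝 x :=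
      (isOpen_lt continuous_const (by fun_prop)).mem_nhds (by
        simp only [Set.mem_ofPred_eq]
        linarith)
    filter_upwards [this] with y hy
    simp only [hφdef]
    rw [hκ1 y hy, one_mul]
  have hφlim : ∀ x : Space m, 0 ≤ x (Fin.last m) →
      ∀ᶠ k in atTop, φ k =ᶠ[𝓝 x] profile D A B f := by
    intro x hx
    filter_upwards [hχlim x] with k hk
    filter_upwards [hk, hφeq k x hx] with y h1 h2
    rw [h2, h1, one_mul]
  have hgradΨ : ∀ x : Space m, 0 ≤ x (Fin.last m) →
      HasGradientAt (profile D A B f) (profileGrad D A B f f₁ x) x := by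
    intro x hx
    have hxΩ : x ∈ Ω := by
      change -((D - 1) / 2) < x (Fin.last m)
      linarith
    exact hasGradientAt_profile hf.toIsProfile (hΩ x hxΩ) (hf.mapsTo hxΩ)
  have hgradφ : ∀ k, ∀ x : Space m, 0 ≤ x (Fin.last m) →
      gradient (φ k) x = χ k x • profileGrad D A B f f₁ x +
        profile D A B f x • gradient (χ k) x := by
    intro k x hx
    rw [(hφeq k x hx).gradient_eq]
    have h1 := ((hχ k).differentiable (by simp) x).hasFDerivAt.mul (hgradΨ x hx).hasFDerivAt
    have h2 : fderiv ℝ (fun y => χ k y * profile D A B f y) x = _ := h1.fderiv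
    simp only [gradient_eq_toDual_symm]
    rw [h2]
    simp
  refine ⟨?_, ?_, ?_, φ, hφ, ?_, ?_, ?_⟩
  · refine (hdec.const_mul (M * ν)).mono' hvm ?_
    filter_upwards [ae_halfVol_nonneg] with x hx using hval x hx
  · refine (hdec.const_mul C).mono' hGm ?_
    filter_upwards [ae_halfVol_nonneg] with x hx using hC x hx
  · exact (hdecb.const_mul M).mono' htm (ae_of_all _ fun y => htr _ (by simp))
  · refine tendsto_eLpNorm_two_of_dominated (hdec.const_mul (M * ν))
      (fun k => ((hφ k).memLp_val hD).1) hvm (fun k => ?_) ?_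
    · filter_upwards [ae_halfVol_nonneg] with x hx
      rw [(hφeq k x hx).eq_of_nhds, show quad D x ^ (-1 : ℝ) * (χ k x * profile D A B f x) -
        quad D x ^ (-1 : ℝ) * profile D A B f x =
        (χ k x - 1) * (quad D x ^ (-1 : ℝ) * profile D A B f x) by ring, norm_mul]
      refine (mul_le_of_le_one_left (norm_nonneg _) (hχ1 k x)).trans ?_
      exact (hval x hx).trans (le_abs_self _)
    · filter_upwards [ae_halfVol_nonneg] with x hx
      refine tendsto_const_nhds.congr' ?_
      filter_upwards [hφlim x hx] with k hk
      rw [hk.eq_of_nhds]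
  · refine tendsto_eLpNorm_two_of_dominated (hdec.const_mul (C + M * (C' * D)))
      (fun k => (hφ k).memLp_grad.1) hGm (fun k => ?_) ?_
    · filter_upwards [ae_halfVol_nonneg] with x hx
      have hq := quad_pos' hD hx
      have hd := decay_nonneg hD hx
      rw [hgradφ k x hx, show χ k x • profileGrad D A B f f₁ x +
        profile D A B f x • gradient (χ k) x - profileGrad D A B f f₁ x =
        (χ k x - 1) • profileGrad D A B f f₁ x + profile D A B f x • gradient (χ k) x by module,
        Real.norm_of_nonneg (by positivity : 0 ≤ (C + M * (C' * D)) * decay D x)]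
      refine (norm_add_le _ _).trans ?_
      rw [norm_smul, norm_smul, norm_gradient, add_mul]
      refine add_le_add ((mul_le_of_le_one_left (norm_nonneg _) (hχ1 k x)).trans (hC x hx)) ?_
      calc ‖profile D A B f x‖ * ‖fderiv ℝ (χ k) x‖
          ≤ (M * quad D x ^ weight m) * (C' * (D * quad D x ^ (-1 / 2 : ℝ))) := by
            refine mul_le_mul (abs_profile_le hD hx (hM x hx).1) ((hχd k x).trans ?_)
              (norm_nonneg _) (mul_nonneg hM0 (Real.rpow_nonneg hq.le _))
            rw [div_eq_mul_inv]
            exact mul_le_mul_of_nonneg_left (quad_rpow_half_le hD hx) hC'0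
        _ = M * (C' * D) * (quad D x ^ weight m * quad D x ^ (-1 / 2 : ℝ)) := by ring
        _ = M * (C' * D) * decay D x := by
            rw [← Real.rpow_add hq, decay]
            ring_nf
    · filter_upwards [ae_halfVol_nonneg] with x hx
      refine tendsto_const_nhds.congr' ?_
      filter_upwards [hφlim x hx] with k hk
      rw [hk.gradient_eq, (hgradΨ x hx).gradient]
  · refine tendsto_eLpNorm_two_of_dominated (hdecb.const_mul M)
      (fun k => ((hφ k).memLp_trace hD).1) htm (fun k => ae_of_all _ fun y => ?_)
      (ae_of_all _ fun y => ?_)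
    · have hx : 0 ≤ bdryPt y (Fin.last m) := by simp
      generalize bdryPt y = x at *
      rw [(hφeq k x hx).eq_of_nhds, show quad D x ^ (-1 / 2 : ℝ) * (χ k x * profile D A B f x) -
        quad D x ^ (-1 / 2 : ℝ) * profile D A B f x =
        (χ k x - 1) * (quad D x ^ (-1 / 2 : ℝ) * profile D A B f x) by ring, norm_mul]
      refine (mul_le_of_le_one_left (norm_nonneg _) (hχ1 k x)).trans ?_
      exact (htr x hx).trans (le_abs_self _)
    · refine tendsto_const_nhds.congr' ?_
      filter_upwards [hφlim (bdryPt y) (by simp)] with k hk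
      rw [hk.eq_of_nhds]

/-- The defect in the boundary condition of a profile, up to a power of `|z|² - 1`. -/
noncomputable def boundaryDefect (D A : ℝ) (B : Space m) (f f₁ : ℝ → ℝ) (x : Space m) : ℝ :=
  D * (f (ratio D A B x) - ratio D A B x * f₁ (ratio D A B x)) +
    (A * D + B (Fin.last m)) * f₁ (ratio D A B x)

lemma profileGrad_bdryPt_last (hD : 1 < D) (y : Bdry m) :
    profileGrad D A B f f₁ (bdryPt y) (Fin.last m) =
      2 * quad D (bdryPt y) ^ (weight m - 1) * boundaryDefect D A B f f₁ (bdryPt y) -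
        dim m * D * quad D (bdryPt y) ^ (-1 : ℝ) * profile D A B f (bdryPt y) := by
  have hq : 0 < quad D (bdryPt y) := quad_pos' hD (by simp)
  have e : quad D (bdryPt y) ^ (-1 : ℝ) * profile D A B f (bdryPt y) =
      quad D (bdryPt y) ^ (weight m - 1) * f (ratio D A B (bdryPt y)) := by
    rw [profile, ← mul_assoc, ← Real.rpow_add hq]
    ring_nf
  rw [mul_assoc (dim m * D), e]
  simp only [profileGrad, boundaryDefect, PiLp.add_apply, PiLp.smul_apply, shift_last,
    bdryPt_last, smul_eq_mul, weight]
  ring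

lemma continuousOn_boundaryDefect (hD : 1 < D) (hf : IsAdmissible D A B I f f₁ f₂) :
    ContinuousOn (boundaryDefect D A B f f₁) (enlargedHalfSpace m ((D - 1) / 2)) := by
  have hr : ContinuousOn (ratio D A B) (enlargedHalfSpace m ((D - 1) / 2)) :=
    (contDiffOn_ratio (n := 0) fun x hx => quad_pos hD hx).continuousOn
  have h1 := hf.contDiffOn.continuousOn.comp hr hf.mapsTo
  have h2 := hf.contDiffOn_deriv.continuousOn.comp hr hf.mapsTo
  exact (continuousOn_const.mul (h1.sub (hr.mul h2))).add (continuousOn_const.mul h2)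

lemma memLp_decay_mul_boundaryDefect (hD : 1 < D) (hm : 2 ≤ m)
    (hf : IsAdmissible D A B I f f₁ f₂) :
    MemLp (fun y : Bdry m => decay D (bdryPt y) * boundaryDefect D A B f f₁ (bdryPt y)) 2 := by
  obtain ⟨M, hM⟩ := hf.exists_bound
  have hM0 : 0 ≤ M := (abs_nonneg _).trans (hM 0 (by simp)).1
  have hδ : 0 < (D - 1) / 2 := by linarith
  set T := (|A| + ‖B‖) * (1 + 2 * (D ^ 2 - 1)⁻¹)
  have hT : 0 ≤ T := by
    have := sq_sub_one_pos hD
    positivity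
  refine ((memLp_decay_bdryPt hD hm).const_mul
    (D * (M + T * M) + |A * D + B (Fin.last m)| * M)).mono'
    (continuous_comp_bdryPt hδ ((continuousOn_quad_rpow hD _).mul
      (continuousOn_boundaryDefect hD hf))).aestronglyMeasurable (ae_of_all _ fun y => ?_)
  have hx : 0 ≤ bdryPt y (Fin.last m) := by simp
  obtain ⟨h1, h2⟩ := hM (bdryPt y) hx
  have h3 := abs_ratio_le hD A B hx
  have hd := decay_nonneg hD hx
  rw [norm_mul, Real.norm_of_nonneg hd, mul_comm]
  refine mul_le_mul_of_nonneg_right ?_ hd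
  rw [boundaryDefect]
  refine (norm_add_le _ _).trans ?_
  simp only [Real.norm_eq_abs, abs_mul, abs_of_pos (by linarith : 0 < D)]
  gcongr
  refine (abs_sub _ _).trans ?_
  rw [abs_mul]
  gcongr

/-- Green's formula: against a test function the bilinear form only sees the boundary defect. -/
lemma linearizedForm_test_profile (hD : 1 < D) (hm : 2 ≤ m)
    (hf : IsAdmissible D A B I f f₁ f₂) {φ : Space m → ℝ} (hφ : IsTest φ) :
    linearizedForm D φ (gradient φ) (fun y => φ (bdryPt y)) (profile D A B f)
      (profileGrad D A B f f₁) (fun y => profile D A B f (bdryPt y)) =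
      -2 * ∫ y, (quad D (bdryPt y) ^ (-1 / 2 : ℝ) * φ (bdryPt y)) *
        (decay D (bdryPt y) * boundaryDefect D A B f f₁ (bdryPt y)) := by
  have hδ : 0 < (D - 1) / 2 := by linarith
  have hG := contDiffOn_profileGrad hf.toIsProfile (fun x hx => quad_pos hD hx) hf.mapsTo
  have hlim := hf.isWeightedLimit hD hm
  rw [linearizedForm, integral_inner_gradient_eq hδ hφ (hG.of_le (by simp))]
  have e1 : ∫ x, φ x * divergence (profileGrad D A B f f₁) x ∂(halfVol m) =
      dim m * (dim m + 2) * ∫ x, (quad D x ^ (-1 : ℝ) * φ x) *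
        (quad D x ^ (-1 : ℝ) * profile D A B f x) ∂(halfVol m) := by
    rw [← integral_const_mul]
    refine integral_congr_ae ?_
    filter_upwards [ae_restrict_mem measurableSet_halfSpace] with x hx
    have hxΩ := halfSpace_subset_enlarged hδ hx
    have hq := quad_pos hD hxΩ
    rw [divergence_profileGrad hf.toIsProfile hq (hf.mapsTo hxΩ)]
    have h1 := hf.equation _ (hf.mapsTo hxΩ)
    have h2 : quad D x ^ (weight m - 2) =
        quad D x ^ (-1 : ℝ) * quad D x ^ (-1 : ℝ) * quad D x ^ weight m := by
      rw [← Real.rpow_add hq, ← Real.rpow_add hq]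
      ring_nf
    rw [h2, profile]
    linear_combination (4 * φ x * quad D x ^ (-1 : ℝ) * quad D x ^ (-1 : ℝ) *
      quad D x ^ weight m) * h1
  have e2 : ∫ y, φ (bdryPt y) * profileGrad D A B f f₁ (bdryPt y) (Fin.last m) =
      2 * (∫ y, (quad D (bdryPt y) ^ (-1 / 2 : ℝ) * φ (bdryPt y)) *
        (decay D (bdryPt y) * boundaryDefect D A B f f₁ (bdryPt y))) -
      dim m * D * ∫ y, (quad D (bdryPt y) ^ (-1 / 2 : ℝ) * φ (bdryPt y)) *
        (quad D (bdryPt y) ^ (-1 / 2 : ℝ) * profile D A B f (bdryPt y)) := by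
    rw [← integral_const_mul, ← integral_const_mul]
    refine Eq.trans ?_ (integral_sub (((hφ.memLp_trace hD).integrable_mul
      (memLp_decay_mul_boundaryDefect hD hm hf)).const_mul 2)
      (((hφ.memLp_trace hD).integrable_mul hlim.memLp_trace).const_mul _))
    refine integral_congr_ae (ae_of_all _ fun y => ?_)
    have hq : 0 < quad D (bdryPt y) := quad_pos' hD (by simp)
    have h1 : quad D (bdryPt y) ^ (weight m - 1) =
        quad D (bdryPt y) ^ (-1 / 2 : ℝ) * decay D (bdryPt y) := by
      rw [decay, ← Real.rpow_add hq]
      ring_nf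
    have h2 : quad D (bdryPt y) ^ (-1 : ℝ) =
        quad D (bdryPt y) ^ (-1 / 2 : ℝ) * quad D (bdryPt y) ^ (-1 / 2 : ℝ) := by
      rw [← Real.rpow_add hq]
      norm_num
    beta_reduce
    rw [profileGrad_bdryPt_last hD, h1, h2]
    ring
  rw [e1, e2]
  ring

lemma linearizedForm_profile (hD : 1 < D) (hm : 2 ≤ m) (hf : IsAdmissible D A B I f f₁ f₂)
    {v : Space m → ℝ} {G : Space m → Space m} {τ : Bdry m → ℝ} (hv : IsWeightedLimit D v G τ) :
    linearizedForm D v G τ (profile D A B f)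
      (profileGrad D A B f f₁) (fun y => profile D A B f (bdryPt y)) =
      -2 * ∫ y, (quad D (bdryPt y) ^ (-1 / 2 : ℝ) * τ y) *
        (decay D (bdryPt y) * boundaryDefect D A B f f₁ (bdryPt y)) := by
  obtain ⟨φ, hφ, h1, h2, h3⟩ := hv.exists_seq
  have t1 := tendsto_linearizedForm hD hv hφ h1 h2 h3 (hf.isWeightedLimit hD hm)
  have t2 := (tendsto_integral_mul (fun k => (hφ k).memLp_trace hD) hv.memLp_trace
    (memLp_decay_mul_boundaryDefect hD hm hf) h3).const_mul (-2)
  refine tendsto_nhds_unique t1 (t2.congr fun k => ?_)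
  rw [linearizedForm_test_profile hD hm hf (hφ k)]

end Admissible

end HalfSpaceBubble

/-! ### The boundary sphere and the Lorentz transformation -/

namespace HalfSpaceBubble

section BoundarySphere

variable {m : ℕ} {D : ℝ}

/-- The vector `(-√(D²-1) b̃, D b_n - a)`: with the scalar `a D - b_n` it is the image of the
Minkowski vector `(a, b)` under the Lorentz transformation that moves the centre of the hyperbolic
ball to the origin. -/
noncomputable def lorentzVec (D a : ℝ) (b : Space m) : Space m :=
  WithLp.toLp 2 (Fin.snoc (α := fun _ => ℝ) (fun i => -√(D ^ 2 - 1) * b (Fin.castSucc i))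
    (D * b (Fin.last m) - a))

/-- The scalar component `a D - b_n` that goes with `lorentzVec`. -/
noncomputable def lorentzScalar (D a : ℝ) (b : Space m) : ℝ := a * D - b (Fin.last m)

@[simp] lemma lorentzVec_castSucc (a : ℝ) (b : Space m) (i : Fin m) :
    lorentzVec D a b (Fin.castSucc i) = -√(D ^ 2 - 1) * b (Fin.castSucc i) := by
  simp [lorentzVec]

@[simp] lemma lorentzVec_last (a : ℝ) (b : Space m) :
    lorentzVec D a b (Fin.last m) = D * b (Fin.last m) - a := by
  simp [lorentzVec]

lemma norm_sq_eq_sum (x : Space m) :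
    ‖x‖ ^ 2 = ∑ i : Fin m, x (Fin.castSucc i) ^ 2 + x (Fin.last m) ^ 2 := by
  rw [EuclideanSpace.real_norm_sq_eq, Fin.sum_univ_castSucc]

lemma inner_eq_sum (x y : Space m) :
    inner ℝ x y = ∑ i : Fin m, x (Fin.castSucc i) * y (Fin.castSucc i) +
      x (Fin.last m) * y (Fin.last m) := by
  rw [PiLp.inner_apply, Fin.sum_univ_castSucc]
  simp [mul_comm]

lemma lorentz_norm_sq (hD : 1 < D) (a : ℝ) (b : Space m) :
    ‖lorentzVec D a b‖ ^ 2 - lorentzScalar D a b ^ 2 = (D ^ 2 - 1) * (‖b‖ ^ 2 - a ^ 2) := by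
  rw [norm_sq_eq_sum, norm_sq_eq_sum b, lorentzScalar]
  simp only [lorentzVec_castSucc, lorentzVec_last, mul_pow, neg_sq,
    Real.sq_sqrt (sq_sub_one_pos hD).le, ← Finset.mul_sum]
  ring

/-- The boundary hyperplane as a sphere without a point: the geodesic sphere of the hyperbolic
metric that is centred at the centre of the hyperbolic ball. -/
noncomputable def spherePt (D : ℝ) (y : Bdry m) : Space m :=
  WithLp.toLp 2 (Fin.snoc (α := fun _ => ℝ)
    (fun i => 2 * √(D ^ 2 - 1) * y i / quad D (bdryPt y))
    ((‖y‖ ^ 2 + 1 - D ^ 2) / quad D (bdryPt y)))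

@[simp] lemma spherePt_castSucc (y : Bdry m) (i : Fin m) :
    spherePt D y (Fin.castSucc i) = 2 * √(D ^ 2 - 1) * y i / quad D (bdryPt y) := by
  simp [spherePt]

@[simp] lemma spherePt_last (y : Bdry m) :
    spherePt D y (Fin.last m) = (‖y‖ ^ 2 + 1 - D ^ 2) / quad D (bdryPt y) := by
  simp [spherePt]

lemma quad_bdryPt (y : Bdry m) : quad D (bdryPt y) = ‖y‖ ^ 2 + (D ^ 2 - 1) := by
  rw [quad_eq, norm_bdryPt]
  simp

lemma norm_spherePt (hD : 1 < D) (y : Bdry m) : ‖spherePt D y‖ = 1 := by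
  have h0 := sq_sub_one_pos hD
  have hq : quad D (bdryPt y) ≠ 0 := (quad_pos' hD (by simp)).ne'
  rw [← sq_eq_sq₀ (norm_nonneg _) zero_le_one, norm_sq_eq_sum]
  simp only [spherePt_castSucc, spherePt_last, div_pow, mul_pow, Real.sq_sqrt h0.le]
  rw [← Finset.sum_div, ← Finset.mul_sum, ← EuclideanSpace.real_norm_sq_eq, ← add_div,
    div_eq_iff (pow_ne_zero 2 hq), quad_bdryPt]
  ring

lemma continuous_spherePt (hD : 1 < D) : Continuous (spherePt D : Bdry m → Space m) := by
  have hq : Continuous fun y : Bdry m => quad D (bdryPt y) := by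
    simp_rw [quad_bdryPt]
    fun_prop
  have hq0 : ∀ y : Bdry m, quad D (bdryPt y) ≠ 0 := fun y => (quad_pos' hD (by simp)).ne'
  refine (PiLp.continuous_toLp 2 _).comp (continuous_pi fun i => ?_)
  refine Fin.lastCases ?_ (fun j => ?_) i
  · simp only [Fin.snoc_last]
    exact Continuous.div (by fun_prop) hq hq0
  · simp only [Fin.snoc_castSucc]
    exact Continuous.div (by fun_prop) hq hq0

lemma injective_spherePt (hD : 1 < D) : Function.Injective (spherePt D : Bdry m → Space m) := by
  intro y z h
  have h0 := sq_sub_one_pos hD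
  have hy : 0 < quad D (bdryPt y) := quad_pos' hD (by simp)
  have hz : 0 < quad D (bdryPt z) := quad_pos' hD (by simp)
  have h1 := congrArg (fun x : Space m => x (Fin.last m)) h
  simp only [spherePt_last] at h1
  rw [div_eq_div_iff hy.ne' hz.ne'] at h1
  have hqq : quad D (bdryPt y) = quad D (bdryPt z) := by
    rw [quad_bdryPt, quad_bdryPt] at h1 ⊢
    have : (D ^ 2 - 1) * (‖y‖ ^ 2 - ‖z‖ ^ 2) = 0 := by linarith
    have := (mul_eq_zero.mp this).resolve_left h0.ne'
    linarith
  ext i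
  have h2 := congrArg (fun x : Space m => x (Fin.castSucc i)) h
  simp only [spherePt_castSucc] at h2
  rw [hqq, div_left_inj' hz.ne'] at h2
  exact mul_left_cancel₀ (mul_pos two_pos (Real.sqrt_pos.mpr h0)).ne' h2

lemma measurableEmbedding_spherePt (hD : 1 < D) :
    MeasurableEmbedding (spherePt D : Bdry m → Space m) :=
  (continuous_spherePt hD).measurableEmbedding (injective_spherePt hD)

lemma ratio_lorentz_mul_quad (hD : 1 < D) (a : ℝ) (b : Space m) {x : Space m}
    (hx : 0 ≤ x (Fin.last m)) :
    ratio D (lorentzScalar D a b) (lorentzVec D a b) x * quad D x =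
      a * (D * (quad D x + 2) - 2 * (x (Fin.last m) + D)) -
        2 * √(D ^ 2 - 1) * ∑ i : Fin m, b (Fin.castSucc i) * x (Fin.castSucc i) -
        b (Fin.last m) * (‖x‖ ^ 2 + 1 - D ^ 2) := by
  have hs : ∀ i : Fin m, shift D x (Fin.castSucc i) = x (Fin.castSucc i) := fun i => by
    simp [shift, coordVec]
  rw [ratio_mul_quad _ _ (quad_pos' hD hx), inner_eq_sum, quad_eq]
  simp only [lorentzVec_castSucc, lorentzVec_last, shift_last, hs, lorentzScalar, mul_assoc,
    ← Finset.mul_sum]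
  ring

lemma ratio_lorentz_bdryPt (hD : 1 < D) (a : ℝ) (b : Space m) (y : Bdry m) :
    ratio D (lorentzScalar D a b) (lorentzVec D a b) (bdryPt y) =
      a * D - inner ℝ b (spherePt D y) := by
  have hq : quad D (bdryPt y) ≠ 0 := (quad_pos' hD (by simp)).ne'
  have h := ratio_lorentz_mul_quad hD a b (x := bdryPt y) (by simp)
  rw [← mul_left_inj' hq, h, inner_eq_sum]
  simp only [spherePt_castSucc, spherePt_last, bdryPt_castSucc, bdryPt_last, norm_bdryPt]
  have e : ∑ i : Fin m, b (Fin.castSucc i) * (2 * √(D ^ 2 - 1) * y i / quad D (bdryPt y)) =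
      2 * √(D ^ 2 - 1) * (∑ i : Fin m, b (Fin.castSucc i) * y i) / quad D (bdryPt y) := by
    rw [Finset.mul_sum, Finset.sum_div]
    exact Finset.sum_congr rfl fun i _ => by ring
  rw [e]
  field_simp
  ring

/-- The Minkowski vectors `(0, b)` with `f = id` give an `n`-dimensional space of solutions, whose
restrictions to the boundary sphere are the linear functions `⟨b, θ⟩`. -/
lemma isAdmissible_id (hD : 1 < D) (b : Space m) :
    IsAdmissible D (lorentzScalar D 0 b) (lorentzVec D 0 b) Set.univ id (fun _ => 1)
      (fun _ => 0) where
  contDiffOn := contDiff_id.contDiffOn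
  contDiffOn_deriv := contDiffOn_const
  hasDerivAt s _ := hasDerivAt_id s
  hasDerivAt_deriv s _ := hasDerivAt_const s 1
  mapsTo := Set.mapsTo_univ _ _
  exists_bound := by
    refine ⟨max ((|lorentzScalar D 0 b| + ‖lorentzVec D 0 b‖) * (1 + 2 * (D ^ 2 - 1)⁻¹)) 1,
      fun x hx => ⟨(abs_ratio_le hD _ _ hx).trans (le_max_left _ _), ?_⟩⟩
    rw [abs_one]
    exact le_max_right _ _
  equation s _ := by simp

lemma boundaryDefect_id (b x : Space m) :
    boundaryDefect D (lorentzScalar D 0 b) (lorentzVec D 0 b) id (fun _ => 1) x = 0 := by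
  simp [boundaryDefect, lorentzScalar]
  ring

lemma norm_shift_gt {x : Space m} (hq : 0 < quad D x) : 1 < ‖shift D x‖ := by
  rw [quad] at hq
  nlinarith [norm_nonneg (shift D x)]

lemma norm_lorentzVec (hD : 1 < D) {b : Space m} (hb : ‖b‖ = 1) :
    0 < lorentzScalar D 1 b ∧ ‖lorentzVec D 1 b‖ = lorentzScalar D 1 b := by
  have h1 : |b (Fin.last m)| ≤ ‖b‖ := by simpa using PiLp.norm_apply_le b (Fin.last m)
  have h2 : 0 < lorentzScalar D 1 b := by
    rw [lorentzScalar]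
    have := (abs_le.mp (h1.trans_eq hb)).2
    linarith
  refine ⟨h2, ?_⟩
  have h3 := lorentz_norm_sq hD 1 b
  rw [hb] at h3
  exact (sq_eq_sq₀ (norm_nonneg _) h2.le).mp (by linarith)

/-- A positive lower bound for the ratio attached to a light-like vector. -/
lemma le_ratio_lightlike (hD : 1 < D) {b : Space m} (hb : ‖b‖ = 1) {x : Space m}
    (hq : 0 < quad D x) : lorentzScalar D 1 b * ((‖shift D x‖ - 1) / (‖shift D x‖ + 1)) ≤
      ratio D (lorentzScalar D 1 b) (lorentzVec D 1 b) x := by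
  obtain ⟨hA, hB⟩ := norm_lorentzVec hD hb
  have hz := norm_shift_gt hq
  have h1 := (abs_le.mp (abs_real_inner_le_norm (lorentzVec D 1 b) (shift D x))).1
  rw [hB] at h1
  have hqz : quad D x = (‖shift D x‖ - 1) * (‖shift D x‖ + 1) := by rw [quad]; ring
  rw [ratio, le_div_iff₀ hq]
  have h2 : (‖shift D x‖ - 1) / (‖shift D x‖ + 1) * quad D x = (‖shift D x‖ - 1) ^ 2 := by
    rw [hqz]
    field_simp
  rw [mul_assoc, h2, quad]
  nlinarith

/-- The horospherical waves: light-like Minkowski vectors `(1, b)`, `|b| = 1`, with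
`f(t) = t⁻ⁿ`. -/
lemma isAdmissible_horospherical (hD : 1 < D) {b : Space m} (hb : ‖b‖ = 1) :
    IsAdmissible D (lorentzScalar D 1 b) (lorentzVec D 1 b) (Set.Ioi 0)
      (fun s => s⁻¹ ^ (m + 1)) (fun s => -(m + 1) * s⁻¹ ^ (m + 2))
      (fun s => (m + 1) * (m + 2) * s⁻¹ ^ (m + 3)) where
  contDiffOn := (contDiffOn_id.inv fun s hs => ne_of_gt hs).pow _
  contDiffOn_deriv := contDiffOn_const.mul ((contDiffOn_id.inv fun s hs => ne_of_gt hs).pow _)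
  hasDerivAt s hs := by
    have hs' : s ≠ 0 := ne_of_gt hs
    convert! (hasDerivAt_inv hs').pow (m + 1) using 1
    simp only [Nat.add_sub_cancel, Nat.cast_add, Nat.cast_one]
    rw [pow_add s⁻¹ m 2, ← inv_pow]
    ring
  hasDerivAt_deriv s hs := by
    have hs' : s ≠ 0 := ne_of_gt hs
    convert! ((hasDerivAt_inv hs').pow (m + 2)).const_mul (-((m : ℝ) + 1)) using 1
    simp only [show m + 2 - 1 = m + 1 from rfl, Nat.cast_add, Nat.cast_ofNat]
    rw [show m + 3 = m + 1 + 2 from rfl, pow_add s⁻¹ (m + 1) 2, ← inv_pow]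
    ring
  mapsTo x hx := by
    have hq := quad_pos hD hx
    have hz := norm_shift_gt hq
    refine lt_of_lt_of_le ?_ (le_ratio_lightlike hD hb hq)
    have := (norm_lorentzVec hD hb).1
    have h1 : 0 < ‖shift D x‖ - 1 := by linarith
    positivity
  exists_bound := by
    have hA := (norm_lorentzVec hD hb).1
    set c := lorentzScalar D 1 b * ((D - 1) / (D + 1))
    have hc : 0 < c := by
      have : 0 < D - 1 := by linarith
      positivity
    refine ⟨max (c⁻¹ ^ (m + 1)) ((m + 1) * c⁻¹ ^ (m + 2)), fun x hx => ?_⟩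
    have hcr : c ≤ ratio D (lorentzScalar D 1 b) (lorentzVec D 1 b) x := by
      refine le_trans ?_ (le_ratio_lightlike hD hb (quad_pos' hD hx))
      refine mul_le_mul_of_nonneg_left ?_ hA.le
      have h2 : D ≤ ‖shift D x‖ := by
        have h3 : |shift D x (Fin.last m)| ≤ ‖shift D x‖ := by
          simpa using PiLp.norm_apply_le (shift D x) (Fin.last m)
        rw [shift_last] at h3
        linarith [le_abs_self (x (Fin.last m) + D)]
      rw [div_le_div_iff₀ (by linarith) (by linarith)]
      nlinarith
    have hi : (ratio D (lorentzScalar D 1 b) (lorentzVec D 1 b) x)⁻¹ ≤ c⁻¹ := inv_anti₀ hc hcr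
    have hi0 : 0 ≤ (ratio D (lorentzScalar D 1 b) (lorentzVec D 1 b) x)⁻¹ :=
      inv_nonneg.mpr (hc.le.trans hcr)
    constructor
    · rw [abs_of_nonneg (by positivity)]
      exact (pow_le_pow_left₀ hi0 hi _).trans (le_max_left _ _)
    · rw [neg_mul, abs_neg, abs_of_nonneg (by positivity)]
      exact (mul_le_mul_of_nonneg_left (pow_le_pow_left₀ hi0 hi _) (by positivity)).trans
        (le_max_right _ _)
  equation s hs := by
    have hs' : s ≠ 0 := ne_of_gt hs
    rw [lorentz_norm_sq hD, hb]
    simp only [dim]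
    rw [pow_succ s⁻¹ (m + 2), pow_succ s⁻¹ (m + 1)]
    field_simp
    ring

/-- On the boundary, the defect of a horospherical wave is the integrand of `kleinPotential` at a
point of the sphere of radius `1 / D`. -/
lemma boundaryDefect_horospherical (hD : 1 < D) {b : Space m} (y : Bdry m) :
    boundaryDefect D (lorentzScalar D 1 b) (lorentzVec D 1 b) (fun s => s⁻¹ ^ (m + 1))
      (fun s => -(m + 1) * s⁻¹ ^ (m + 2)) (bdryPt y) =
    D * D⁻¹ ^ (m + 1) * (((m + 1 : ℕ) + 1) *
        (1 - inner ℝ (D⁻¹ • b) (spherePt D y))⁻¹ ^ (m + 1) -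
      (m + 1 : ℕ) * (1 - D⁻¹ ^ 2) * (1 - inner ℝ (D⁻¹ • b) (spherePt D y))⁻¹ ^ (m + 1 + 1)) := by
  have hD0 : D ≠ 0 := by linarith
  rw [boundaryDefect, ratio_lorentz_bdryPt hD]
  have h1 : 1 * D - inner ℝ b (spherePt D y) =
      D * (1 - inner ℝ (D⁻¹ • b) (spherePt D y)) := by
    rw [real_inner_smul_left]
    field_simp
  rw [h1, lorentzVec_last, lorentzScalar]
  generalize 1 - inner ℝ (D⁻¹ • b) (spherePt D y) = s
  have h2 : ∀ k : ℕ, (D * s)⁻¹ ^ k = D⁻¹ ^ k * s⁻¹ ^ k := fun k => by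
    rw [mul_inv, mul_pow]
  simp only [h2]
  by_cases hs : s = 0
  · simp [hs]
  push_cast
  rw [show m + 2 = (m + 1) + 1 from rfl, pow_succ D⁻¹ (m + 1), pow_succ s⁻¹ (m + 1)]
  field_simp
  ring

end BoundarySphere

section Projection

/-- Orthogonal projection to the range of a linear map on a finite-dimensional space. -/
lemma exists_forall_inner_map_eq_zero {E H : Type*} [NormedAddCommGroup E] [NormedSpace ℝ E]
    [FiniteDimensional ℝ E] [NormedAddCommGroup H] [InnerProductSpace ℝ H] (T : E →ₗ[ℝ] H)
    (x : H) : ∃ c : E, ∀ ξ : E, inner ℝ (T ξ) (x - T c) = 0 := by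
  obtain ⟨c, hc⟩ : (LinearMap.range T).starProjection x ∈ LinearMap.range T :=
    Submodule.starProjection_apply_mem _ _
  refine ⟨c, fun ξ => ?_⟩
  rw [hc]
  exact (Submodule.sub_starProjection_mem_orthogonal x) _ ⟨ξ, rfl⟩

end Projection

end HalfSpaceBubble

/-! ### Classification of the solutions -/

namespace HalfSpaceBubble

section Uniqueness

variable {m : ℕ} {D : ℝ}

lemma rpow_mul_profile_id_bdryPt (hD : 1 < D) (b : Space m) (y : Bdry m) :
    quad D (bdryPt y) ^ (-1 / 2 : ℝ) *
      profile D (lorentzScalar D 0 b) (lorentzVec D 0 b) id (bdryPt y) =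
      -(decay D (bdryPt y) * inner ℝ b (spherePt D y)) := by
  have hq : 0 < quad D (bdryPt y) := quad_pos' hD (by simp)
  rw [profile, id, ratio_lorentz_bdryPt hD, ← mul_assoc, ← Real.rpow_add hq, decay,
    show -1 / 2 + weight m = weight m - 1 / 2 by ring]
  ring

/-- The profiles with linear boundary values solve the linearized problem: their boundary defect
vanishes. -/
lemma isLinearizedSolution_profile_id (hD : 1 < D) (hm : 2 ≤ m) (b : Space m) :
    IsLinearizedSolution D (profile D (lorentzScalar D 0 b) (lorentzVec D 0 b) id)
      (profileGrad D (lorentzScalar D 0 b) (lorentzVec D 0 b) id fun _ => 1)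
      (fun y => profile D (lorentzScalar D 0 b) (lorentzVec D 0 b) id (bdryPt y)) := by
  intro φ hφ
  rw [linearizedForm_comm, linearizedForm_test_profile hD hm (isAdmissible_id hD b) hφ]
  simp [boundaryDefect_id]

lemma memLp_decay_mul_inner_spherePt (hD : 1 < D) (hm : 2 ≤ m) (b : Space m) :
    MemLp (fun y : Bdry m => decay D (bdryPt y) * inner ℝ b (spherePt D y)) 2 := by
  refine (memLp_decay_bdryPt hD hm).of_le_mul (c := ‖b‖)
    ((memLp_decay_bdryPt hD hm).1.mul
      ((continuous_const.inner (continuous_spherePt hD)).aestronglyMeasurable))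
    (ae_of_all _ fun y => ?_)
  rw [norm_mul, mul_comm]
  refine mul_le_mul_of_nonneg_right ?_ (norm_nonneg _)
  simpa [norm_spherePt hD] using norm_inner_le_norm (𝕜 := ℝ) b (spherePt D y)

/-- A solution whose weighted trace is orthogonal to the linear functions on the boundary sphere
vanishes. Testing with horospherical waves gives the boundary values of `kleinPotential` on the
sphere of radius `1 / D`. -/
lemma IsLinearizedSolution.ae_eq_zero_of_orthogonal (hD : 1 < D) (hm : 2 ≤ m)
    {v : Space m → ℝ} {G : Space m → Space m} {τ : Bdry m → ℝ}
    (hv : IsLinearizedSolution D v G τ) (hvl : IsWeightedLimit D v G τ)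
    (horth : ∀ ξ : Space m, ∫ y, inner ℝ ξ (spherePt D y) *
      (decay D (bdryPt y) * (quad D (bdryPt y) ^ (-1 / 2 : ℝ) * τ y)) = 0) :
    v =ᵐ[halfVol m] 0 := by
  have hD0 : 0 < D := by linarith
  have hθm := (continuous_spherePt (m := m) hD).measurable
  set g : Bdry m → ℝ := fun y =>
    decay D (bdryPt y) * (quad D (bdryPt y) ^ (-1 / 2 : ℝ) * τ y) with hgdef
  have hg : Integrable g := (memLp_decay_bdryPt hD hm).integrable_mul hvl.memLp_trace
  have hzero : g =ᵐ[volume] 0 := by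
    refine ae_eq_zero_of_kleinPotential_eq_zero (EuclideanSpace.basisFun (Fin (m + 1)) ℝ)
      (by simp; omega) (measurableEmbedding_spherePt hD) (norm_spherePt hD) hg (r := D⁻¹)
      (inv_pos.mpr hD0) (inv_lt_one_of_one_lt₀ hD) (fun ξ hξ => ?_) horth
    have hξ1 : ‖ξ‖ < 1 := hξ.trans_lt (inv_lt_one_of_one_lt₀ hD)
    have hb : ‖D • ξ‖ = 1 := by
      rw [norm_smul, hξ, Real.norm_of_nonneg hD0.le, mul_inv_cancel₀ hD0.ne']
    have hadm := isAdmissible_horospherical hD hb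
    have h1 := hv.eq_zero hD hvl (hadm.isWeightedLimit hD hm)
    rw [linearizedForm_profile hD hm hadm hvl] at h1
    have h2 := (mul_eq_zero.mp h1).resolve_left (by norm_num)
    have h3 : ∀ y : Bdry m, (quad D (bdryPt y) ^ (-1 / 2 : ℝ) * τ y) *
        (decay D (bdryPt y) * boundaryDefect D (lorentzScalar D 1 (D • ξ))
          (lorentzVec D 1 (D • ξ)) (fun s => s⁻¹ ^ (m + 1))
          (fun s => -(m + 1) * s⁻¹ ^ (m + 2)) (bdryPt y)) =
        D * D⁻¹ ^ (m + 1) * ((((m + 1 : ℕ) : ℝ) + 1) *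
            ((1 - inner ℝ ξ (spherePt D y))⁻¹ ^ (m + 1) * g y) -
          (m + 1 : ℕ) * (1 - ‖ξ‖ ^ 2) *
            ((1 - inner ℝ ξ (spherePt D y))⁻¹ ^ (m + 1 + 1) * g y)) := by
      intro y
      rw [boundaryDefect_horospherical hD, smul_smul, inv_mul_cancel₀ hD0.ne', one_smul, hξ]
      simp only [hgdef]
      ring
    simp_rw [h3] at h2
    rw [integral_const_mul] at h2
    have h4 := (mul_eq_zero.mp h2).resolve_left (by positivity)
    rw [integral_sub ((integrable_kernel hθm (norm_spherePt hD) hg _ hξ1).const_mul _)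
      ((integrable_kernel hθm (norm_spherePt hD) hg _ hξ1).const_mul _), integral_const_mul,
      integral_const_mul] at h4
    rw [Fintype.card_fin]
    exact h4
  refine hv.ae_eq_zero hD hvl ?_
  filter_upwards [hzero] with y hy
  have hq : 0 < quad D (bdryPt y) := quad_pos' hD (by simp)
  have h1 := (mul_eq_zero.mp hy).resolve_left (Real.rpow_pos_of_pos hq _).ne'
  exact (mul_eq_zero.mp h1).resolve_left (Real.rpow_pos_of_pos hq _).ne'

lemma inner_toLp_eq_integral {α : Type*} [MeasurableSpace α] {μ : Measure α} {f g : α → ℝ}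
    (hf : MemLp f 2 μ) (hg : MemLp g 2 μ) :
    inner ℝ (hf.toLp f) (hg.toLp g) = ∫ x, f x * g x ∂μ := by
  rw [L2.inner_def]
  refine integral_congr_ae ?_
  filter_upwards [hf.coeFn_toLp, hg.coeFn_toLp] with x h1 h2
  rw [h1, h2]
  simp [mul_comm]

/-- Every solution is a profile with linear boundary values: subtract the one whose weighted trace
is the orthogonal projection of the weighted trace of the solution. -/
lemma IsLinearizedSolution.exists_ae_eq_profile_id (hD : 1 < D) (hm : 2 ≤ m)
    {v : Space m → ℝ} {G : Space m → Space m} {τ : Bdry m → ℝ}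
    (hv : IsLinearizedSolution D v G τ) (hvl : IsWeightedLimit D v G τ) :
    ∃ b : Space m, v =ᵐ[halfVol m] profile D (lorentzScalar D 0 b) (lorentzVec D 0 b) id := by
  have hh := memLp_decay_mul_inner_spherePt (m := m) hD hm
  let T : Space m →ₗ[ℝ] Lp ℝ 2 (volume : Measure (Bdry m)) :=
    { toFun := fun ξ => (hh ξ).toLp _
      map_add' := fun ξ η => by
        rw [← MemLp.toLp_add]
        refine MemLp.toLp_congr _ _ (ae_of_all _ fun y => ?_)
        simp only [Pi.add_apply, inner_add_left]
        ring
      map_smul' := fun a ξ => by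
        rw [RingHom.id_apply, ← MemLp.toLp_const_smul]
        refine MemLp.toLp_congr _ _ (ae_of_all _ fun y => ?_)
        simp only [Pi.smul_apply, real_inner_smul_left, smul_eq_mul]
        ring }
  obtain ⟨c, hc⟩ := exists_forall_inner_map_eq_zero T (hvl.memLp_trace.toLp _)
  have hc' : ∀ ξ : Space m, ∫ y, (decay D (bdryPt y) * inner ℝ ξ (spherePt D y)) *
      (quad D (bdryPt y) ^ (-1 / 2 : ℝ) * τ y -
        decay D (bdryPt y) * inner ℝ c (spherePt D y)) = 0 := fun ξ => by
    have h := hc ξ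
    rw [show T ξ = (hh ξ).toLp _ from rfl, show T c = (hh c).toLp _ from rfl, ← MemLp.toLp_sub,
      inner_toLp_eq_integral] at h
    exact h
  have hadm := isAdmissible_id hD (-c)
  have hwl := hadm.isWeightedLimit hD hm
  have hzero := (hv.sub hD hvl (isLinearizedSolution_profile_id hD hm (-c))
    hwl).ae_eq_zero_of_orthogonal hD hm (hvl.sub hD hwl) fun ξ => by
      refine Eq.trans (integral_congr_ae (ae_of_all _ fun y => ?_)) (hc' ξ)
      beta_reduce
      rw [mul_sub (quad D (bdryPt y) ^ (-1 / 2 : ℝ)), rpow_mul_profile_id_bdryPt hD, inner_neg_left]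
      ring
  refine ⟨-c, ?_⟩
  filter_upwards [hzero] with x hx using sub_eq_zero.mp hx

end Uniqueness

section Bubble

variable {m : ℕ} {K H : ℝ}

lemma rho_eq_quad (x : Space m) : rho K H x = quad (scalingD m K H) x := by
  have hs : ∀ i : Fin m, shift (scalingD m K H) x (Fin.castSucc i) = x (Fin.castSucc i) :=
    fun i => by simp [shift, coordVec]
  rw [rho, quad, norm_sq_eq_sum, shift_last]
  simp only [hs]

lemma bubble_eq {x : Space m} (hq : 0 < quad (scalingD m K H) x) :
    bubble K H x = bubbleConst m K * quad (scalingD m K H) x ^ weight m := by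
  rw [bubble, rho_eq_quad, weight, neg_div, Real.rpow_neg hq.le, one_div]

lemma bubbleConst_pos (hm : 2 ≤ m) (hK : K < 0) : 0 < bubbleConst m K := by
  have hm' : (2 : ℝ) ≤ m := by exact_mod_cast hm
  have h1 : 0 < |K| := abs_pos.mpr hK.ne
  have h2 : 0 < 4 * dim m * (dim m - 1) := by
    simp only [dim, add_sub_cancel_right]
    positivity
  exact div_pos (Real.rpow_pos_of_pos h2 _) (Real.rpow_pos_of_pos h1 _)

lemma bubbleConst_rpow (hm : 2 ≤ m) (s : ℝ) :
    bubbleConst m K ^ (4 * s / (dim m - 2)) = (4 * dim m * (dim m - 1) / |K|) ^ s := by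
  have hm' : (2 : ℝ) ≤ m := by exact_mod_cast hm
  have h0 : dim m - 2 ≠ 0 := by
    have : 0 < dim m - 2 := by simp only [dim]; linarith
    exact this.ne'
  have h2 : 0 ≤ 4 * dim m * (dim m - 1) := by
    simp only [dim, add_sub_cancel_right]
    positivity
  have h3 : (dim m - 2) / 4 * (4 * s / (dim m - 2)) = s := by field_simp
  rw [bubbleConst, Real.div_rpow (Real.rpow_nonneg h2 _) (Real.rpow_nonneg (abs_nonneg K) _),
    ← Real.rpow_mul h2, ← Real.rpow_mul (abs_nonneg K), h3, Real.div_rpow h2 (abs_nonneg K)]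

lemma bubble_rpow (hm : 2 ≤ m) (hK : K < 0) {x : Space m}
    (hq : 0 < quad (scalingD m K H) x) (s : ℝ) :
    bubble K H x ^ (4 * s / (dim m - 2)) =
      (4 * dim m * (dim m - 1) / |K|) ^ s * quad (scalingD m K H) x ^ (-2 * s) := by
  have hm' : (2 : ℝ) ≤ m := by exact_mod_cast hm
  have h0 : dim m - 2 ≠ 0 := by
    have : 0 < dim m - 2 := by simp only [dim]; linarith
    exact this.ne'
  rw [bubble_eq hq, Real.mul_rpow (bubbleConst_pos hm hK).le (Real.rpow_nonneg hq.le _),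
    bubbleConst_rpow hm, ← Real.rpow_mul hq.le, weight]
  congr 2
  field_simp
  norm_num

lemma dim_mul_scalingD :
    dim m * scalingD m K H = dim m / 2 * H * (4 * dim m * (dim m - 1) / |K|) ^ (1 / 2 : ℝ) := by
  rw [← Real.sqrt_eq_rpow, mul_assoc 4, Real.sqrt_div' _ (abs_nonneg K),
    Real.sqrt_mul (by norm_num),
    show (4 : ℝ) = 2 ^ 2 by norm_num, Real.sqrt_sq (by norm_num), scalingD]
  ring

/-- The weak formulation, divided by `4(n-1)/(n-2)` and written in terms of `|z|² - 1`. -/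
lemma isLinearizedSolution_of_forall_test (hm : 2 ≤ m) (hK : K < 0)
    (hD : 1 < scalingD m K H) {v : Space m → ℝ} {G : Space m → Space m} {τ : Bdry m → ℝ}
    (h : ∀ φ : Space m → ℝ, IsTest φ →
      4 * (dim m - 1) / (dim m - 2) * ∫ x, inner ℝ (G x) (gradient φ x) ∂(halfVol m)
        + (dim m + 2) / (dim m - 2) * |K| *
            ∫ x, bubble K H x ^ (4 / (dim m - 2)) * v x * φ x ∂(halfVol m)
      = 4 * (dim m - 1) / (dim m - 2) *
          (dim m / 2 * H *
            ∫ y : Bdry m, bubble K H (bdryPt y) ^ (2 / (dim m - 2)) * τ y * φ (bdryPt y))) :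
    IsLinearizedSolution (scalingD m K H) v G τ := by
  intro φ hφ
  have hm' : (2 : ℝ) ≤ m := by exact_mod_cast hm
  have h0 : dim m - 2 ≠ 0 := by
    have : 0 < dim m - 2 := by simp only [dim]; linarith
    exact this.ne'
  have h1 : dim m - 1 ≠ 0 := by
    have : 0 < dim m - 1 := by simp only [dim]; linarith
    exact this.ne'
  have hK0 : |K| ≠ 0 := abs_ne_zero.mpr hK.ne
  have e1 : ∫ x, bubble K H x ^ (4 / (dim m - 2)) * v x * φ x ∂(halfVol m) =
      4 * dim m * (dim m - 1) / |K| *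
        ∫ x, (quad (scalingD m K H) x ^ (-1 : ℝ) * v x) *
          (quad (scalingD m K H) x ^ (-1 : ℝ) * φ x) ∂(halfVol m) := by
    rw [← integral_const_mul]
    refine integral_congr_ae ?_
    filter_upwards [ae_halfVol_nonneg] with x hx
    have hq := quad_pos' hD hx
    have h2 := bubble_rpow hm hK hq 1
    rw [mul_one, Real.rpow_one, show (-2 : ℝ) * 1 = -1 + -1 by norm_num, Real.rpow_add hq] at h2
    rw [h2]
    ring
  have e2 : ∫ y : Bdry m, bubble K H (bdryPt y) ^ (2 / (dim m - 2)) * τ y * φ (bdryPt y) =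
      (4 * dim m * (dim m - 1) / |K|) ^ (1 / 2 : ℝ) *
        ∫ y, (quad (scalingD m K H) (bdryPt y) ^ (-1 / 2 : ℝ) * τ y) *
          (quad (scalingD m K H) (bdryPt y) ^ (-1 / 2 : ℝ) * φ (bdryPt y)) := by
    rw [← integral_const_mul]
    refine integral_congr_ae (ae_of_all _ fun y => ?_)
    have hq : 0 < quad (scalingD m K H) (bdryPt y) := quad_pos' hD (by simp)
    have h2 := bubble_rpow hm hK hq (1 / 2)
    rw [show (4 : ℝ) * (1 / 2) = 2 by norm_num,
      show (-2 : ℝ) * (1 / 2) = -1 / 2 + -1 / 2 by norm_num,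
      Real.rpow_add hq] at h2
    beta_reduce
    rw [h2]
    ring
  have h3 := h φ hφ
  rw [e1, e2, ← mul_assoc (dim m / 2 * H), ← dim_mul_scalingD] at h3
  rw [linearizedForm]
  generalize ∫ x, (quad (scalingD m K H) x ^ (-1 : ℝ) * v x) *
    (quad (scalingD m K H) x ^ (-1 : ℝ) * φ x) ∂(halfVol m) = J₁ at h3 ⊢
  generalize ∫ y, (quad (scalingD m K H) (bdryPt y) ^ (-1 / 2 : ℝ) * τ y) *
    (quad (scalingD m K H) (bdryPt y) ^ (-1 / 2 : ℝ) * φ (bdryPt y)) = J₂ at h3 ⊢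
  generalize ∫ x, inner ℝ (G x) (gradient φ x) ∂(halfVol m) = J₃ at h3 ⊢
  field_simp at h3
  linear_combination h3

lemma hasFDerivAt_bubble {x : Space m} (hq : 0 < quad (scalingD m K H) x) :
    HasFDerivAt (bubble K H) ((bubbleConst m K * (2 * weight m *
      quad (scalingD m K H) x ^ (weight m - 1))) • innerSL ℝ (shift (scalingD m K H) x)) x := by
  have h1 := (hasFDerivAt_quad_rpow (weight m) hq).const_mul (bubbleConst m K)
  rw [smul_smul] at h1
  refine h1.congr_of_eventuallyEq ?_
  filter_upwards [(hasFDerivAt_quad (scalingD m K H) x).continuousAt.eventually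
    (lt_mem_nhds hq)] with y hy
  exact bubble_eq hy

lemma rpow_weight_sub_one {q : ℝ} (hq : 0 < q) : q ^ (weight m - 1) = (q ^ (dim m / 2))⁻¹ := by
  rw [← Real.rpow_neg hq.le, weight]
  ring_nf

lemma zTan_eq {x : Space m} (hq : 0 < quad (scalingD m K H) x) (i : Fin m) :
    zTan K H i x = bubbleConst m K *
      ((2 - dim m) * x (Fin.castSucc i) / rho K H x ^ (dim m / 2)) := by
  have hs : shift (scalingD m K H) x (Fin.castSucc i) = x (Fin.castSucc i) := by
    simp [shift, coordVec]
  rw [zTan, (hasFDerivAt_bubble hq).fderiv, rho_eq_quad, rpow_weight_sub_one hq]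
  simp only [smul_apply, innerSL_apply_apply, coordVec, EuclideanSpace.inner_single_right, hs,
    smul_eq_mul, weight]
  simp
  ring

lemma zDil_eq {x : Space m} (hq : 0 < quad (scalingD m K H) x) :
    zDil K H x = bubbleConst m K * ((dim m - 2) / 2) *
      ((‖x‖ ^ 2 + 1 - scalingD m K H ^ 2) / rho K H x ^ (dim m / 2)) := by
  have h1 : inner ℝ (gradient (bubble K H) x) (shift (scalingD m K H) x) =
      fderiv ℝ (bubble K H) x (shift (scalingD m K H) x) := by
    rw [gradient_eq_toDual_symm, InnerProductSpace.toDual_symm_apply]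
  have h2 : quad (scalingD m K H) x ^ weight m =
      quad (scalingD m K H) x ^ (weight m - 1) * quad (scalingD m K H) x := by
    rw [← Real.rpow_add_one hq.ne', sub_add_cancel]
  have h3 : inner ℝ (shift (scalingD m K H) x) (coordVec (Fin.last m)) =
      x (Fin.last m) + scalingD m K H := by
    rw [coordVec, EuclideanSpace.inner_single_right, shift_last]
    simp
  rw [zDil, ← shift, h1, (hasFDerivAt_bubble hq).fderiv, bubble_eq hq, rho_eq_quad, h2]
  simp only [smul_apply, innerSL_apply_apply, smul_eq_mul, real_inner_self_eq_norm_sq,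
    norm_shift_sq, h3]
  rw [rpow_weight_sub_one hq, weight]
  have h4 := quad_eq (scalingD m K H) x
  linear_combination (bubbleConst m K * ((dim m - 2) / 2) *
    (quad (scalingD m K H) x ^ (dim m / 2))⁻¹) * h4

/-- The profiles with linear boundary values are linear combinations of the functions `𝔷_i`. -/
lemma exists_profile_id_eq_sum (hm : 2 ≤ m) (hK : K < 0) (hD : 1 < scalingD m K H) (b : Space m) :
    ∃ (c : Fin m → ℝ) (d : ℝ), ∀ x : Space m, 0 ≤ x (Fin.last m) →
      profile (scalingD m K H) (lorentzScalar (scalingD m K H) 0 b)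
        (lorentzVec (scalingD m K H) 0 b) id x =
      (∑ i : Fin m, c i * zTan K H i x) + d * zDil K H x := by
  have hm' : (2 : ℝ) ≤ m := by exact_mod_cast hm
  have h0 : dim m - 2 ≠ 0 := by
    have : 0 < dim m - 2 := by simp only [dim]; linarith
    exact this.ne'
  have hC := (bubbleConst_pos (K := K) hm hK).ne'
  refine ⟨fun i => 2 * √(scalingD m K H ^ 2 - 1) * b (Fin.castSucc i) /
    (bubbleConst m K * (dim m - 2)), -2 * b (Fin.last m) / (bubbleConst m K * (dim m - 2)),
    fun x hx => ?_⟩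
  have hq := quad_pos' hD hx
  have h1 := ratio_lorentz_mul_quad hD 0 b hx
  have h2 : quad (scalingD m K H) x ^ weight m =
      quad (scalingD m K H) x ^ (weight m - 1) * quad (scalingD m K H) x := by
    rw [← Real.rpow_add_one hq.ne', sub_add_cancel]
  simp only [zTan_eq hq, zDil_eq hq, rho_eq_quad]
  rw [profile, id, h2, mul_assoc, mul_comm (quad _ x) (ratio _ _ _ x), h1,
    rpow_weight_sub_one hq]
  have h3 : ∀ i : Fin m, 2 * √(scalingD m K H ^ 2 - 1) * b (Fin.castSucc i) /
      (bubbleConst m K * (dim m - 2)) * (bubbleConst m K * ((2 - dim m) * x (Fin.castSucc i) /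
        quad (scalingD m K H) x ^ (dim m / 2))) =
      -(2 * √(scalingD m K H ^ 2 - 1) * (quad (scalingD m K H) x ^ (dim m / 2))⁻¹) *
        (b (Fin.castSucc i) * x (Fin.castSucc i)) := fun i => by
    field_simp
    ring
  rw [Finset.sum_congr rfl fun i _ => h3 i, ← Finset.mul_sum]
  field_simp
  ring

end Bubble

end HalfSpaceBubble

theorem theorem2p1 (m : ℕ) (hm : 2 ≤ m) (K H : ℝ) (hK : K < 0) (hH : 0 < H)
    (hD : 1 < HalfSpaceBubble.scalingD m K H) :
    (∀ v : HalfSpaceBubble.Space m → ℝ,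
      HalfSpaceBubble.MemH1 v → HalfSpaceBubble.IsWeakSolution K H v →
      ∃ (c : Fin m → ℝ) (d : ℝ), ∀ᵐ x ∂(HalfSpaceBubble.halfVol m),
        v x = (∑ i : Fin m, c i * HalfSpaceBubble.zTan K H i x)
          + d * HalfSpaceBubble.zDil K H x) ∧
    (∀ x : HalfSpaceBubble.Space m, 0 ≤ x (Fin.last m) →
      (∀ i : Fin m, HalfSpaceBubble.zTan K H i x =
        HalfSpaceBubble.bubbleConst m K *
          ((2 - HalfSpaceBubble.dim m) * x (Fin.castSucc i)
            / HalfSpaceBubble.rho K H x ^ (HalfSpaceBubble.dim m / 2))) ∧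
      HalfSpaceBubble.zDil K H x =
        HalfSpaceBubble.bubbleConst m K * ((HalfSpaceBubble.dim m - 2) / 2) *
          ((‖x‖ ^ 2 + 1 - HalfSpaceBubble.scalingD m K H ^ 2)
            / HalfSpaceBubble.rho K H x ^ (HalfSpaceBubble.dim m / 2))) := by
  refine ⟨fun v _ ⟨G, τ, hvG, hτ, hsol⟩ => ?_, fun x hx =>
    ⟨fun i => HalfSpaceBubble.zTan_eq (HalfSpaceBubble.quad_pos' hD hx) i,
      HalfSpaceBubble.zDil_eq (HalfSpaceBubble.quad_pos' hD hx)⟩⟩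
  obtain ⟨b, hb⟩ := (HalfSpaceBubble.isLinearizedSolution_of_forall_test hm hK hD
    hsol).exists_ae_eq_profile_id hD hm (hτ.isWeightedLimit hD hvG)
  obtain ⟨c, d, hcd⟩ := HalfSpaceBubble.exists_profile_id_eq_sum hm hK hD b
  refine ⟨c, d, ?_⟩
  filter_upwards [hb, HalfSpaceBubble.ae_halfVol_nonneg] with x hx hx0
  rw [hx, hcd x hx0]
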